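/- A cell is a unit square $[a,a+(1,1)]$ of $\mathbb{Z}^2$. A polyomino is a non-empty finite set $\mathcal{P}$ of cells such that any two of its cells are joined by a path of cells of $\mathcal{P}$ in which consecutive cells share an edge; it is simple if any two cells not in $\mathcal{P}$ are joined by such a path of cells not in $\mathcal{P}$. For a finite set $\mathcal{P}$ of cells let $V(\mathcal{P})$ be the set of vertices of its cells and $\operatorname{rank}\mathcal{P}$ the number of its cells. Let $K$ be a field, $S_{\mathcal{P}}=K[x_v : v\in V(\mathcal{P})]$, let $I_{\mathcal{P}}\subset S_{\mathcal{P}}$ be the ideal generated by the binomials $x_ax_b-x_cx_d$, where $[a,b]$ runs over the intervals $\{(m,n): i\le m\le k,\ j\le n\le l\}$ with $a=(i,j)$, $b=(k,l)$, $i<k$, $j<l$, all of whose cells belong to $\mathcal{P}$, and $c=(i,l)$, $d=(k,j)$; put $K[\mathcal{P}]=S_{\mathcal{P}}/I_{\mathcal{P}}$ with its standard grading. Let $\mathrm{HP}_{K[\mathcal{P}]}(t)=\sum_{k\ge 0}\dim_K K[\mathcal{P}]_k\,t^k$ and let $h_{K[\mathcal{P}]}(t)\in\mathbb{Z}[t]$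 be the polynomial with $h_{K[\mathcal{P}]}(1)\ne 0$ and $\mathrm{HP}_{K[\mathcal{P}]}(t)=h_{K[\mathcal{P}]}(t)/(1-t)^{d}$, where $d$ is the Krull dimension of $K[\mathcal{P}]$. Let $A$ be a cell, let $r,s\ge 2$, let $A_1,\dots,A_r$ be the consecutive cells to the right of $A$ and $B_1,\dots,B_s$ the consecutive cells above $A$. Put $[A,A_r]=\{A,A_1,\dots,A_r\}$, $[A,B_s]=\{A,B_1,\dots,B_s\}$ and $\mathcal{L}=[A,A_r]\cup[A,B_s]$. Let $d_i$ and $a_i$ be the upper left and upper right corners of $B_i$, and $b_j$ and $c_j$ the upper right and lower right corners of $A_j$. A polyomino $\mathcal{P}$ is an $(\mathcal{L},\mathcal{C})$-polyomino, for a polyomino $\mathcal{C}$, if $\mathcal{P}$ is the disjoint union of the sets of cells $\mathcal{L}$ and $\mathcal{C}$, and $V(\mathcal{L})\cap V(\mathcal{C})$ is one of the four sets $\{a_{s-1},a_s,b_{r-1},b_r\}$, $\{a_{s-1},a_s,c_{r-1},c_r\}$, $\{d_{s-1},d_s,b_{r-1},b_r\}$, $\{d_{s-1},d_s,c_{r-1},c_r\}$.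 In this case put $\mathcal{P}_1=\mathcal{P}\setminus[A,A_r]$, $\mathcal{P}_2=\mathcal{P}\setminus[A,B_s]$, $\mathcal{P}_3=\mathcal{P}\setminus([A,A_r]\cup[A,B_s])=\mathcal{C}$ and $\mathcal{P}_4=\mathcal{P}\setminus\{A,A_1,B_1\}$. **Corollary.** Let $\mathcal{P}$ be an $(\mathcal{L},\mathcal{C})$-polyomino such that $I_{\mathcal{P}}$ is a prime ideal and $\mathcal{C}$ is a simple polyomino. Then $$\mathrm{HP}_{K[\mathcal{P}]}(t)=\frac{h_{K[\mathcal{P}_4]}(t)+t\big[h_{K[\mathcal{P}_1]}(t)+h_{K[\mathcal{P}_2]}(t)+(1-t)\,h_{K[\mathcal{P}_3]}(t)\big]}{(1-t)^{|V(\mathcal{P})|-\operatorname{rank}\mathcal{P}}},$$ and $K[\mathcal{P}]$ has Krull dimension $|V(\mathcal{P})|-\operatorname{rank}\mathcal{P}$. -/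

import Mathlib

namespace Polyomino

/-- A cell of `ℤ²`, encoded by its lower left corner: `(i, j)` stands for the cell
`[(i, j), (i + 1, j + 1)]`. -/
abbrev Cell : Type := ℤ × ℤ

/-- A lattice point of `ℤ²`. -/
abbrev Vertex : Type := ℤ × ℤ

/-- The four vertices of a cell: lower left, upper right, upper left, lower right. -/
def cellVertices (c : Cell) : Finset Vertex :=
  {(c.1, c.2), (c.1 + 1, c.2 + 1), (c.1, c.2 + 1), (c.1 + 1, c.2)}

/-- The four edges of a cell, each as the pair of its end points. -/
def cellEdges (c : Cell) : Finset (Finset Vertex) :=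
  {{(c.1, c.2), (c.1, c.2 + 1)}, {(c.1, c.2 + 1), (c.1 + 1, c.2 + 1)},
    {(c.1 + 1, c.2 + 1), (c.1 + 1, c.2)}, {(c.1, c.2), (c.1 + 1, c.2)}}

/-- The graph on all cells of `ℤ²`: two distinct cells are adjacent when they intersect in a
common edge. -/
def cellGraph : SimpleGraph Cell where
  Adj c d := c ≠ d ∧ cellVertices c ∩ cellVertices d ∈ cellEdges c ∧
    cellVertices c ∩ cellVertices d ∈ cellEdges d
  symm := ⟨fun c d h => ⟨h.1.symm, by
    rw [Finset.inter_comm (cellVertices d)]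
    exact ⟨h.2.2, h.2.1⟩⟩⟩
  loopless := ⟨fun _ h => h.1 rfl⟩

/-- The set `V(P)` of vertices of a finite collection of cells. -/
def vertices (P : Finset Cell) : Finset Vertex := P.biUnion cellVertices

/-- There are at least as many vertices as cells, so `|V(P)| - rank P` never truncates. -/
theorem card_le_card_vertices (P : Finset Cell) : P.card ≤ (vertices P).card := by
  refine Finset.card_le_card fun c hc => Finset.mem_biUnion.2 ⟨c, hc, ?_⟩
  simp [cellVertices]

/-- A polyomino: a non-empty finite collection of cells, any two of which are joined by a path
of cells inside the collection. -/
def IsPolyomino (P : Finset Cell) : Prop :=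
  P.Nonempty ∧ (cellGraph.induce (P : Set Cell)).Preconnected

/-- A polyomino is simple if any two cells outside it are joined by a path of cells
outside it. -/
def IsSimple (P : Finset Cell) : Prop :=
  (cellGraph.induce ((P : Set Cell)ᶜ)).Preconnected

/-- `[a, b]` is an inner interval of `P`: a proper interval of `ℤ²` all of whose cells
belong to `P`. -/
def IsInnerInterval (P : Finset Cell) (a b : Vertex) : Prop :=
  a.1 < b.1 ∧ a.2 < b.2 ∧ Finset.Icc a (b.1 - 1, b.2 - 1) ⊆ P

/-- The four corners of an inner interval of `P` are vertices of `P`. -/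
theorem IsInnerInterval.corners_mem {P : Finset Cell} {a b : Vertex}
    (h : IsInnerInterval P a b) :
    a ∈ vertices P ∧ b ∈ vertices P ∧ (a.1, b.2) ∈ vertices P ∧ (b.1, a.2) ∈ vertices P := by
  obtain ⟨h1, h2, h3⟩ := h
  have key : ∀ x y : ℤ, a.1 ≤ x → x ≤ b.1 - 1 → a.2 ≤ y → y ≤ b.2 - 1 → (x, y) ∈ P :=
    fun x y hx hx' hy hy' => h3 (Finset.mem_Icc.2 ⟨⟨hx, hy⟩, ⟨hx', hy'⟩⟩)
  refine ⟨Finset.mem_biUnion.2 ⟨(a.1, a.2), key _ _ ?_ ?_ ?_ ?_, ?_⟩,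
    Finset.mem_biUnion.2 ⟨(b.1 - 1, b.2 - 1), key _ _ ?_ ?_ ?_ ?_, ?_⟩,
    Finset.mem_biUnion.2 ⟨(a.1, b.2 - 1), key _ _ ?_ ?_ ?_ ?_, ?_⟩,
    Finset.mem_biUnion.2 ⟨(b.1 - 1, a.2), key _ _ ?_ ?_ ?_ ?_, ?_⟩⟩ <;>
  first
  | omega
  | simp [cellVertices]

/-- The polyomino ideal `I_P` in `S_P = K[x_v | v ∈ V(P)]`, generated by the inner 2-minors
`x_a x_b - x_c x_d`, for `[a, b]` an inner interval with anti-diagonal corners `c`, `d`. -/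
noncomputable def polyominoIdeal (K : Type*) [Field K] (P : Finset Cell) :
    Ideal (MvPolynomial {v : Vertex // v ∈ vertices P} K) :=
  Ideal.span {f | ∃ a b c d : {v : Vertex // v ∈ vertices P},
    IsInnerInterval P a.1 b.1 ∧ c.1 = (a.1.1, b.1.2) ∧ d.1 = (b.1.1, a.1.2) ∧
    f = MvPolynomial.X a * MvPolynomial.X b - MvPolynomial.X c * MvPolynomial.X d}

/-- The coordinate ring `K[P] = S_P / I_P`. -/
abbrev CoordinateRing (K : Type*) [Field K] (P : Finset Cell) : Type _ :=
  MvPolynomial {v : Vertex // v ∈ vertices P} K ⧸ polyominoIdeal K P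

/-- The homogeneous component of degree `k` of `K[P]`: the image of the homogeneous polynomials
of degree `k`. -/
noncomputable def gradedPart (K : Type*) [Field K] (P : Finset Cell) (k : ℕ) :
    Submodule K (CoordinateRing K P) :=
  (MvPolynomial.homogeneousSubmodule {v : Vertex // v ∈ vertices P} K k).map
    (Ideal.Quotient.mkₐ K (polyominoIdeal K P)).toLinearMap

/-- The Hilbert-Poincaré series of `K[P]`. -/
noncomputable def hilbertSeries (K : Type*) [Field K] (P : Finset Cell) : PowerSeries ℤ :=
  PowerSeries.mk fun k => (Module.finrank K (gradedPart K P k) : ℤ)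

/-- `h` is the `h`-polynomial of `K[P]`: the Hilbert-Poincaré series is `h(t) / (1 - t) ^ d`,
where `d` is the Krull dimension of `K[P]`, and `h(1) ≠ 0`. -/
def IsHPolynomial (K : Type*) [Field K] (P : Finset Cell) (h : Polynomial ℤ) : Prop :=
  h.eval 1 ≠ 0 ∧ ∃ d : ℕ, ringKrullDim (CoordinateRing K P) = d ∧
    hilbertSeries K P * (1 - PowerSeries.X) ^ d = (h : PowerSeries ℤ)

/-- The `h`-polynomial is unique. -/
theorem IsHPolynomial.unique {K : Type*} [Field K] {P : Finset Cell} {h h' : Polynomial ℤ}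
    (H : IsHPolynomial K P h) (H' : IsHPolynomial K P h') : h = h' := by
  obtain ⟨-, d, hd, e⟩ := H
  obtain ⟨-, d', hd', e'⟩ := H'
  have hdd : d = d' := by
    have := hd.symm.trans hd'
    exact_mod_cast this
  subst hdd
  exact Polynomial.coe_injective ℤ (e.symm.trans e')

/-- The cell `A_j`, `j` steps to the right of `A`. -/
def cellRight (A : Cell) (j : ℕ) : Cell := (A.1 + j, A.2)

/-- The cell `B_i`, `i` steps above `A`. -/
def cellUp (A : Cell) (i : ℕ) : Cell := (A.1, A.2 + i)

/-- The cell interval `[A, A_r]`, consisting of `A, A_1, …, A_r`. -/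
noncomputable def horizontalArm (A : Cell) (r : ℕ) : Finset Cell := Finset.Icc A (cellRight A r)

/-- The cell interval `[A, B_s]`, consisting of `A, B_1, …, B_s`. -/
noncomputable def verticalArm (A : Cell) (s : ℕ) : Finset Cell := Finset.Icc A (cellUp A s)

/-- `a_i`, the upper right corner of `B_i`. -/
def vertexA (A : Cell) (i : ℕ) : Vertex := ((cellUp A i).1 + 1, (cellUp A i).2 + 1)

/-- `d_i`, the upper left corner of `B_i`. -/
def vertexD (A : Cell) (i : ℕ) : Vertex := ((cellUp A i).1, (cellUp A i).2 + 1)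

/-- `b_j`, the upper right corner of `A_j`. -/
def vertexB (A : Cell) (j : ℕ) : Vertex := ((cellRight A j).1 + 1, (cellRight A j).2 + 1)

/-- `c_j`, the lower right corner of `A_j`. -/
def vertexC (A : Cell) (j : ℕ) : Vertex := ((cellRight A j).1 + 1, (cellRight A j).2)

/-- `P` is an `(L, C)`-polyomino, where `L = [A, A_r] ∪ [A, B_s]`. The four possibilities for
`V(L) ∩ V(C)` are pairwise different sets, so exactly one of them occurs. -/
structure IsLCPolyomino (P : Finset Cell) (A : Cell) (r s : ℕ) (C : Finset Cell) : Prop where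
  two_le_r : 2 ≤ r
  two_le_s : 2 ≤ s
  isPolyomino : IsPolyomino P
  isPolyomino_C : IsPolyomino C
  eq_union : P = (horizontalArm A r ∪ verticalArm A s) ∪ C
  disjoint : Disjoint (horizontalArm A r ∪ verticalArm A s) C
  inter :
    vertices (horizontalArm A r ∪ verticalArm A s) ∩ vertices C =
        {vertexA A (s - 1), vertexA A s, vertexB A (r - 1), vertexB A r} ∨
    vertices (horizontalArm A r ∪ verticalArm A s) ∩ vertices C =
        {vertexA A (s - 1), vertexA A s, vertexC A (r - 1), vertexC A r} ∨
    vertices (horizontalArm A r ∪ verticalArm A s) ∩ vertices C =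
        {vertexD A (s - 1), vertexD A s, vertexB A (r - 1), vertexB A r} ∨
    vertices (horizontalArm A r ∪ verticalArm A s) ∩ vertices C =
        {vertexD A (s - 1), vertexD A s, vertexC A (r - 1), vertexC A r}

end Polyomino

/-! The ideal `polyominoIdeal` is generated by binomials, so the residue classes of monomials are
linearly independent (`linearIndepOn_monomialSet`) and the Hilbert function counts these classes.
The theorem thus becomes a statement about counting monomials modulo exchange relations.

Say that $\mathcal{C}$ is glued to the side $y=\alpha$ of the horizontal arm and to the side
$x=\beta$ of the vertical arm; the opposite sides $y=\upsilon$ and $x=\gamma$ are detached. The cell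
$A$ has corners $o=(\beta,\alpha)$, $q=(\gamma,\alpha)$, $q'=(\beta,\upsilon)$,
$p=(\gamma,\upsilon)$. Let $W_1$ and $W_2$ be the vertices off the detached side of the horizontal
and of the vertical arm. Every monomial class of positive degree is of exactly one of the forms $pm$
with $m$ arbitrary, $qm$ with $m$ in $W_1$, $q'm$ with $m$ in $W_2$, $om$ with $m$ in $W_1\cap W_2$,
or $m$ avoiding all four corners. Existence: the minors of the arms trade a factor outside the
allowed set for a corner earlier in this list. Uniqueness: each of these vertex sets contains both
or none of the diagonals of every inner interval, so killing the other variables is a well-defined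
endomorphism of the domain $K[\mathcal{P}]$ (`isRetract_of_closed`). With $H_W$ the series of
monomials in $W$, this gives (`monomialSeries_decomposition`, `hilbertSeries_mul_one_sub_X`)
$$(1-t)\,\mathrm{HP}_{K[\mathcal{P}]}=\mathrm{HP}_{K[\mathcal{P}_4]}+t\,(H_{W_1}+H_{W_2}+H_{W_1\cap
W_2}).$$ The monomials in $W_1$, $W_2$, $W_1\cap W_2$ are those of $K[\mathcal{P}_1]$,
$K[\mathcal{P}_2]$, $K[\mathcal{C}]$ with $r-2$, $s-2$, $r+s-3$ extra free variables
(`rowFace_series`, `colFace_series`, `rowFace_inter_colFace_series`). The rings $K[\mathcal{P}_i]$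
embed in $K[\mathcal{P}]$, so they are domains.

For any collection of cells whose coordinate ring is a domain, the variables at vertices that are
not lower left corners of cells form a transcendence basis. Hence the Krull dimension is the number
of vertices minus the number of cells (`ringKrullDim_coordinateRing`), and the growth of the Hilbert
function shows that the pole order at 1 is the same number (`exists_isHPolynomial`). Comparing these
numbers for $\mathcal{P}$ and the $\mathcal{P}_i$ gives the formula; the pole order for
$\mathcal{C}$ is one too small, whence the factor $1-t$ at $h_{K[\mathcal{P}_3]}$. -/

namespace Polyomino

/-! ### Values of monomials in a commutative monoid -/

section Monomials

variable {R V : Type*} [CommMonoid R] (y : V → R)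

/-- The set of values of the monomials of degree `k` in the variables `y w`, `w ∈ W`. -/
def monomialSet (W : Set V) (k : ℕ) : Set R :=
  {x | ∃ s : Multiset V, (∀ v ∈ s, v ∈ W) ∧ s.card = k ∧ (s.map y).prod = x}

variable {y}

theorem monomialSet_zero (W : Set V) : monomialSet y W 0 = {1} := by
  ext x
  constructor
  · rintro ⟨s, -, hs, rfl⟩
    simp [Multiset.card_eq_zero.1 hs]
  · rintro rfl
    exact ⟨0, by simp, by simp, by simp⟩

theorem monomialSet_mono {W W' : Set V} (h : W ⊆ W') (k : ℕ) :
    monomialSet y W k ⊆ monomialSet y W' k := by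
  rintro x ⟨s, hs, hk, rfl⟩
  exact ⟨s, fun v hv => h (hs v hv), hk, rfl⟩

theorem mul_mem_monomialSet {W : Set V} {k : ℕ} {v : V} (hv : v ∈ W) {x : R}
    (hx : x ∈ monomialSet y W k) : y v * x ∈ monomialSet y W (k + 1) := by
  obtain ⟨s, hs, hk, rfl⟩ := hx
  refine ⟨v ::ₘ s, ?_, by simp [hk], by simp⟩
  intro w hw
  rcases Multiset.mem_cons.1 hw with rfl | hw
  exacts [hv, hs w hw]

theorem monomialSet_finite {W : Set V} (hW : W.Finite) (k : ℕ) : (monomialSet y W k).Finite := by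
  induction k with
  | zero => simp [monomialSet_zero]
  | succ k ih =>
    refine (hW.image2 (fun v x => y v * x) ih).subset ?_
    rintro x ⟨s, hs, hk, rfl⟩
    obtain ⟨v, t, rfl, ht⟩ := Multiset.card_eq_succ_iff.1 hk
    exact ⟨v, hs v (by simp), _, ⟨t, fun w hw => hs w (by simp [hw]), ht, rfl⟩, by simp⟩

theorem map_mem_monomialSet {R' V' : Type*} [CommMonoid R'] {y' : V' → R'} {W : Set V}
    {W' : Set V'} (f : R →* R') (g : V → V') (hg : ∀ v ∈ W, g v ∈ W')
    (hf : ∀ v ∈ W, f (y v) = y' (g v)) {k : ℕ} {x : R} (hx : x ∈ monomialSet y W k) :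
    f x ∈ monomialSet y' W' k := by
  obtain ⟨s, hs, hk, rfl⟩ := hx
  refine ⟨s.map g, ?_, by simp [hk], ?_⟩
  · intro v hv
    obtain ⟨w, hw, rfl⟩ := Multiset.mem_map.1 hv
    exact hg w (hs w hw)
  · rw [map_multiset_prod, Multiset.map_map, Multiset.map_map]
    exact congrArg _ (Multiset.map_congr rfl fun v hv => (hf v (hs v hv)).symm)

end Monomials

/-! ### Monomial basis of the coordinate ring -/

section CoordinateRing

variable (K : Type*) [Field K] (P : Finset Cell)

/-- The residue class of the variable `x_v` in `K[P]`, and `0` if `v` is not a vertex of `P`. -/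
noncomputable def vertexVar (v : Vertex) : CoordinateRing K P :=
  if h : v ∈ vertices P then Ideal.Quotient.mk (polyominoIdeal K P) (MvPolynomial.X ⟨v, h⟩) else 0

variable {K P}

theorem vertexVar_of_mem {v : Vertex} (h : v ∈ vertices P) :
    vertexVar K P v = Ideal.Quotient.mk (polyominoIdeal K P) (MvPolynomial.X ⟨v, h⟩) :=
  dif_pos h

theorem vertexVar_mul {a b : Vertex} (h : IsInnerInterval P a b) :
    vertexVar K P a * vertexVar K P b = vertexVar K P (a.1, b.2) * vertexVar K P (b.1, a.2) := by
  obtain ⟨ha, hb, hc, hd⟩ := h.corners_mem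
  rw [vertexVar_of_mem ha, vertexVar_of_mem hb, vertexVar_of_mem hc, vertexVar_of_mem hd,
    ← RingHom.map_mul, ← RingHom.map_mul, Ideal.Quotient.eq]
  exact Ideal.subset_span ⟨⟨a, ha⟩, ⟨b, hb⟩, ⟨_, hc⟩, ⟨_, hd⟩, h, rfl, rfl, rfl⟩

section Lift

variable {B : Type*} [CommRing B] [Algebra K B] (z : Vertex → B)

/-- The algebra homomorphism from `K[P]` sending `x_v` to `z v`. -/
noncomputable def liftVertex (hz : ∀ a b, IsInnerInterval P a b →
      z a * z b = z (a.1, b.2) * z (b.1, a.2)) : CoordinateRing K P →ₐ[K] B :=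
  Ideal.Quotient.liftₐ (polyominoIdeal K P) (MvPolynomial.aeval fun v => z v.1) <| by
    intro f hf
    have : polyominoIdeal K P ≤ RingHom.ker (MvPolynomial.aeval (R := K)
        (fun v : {v : Vertex // v ∈ vertices P} => z v.1)) := by
      refine Ideal.span_le.2 ?_
      rintro f ⟨a, b, c, d, h, hc, hd, rfl⟩
      simp [RingHom.mem_ker, hc, hd, hz _ _ h]
    exact this hf

theorem liftVertex_vertexVar {z : Vertex → B} (hz : ∀ a b, IsInnerInterval P a b →
    z a * z b = z (a.1, b.2) * z (b.1, a.2)) {v : Vertex} (hv : v ∈ vertices P) :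
    liftVertex z hz (vertexVar K P v) = z v := by
  rw [vertexVar_of_mem hv]
  exact MvPolynomial.aeval_X _ _

theorem coordinateRing_algHom_ext {f g : CoordinateRing K P →ₐ[K] B}
    (h : ∀ v ∈ vertices P, f (vertexVar K P v) = g (vertexVar K P v)) : f = g := by
  apply Ideal.Quotient.algHom_ext
  apply MvPolynomial.algHom_ext
  rintro ⟨v, hv⟩
  have := h v hv
  rw [vertexVar_of_mem hv] at this
  exact this

end Lift

/-- The point with all coordinates 1 satisfies every inner minor. -/
theorem vertexVar_ne_zero {v : Vertex} (hv : v ∈ vertices P) : vertexVar K P v ≠ 0 := by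
  intro h
  have := liftVertex_vertexVar (K := K) (P := P) (z := fun _ => (1 : K)) (by simp) hv
  rw [h, map_zero] at this
  exact zero_ne_one this

theorem mk_monomial (m : {v : Vertex // v ∈ vertices P} →₀ ℕ) (c : K) :
    Ideal.Quotient.mk (polyominoIdeal K P) (MvPolynomial.monomial m c) =
      c • ((m.toMultiset.map Subtype.val).map (vertexVar K P)).prod := by
  rw [MvPolynomial.monomial_eq, ← MvPolynomial.smul_eq_C_mul, ← Ideal.Quotient.mkₐ_eq_mk K,
    map_smul, Multiset.map_map]
  congr 1
  rw [Finsupp.toMultiset_map, Finsupp.prod_toMultiset, Finsupp.prod_mapDomain_index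
    (fun _ => pow_zero _) (fun _ _ _ => pow_add _ _ _), Finsupp.prod, Finsupp.prod, map_prod]
  refine Finset.prod_congr rfl fun v _ => ?_
  simp [vertexVar_of_mem v.2]

theorem isHomogeneous_multiset_prod_X {σ : Type*} (s : Multiset σ) :
    (s.map (MvPolynomial.X : σ → MvPolynomial σ K)).prod.IsHomogeneous s.card := by
  induction s using Multiset.induction_on with
  | empty => simpa using MvPolynomial.isHomogeneous_one σ K
  | cons v s ih =>
    rw [Multiset.map_cons, Multiset.prod_cons, Multiset.card_cons, add_comm]
    exact (MvPolynomial.isHomogeneous_X K v).mul ih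

theorem gradedPart_eq_span (k : ℕ) :
    gradedPart K P k = Submodule.span K (monomialSet (vertexVar K P) (vertices P) k) := by
  apply le_antisymm
  · rintro _ ⟨p, hp, rfl⟩
    have hp' : p.IsHomogeneous k := hp
    rw [← MvPolynomial.support_sum_monomial_coeff p, map_sum]
    refine Submodule.sum_mem _ fun m hm => ?_
    have hdeg : m.degree = k := by
      rw [Finsupp.degree_eq_weight_one]
      exact hp' (MvPolynomial.mem_support_iff.1 hm)
    have := mk_monomial m (p.coeff m)
    refine (show _ = _ from this) ▸ Submodule.smul_mem _ _ (Submodule.subset_span ?_)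
    refine ⟨_, ?_, ?_, rfl⟩
    · intro v hv
      obtain ⟨w, -, rfl⟩ := Multiset.mem_map.1 hv
      exact w.2
    · rw [Multiset.card_map, Finsupp.card_toMultiset, ← hdeg]
      rfl
  · refine Submodule.span_le.2 ?_
    rintro x ⟨s, hs, hk, rfl⟩
    let t : Multiset {v : Vertex // v ∈ vertices P} := s.attach.map fun v => ⟨v.1, hs v.1 v.2⟩
    have ht : t.map Subtype.val = s := by
      rw [Multiset.map_map]
      exact Multiset.attach_map_val s
    refine ⟨(t.map MvPolynomial.X).prod, ?_, ?_⟩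
    · rw [SetLike.mem_coe, MvPolynomial.mem_homogeneousSubmodule, ← hk, ← ht, Multiset.card_map]
      exact isHomogeneous_multiset_prod_X t
    · rw [AlgHom.toLinearMap_apply, map_multiset_prod, Multiset.map_map]
      conv_rhs => rw [← ht, Multiset.map_map]
      refine congrArg _ (Multiset.map_congr rfl fun v _ => ?_)
      exact (vertexVar_of_mem v.2).symm

/-- The relations equate monomials with monomials, so they persist in the monoid algebra over the
multiplicative monoid of `CoordinateRing K P`. The resulting map `f` sends each monomial class to
its own basis vector, and independence is pulled back along `f`. -/
theorem linearIndepOn_monomialSet (k : ℕ) :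
    LinearIndepOn K id (monomialSet (vertexVar K P) (vertices P) k) := by
  let f : CoordinateRing K P →ₐ[K] MonoidAlgebra K (CoordinateRing K P) :=
    liftVertex (fun v => MonoidAlgebra.of K _ (vertexVar K P v)) fun a b h => by
      rw [← map_mul, ← map_mul, vertexVar_mul h]
  have hf : ∀ x ∈ monomialSet (vertexVar K P) (vertices P) k, f x = MonoidAlgebra.of K _ x := by
    rintro _ ⟨s, hs, -, rfl⟩
    rw [map_multiset_prod, map_multiset_prod, Multiset.map_map, Multiset.map_map]
    exact congrArg _ (Multiset.map_congr rfl fun v hv => liftVertex_vertexVar _ (hs v hv))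
  refine LinearIndependent.of_comp f.toLinearMap ?_
  have := (MonoidAlgebra.basis (CoordinateRing K P) K).linearIndependent.comp
    (Subtype.val : monomialSet (vertexVar K P) (vertices P) k → _) Subtype.val_injective
  have e : (f.toLinearMap ∘ fun x : monomialSet (vertexVar K P) (vertices P) k => id x.1) =
      (MonoidAlgebra.basis (CoordinateRing K P) K) ∘ Subtype.val :=
    funext fun x => by simpa using hf x x.2
  exact e ▸ this

/-- The Hilbert function counts residue classes of monomials. -/
theorem finrank_gradedPart (k : ℕ) :
    Module.finrank K (gradedPart K P k) =
      (monomialSet (vertexVar K P) (vertices P) k).ncard := by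
  have hfin := monomialSet_finite (y := vertexVar K P) (vertices P).finite_toSet k
  have := hfin.fintype
  rw [gradedPart_eq_span, Set.ncard_eq_toFinset_card']
  exact finrank_span_set_eq_card (linearIndepOn_monomialSet k)

end CoordinateRing

/-! ### Rational series whose numerator is positive at 1 -/

section RationalSeries

open PowerSeries

/-- `F` is of the form `h / (1 - X) ^ d` with a polynomial `h` such that `h(1) > 0`. -/
def IsRationalSeries (F : PowerSeries ℤ) : Prop :=
  ∃ (d : ℕ) (h : Polynomial ℤ), 0 < h.eval 1 ∧ F * (1 - X) ^ d = (h : PowerSeries ℤ)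

/-- Positivity of the numerators at 1 rules out cancellation of the leading pole in a sum, which
mere non-vanishing would allow. -/
theorem IsRationalSeries.add {F G : PowerSeries ℤ} (hF : IsRationalSeries F)
    (hG : IsRationalSeries G) : IsRationalSeries (F + G) := by
  obtain ⟨d, f, hf, ef⟩ := hF
  obtain ⟨e, g, hg, eg⟩ := hG
  wlog hde : d ≤ e generalizing F G d e f g
  · rw [add_comm]
    exact this e g hg eg d f hf ef (le_of_not_ge hde)
  obtain ⟨c, rfl⟩ := Nat.exists_eq_add_of_le hde
  refine ⟨d + c, f * (1 - Polynomial.X) ^ c + g, ?_, ?_⟩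
  · rcases Nat.eq_zero_or_pos c with rfl | hc
    · simpa using add_pos hf hg
    · simpa [hc.ne'] using hg
  · rw [add_mul, eg, pow_add, ← mul_assoc, ef]
    push_cast
    ring

theorem IsRationalSeries.X_mul {F : PowerSeries ℤ} (hF : IsRationalSeries F) :
    IsRationalSeries (X * F) := by
  obtain ⟨d, f, hf, ef⟩ := hF
  refine ⟨d, Polynomial.X * f, by simpa using hf, ?_⟩
  rw [mul_assoc, ef]
  push_cast
  ring

theorem IsRationalSeries.of_mul_one_sub_X {F : PowerSeries ℤ}
    (hF : IsRationalSeries (F * (1 - X))) : IsRationalSeries F := by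
  obtain ⟨d, f, hf, ef⟩ := hF
  exact ⟨d + 1, f, hf, by rw [← ef, pow_succ']; ring⟩

end RationalSeries

/-! ### Counting points of lower sets in ℕⁿ -/

section LowerSet

variable {n : ℕ}

theorem finite_setOf_sum_eq (L : Set (Fin n → ℕ)) (k : ℕ) : {m ∈ L | ∑ i, m i = k}.Finite := by
  refine (Set.finite_Iic (fun _ : Fin n => k)).subset ?_
  rintro m ⟨-, rfl⟩ i
  exact Finset.single_le_sum (f := m) (fun _ _ => Nat.zero_le _) (Finset.mem_univ i)

/-- The generating series counting the elements of `L ⊆ ℕⁿ` by their coordinate sum. -/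
noncomputable def countingSeries (L : Set (Fin n → ℕ)) : PowerSeries ℤ :=
  PowerSeries.mk fun k => ({m ∈ L | ∑ i, m i = k}.ncard : ℤ)

theorem countingSeries_empty : countingSeries (∅ : Set (Fin n → ℕ)) = 0 := by
  ext k
  simp [countingSeries]

/-- The part of `L` with vanishing first coordinate. -/
def bottomSlice (L : Set (Fin (n + 1) → ℕ)) : Set (Fin n → ℕ) :=
  {m | (Fin.cons 0 m : Fin (n + 1) → ℕ) ∈ L}

/-- The part of `L` with positive first coordinate, shifted down by one. -/
def shiftDown (L : Set (Fin (n + 1) → ℕ)) : Set (Fin (n + 1) → ℕ) :=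
  {m | (m + Pi.single 0 1 : Fin (n + 1) → ℕ) ∈ L}

theorem shiftDown_subset {L : Set (Fin (n + 1) → ℕ)} (hL : IsLowerSet L) : shiftDown L ⊆ L :=
  fun _ hm => hL le_self_add hm

theorem isLowerSet_shiftDown {L : Set (Fin (n + 1) → ℕ)} (hL : IsLowerSet L) :
    IsLowerSet (shiftDown L) :=
  fun _ _ h ha => hL (add_le_add_left h _) ha

theorem isLowerSet_bottomSlice {L : Set (Fin (n + 1) → ℕ)} (hL : IsLowerSet L) :
    IsLowerSet (bottomSlice L) :=
  fun _ _ h ha => hL (Fin.cons_le_cons.2 ⟨le_rfl, h⟩) ha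

/-- Points are split by whether the first coordinate vanishes; the shift by one costs a factor `X`.
-/
theorem countingSeries_eq_add (L : Set (Fin (n + 1) → ℕ)) :
    countingSeries L = countingSeries (bottomSlice L) +
      PowerSeries.X * countingSeries (shiftDown L) := by
  ext k
  have hinj : Function.Injective (fun m : Fin n → ℕ => (Fin.cons 0 m : Fin (n + 1) → ℕ)) :=
    fun a b h => (Fin.cons_injective2 h).2
  have hinj' : Function.Injective (fun m : Fin (n + 1) → ℕ => m + Pi.single 0 1) :=
    add_left_injective _
  have hzero : ∀ m ∈ L, m 0 = 0 → ∀ k, ∑ i, m i = k →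
      m ∈ (fun m : Fin n → ℕ => (Fin.cons 0 m : Fin (n + 1) → ℕ)) ''
        {m' ∈ bottomSlice L | ∑ i, m' i = k} := by
    rintro m hm h0 _ rfl
    have e : (Fin.cons 0 (Fin.tail m) : Fin (n + 1) → ℕ) = m := by
      rw [← h0, Fin.cons_self_tail]
    refine ⟨Fin.tail m, ⟨by rw [bottomSlice, Set.mem_ofPred_eq, e]; exact hm, ?_⟩, e⟩
    rw [Fin.sum_univ_succ m, h0, zero_add]
    rfl
  rcases k with _ | k
  · have : {m ∈ L | ∑ i, m i = 0} = (fun m : Fin n → ℕ => (Fin.cons 0 m : Fin (n + 1) → ℕ)) ''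
        {m ∈ bottomSlice L | ∑ i, m i = 0} := by
      ext m
      constructor
      · rintro ⟨hm, hs⟩
        exact hzero m hm (by simpa using Finset.sum_eq_zero_iff.1 hs 0 (Finset.mem_univ _)) _ hs
      · rintro ⟨m, ⟨hm, hs⟩, rfl⟩
        exact ⟨hm, by simpa [Fin.sum_univ_succ] using hs⟩
    simp only [countingSeries, PowerSeries.coeff_mk, map_add, PowerSeries.coeff_zero_X_mul,
      add_zero, this, Set.ncard_image_of_injective _ hinj]
  · have : {m ∈ L | ∑ i, m i = k + 1} =
        (fun m : Fin n → ℕ => (Fin.cons 0 m : Fin (n + 1) → ℕ)) ''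
          {m ∈ bottomSlice L | ∑ i, m i = k + 1} ∪
        (fun m : Fin (n + 1) → ℕ => m + Pi.single 0 1) '' {m ∈ shiftDown L | ∑ i, m i = k} := by
      ext m
      constructor
      · rintro ⟨hm, hs⟩
        rcases Nat.eq_zero_or_pos (m 0) with h0 | h0
        · left
          exact hzero m hm h0 _ hs
        · right
          have e : m - Pi.single 0 1 + Pi.single 0 1 = m := by
            refine tsub_add_cancel_of_le fun i => ?_
            by_cases hi : i = 0
            · subst hi; simpa using Nat.succ_le_of_lt h0
            · simp [hi]
          refine ⟨m - Pi.single 0 1, ⟨by rw [shiftDown, Set.mem_ofPred_eq, e]; exact hm, ?_⟩, e⟩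
          rw [← e] at hs
          simpa [Finset.sum_add_distrib] using hs
      · rintro (⟨m, ⟨hm, hs⟩, rfl⟩ | ⟨m, ⟨hm, hs⟩, rfl⟩)
        · exact ⟨hm, by simpa [Fin.sum_univ_succ] using hs⟩
        · exact ⟨hm, by simp [Finset.sum_add_distrib, hs]⟩
    have hdisj : Disjoint ((fun m : Fin n → ℕ => (Fin.cons 0 m : Fin (n + 1) → ℕ)) ''
          {m ∈ bottomSlice L | ∑ i, m i = k + 1})
        ((fun m : Fin (n + 1) → ℕ => m + Pi.single 0 1) ''
          {m ∈ shiftDown L | ∑ i, m i = k}) := by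
      rw [Set.disjoint_left]
      rintro _ ⟨m, -, rfl⟩ ⟨m', -, h⟩
      simpa using congrFun h 0
    simp only [countingSeries, PowerSeries.coeff_mk, map_add, PowerSeries.coeff_succ_X_mul, this,
      Set.ncard_union_eq hdisj ((finite_setOf_sum_eq _ _).image _)
        ((finite_setOf_sum_eq _ _).image _), Set.ncard_image_of_injective _ hinj,
      Set.ncard_image_of_injective _ hinj']
    push_cast
    ring

theorem iterate_shiftDown {L : Set (Fin (n + 1) → ℕ)} (hL : IsLowerSet L) (j : ℕ) :
    IsLowerSet (shiftDown^[j] L) := by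
  induction j with
  | zero => exact hL
  | succ j ih =>
    rw [Function.iterate_succ_apply']
    exact isLowerSet_shiftDown ih

/-- By Dickson's lemma the successive shifts of a lower set become stationary. -/
theorem exists_shiftDown_eq {L : Set (Fin (n + 1) → ℕ)} (hL : IsLowerSet L) :
    ∃ j, shiftDown (shiftDown^[j] L) = shiftDown^[j] L := by
  by_contra! h
  have hne : ∀ j, ∃ m, m ∈ shiftDown^[j] L ∧ m ∉ shiftDown^[j + 1] L := by
    intro j
    by_contra! hj
    refine h j ((shiftDown_subset (iterate_shiftDown hL j)).antisymm fun m hm => ?_)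
    rw [← Function.iterate_succ_apply' shiftDown]
    exact hj m hm
  choose m hm hm' using hne
  have hanti : Antitone fun j => shiftDown^[j] L := antitone_nat_of_succ_le fun j => by
    rw [Function.iterate_succ_apply']
    exact shiftDown_subset (iterate_shiftDown hL j)
  -- If no stage is stationary, `m j` is lost in passing from stage `j` to stage `j + 1`. For `i <
  -- j` with `m i ≤ m j`, the point `m j`, and hence `m i`, still lies in stage `i + 1`.
  obtain ⟨i, j, hij, hle⟩ := wellQuasiOrdered_le m
  exact hm' i (iterate_shiftDown hL _ hle (hanti (Nat.succ_le_of_lt hij) (hm j)))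

/-- Induction on the dimension, and inside it on the number of shifts until the lower set is
stationary. For a stationary set the slicing identity reads $F(1-X)=F_{\mathrm{bottom}}$; otherwise
one slice is split off. -/
theorem countingSeries_rational : ∀ (n : ℕ) (L : Set (Fin n → ℕ)), IsLowerSet L → L.Nonempty →
    IsRationalSeries (countingSeries L)
  | 0, L, _, hne => by
    refine ⟨0, 1, by simp, ?_⟩
    obtain ⟨m, hm⟩ := hne
    have hL : L = Set.univ := Set.eq_univ_of_forall fun m' => by rwa [Subsingleton.elim m' m]
    subst hL
    ext k
    rcases k with _ | k
    · simp [countingSeries]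
    · have : ¬ (0 = k + 1) := by omega
      simp [countingSeries, PowerSeries.coeff_one]
  | n + 1, L, hL, hne => by
    have key : ∀ (j : ℕ) (L : Set (Fin (n + 1) → ℕ)), IsLowerSet L → L.Nonempty →
        shiftDown (shiftDown^[j] L) = shiftDown^[j] L → IsRationalSeries (countingSeries L) := by
      intro j
      induction j with
      | zero =>
        intro L hL hne h
        have hb : (bottomSlice L).Nonempty := by
          obtain ⟨m, hm⟩ := hne
          exact ⟨0, hL (fun i => by refine Fin.cases ?_ (fun i => ?_) i <;> simp) hm⟩
        have := countingSeries_rational n _ (isLowerSet_bottomSlice hL) hb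
        apply IsRationalSeries.of_mul_one_sub_X
        have e := countingSeries_eq_add L
        rw [show shiftDown L = L from h] at e
        have : countingSeries L * (1 - PowerSeries.X) = countingSeries (bottomSlice L) := by
          linear_combination e
        rwa [this]
      | succ j ih =>
        intro L hL hne h
        have hb : (bottomSlice L).Nonempty := by
          obtain ⟨m, hm⟩ := hne
          exact ⟨0, hL (fun i => by refine Fin.cases ?_ (fun i => ?_) i <;> simp) hm⟩
        have h0 := countingSeries_rational n _ (isLowerSet_bottomSlice hL) hb
        rw [countingSeries_eq_add]
        rcases (shiftDown L).eq_empty_or_nonempty with he | hs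
        · rw [he, countingSeries_empty, mul_zero, add_zero]
          exact h0
        · exact h0.add (ih _ (isLowerSet_shiftDown hL) hs h).X_mul
    obtain ⟨j, hj⟩ := exists_shiftDown_eq hL
    exact key j L hL hne hj

end LowerSet

/-! ### Standard monomials -/

section StandardMonomials

variable {R V : Type*} [CommMonoid R] {y : V → R}

theorem monomialSet_eq_image (W : Finset V) (k : ℕ) :
    monomialSet y W k = (fun m : Fin W.card → ℕ => ∏ i, y (W.equivFin.symm i) ^ m i) ''
      {m | ∑ i, m i = k} := by
  classical
  ext x
  constructor
  · rintro ⟨s, hs, hk, rfl⟩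
    have hsub : s.toFinset ⊆ W := fun v hv => hs v (Multiset.mem_toFinset.1 hv)
    refine ⟨fun i => s.count (W.equivFin.symm i).1, ?_, ?_⟩
    · rw [Set.mem_ofPred_eq, Equiv.sum_comp W.equivFin.symm (fun v => s.count v.1),
        Finset.sum_coe_sort W (fun v => s.count v), ← hk]
      exact Multiset.sum_count_eq_card hs
    · simp only
      rw [Equiv.prod_comp W.equivFin.symm (fun v => y v.1 ^ s.count v.1),
        Finset.prod_coe_sort W (fun v => y v ^ s.count v), Finset.prod_multiset_map_count]
      refine (Finset.prod_subset hsub fun v _ hv => ?_).symm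
      rw [Multiset.count_eq_zero.2 (fun h => hv (Multiset.mem_toFinset.2 h)), pow_zero]
  · rintro ⟨m, hm, rfl⟩
    refine ⟨∑ i, m i • {(W.equivFin.symm i).1}, ?_, ?_, ?_⟩
    · intro v hv
      obtain ⟨i, -, hi⟩ := Multiset.mem_sum.1 hv
      rw [Multiset.mem_singleton.1 (Multiset.mem_of_mem_nsmul hi)]
      exact (W.equivFin.symm i).2
    · simpa using hm
    · rw [← Multiset.coe_mapAddMonoidHom, map_sum, Multiset.prod_sum]
      exact Finset.prod_congr rfl fun i _ => by
        simp [Multiset.map_nsmul, Multiset.prod_nsmul]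

/-- The Hilbert function of a commutative monoid generated by finitely many elements is that of
the lower set of its standard monomials. -/
theorem exists_lowerSet_ncard_monomialSet (y : V → R) (W : Finset V) :
    ∃ L : Set (Fin W.card → ℕ), IsLowerSet L ∧ L.Nonempty ∧
      ∀ k, (monomialSet y W k).ncard = {m ∈ L | ∑ i, m i = k}.ncard := by
  let μ : (Fin W.card → ℕ) → R := fun m => ∏ i, y (W.equivFin.symm i) ^ m i
  have hμ : ∀ m m', μ (m + m') = μ m * μ m' := fun m m' => by
    simp [μ, pow_add, Finset.prod_mul_distrib]
  -- The lexicographically least exponent represents each pair of a degree and a value. The order is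
  -- compatible with addition, so a divisor of a least exponent is again least.
  let L : Set (Fin W.card → ℕ) :=
    {m | ∀ m', ∑ i, m' i = ∑ i, m i → μ m' = μ m → toLex m ≤ toLex m'}
  refine ⟨L, ?_, ⟨0, ?_⟩, fun k => ?_⟩
  · intro m m₀ h hm m' hs hμ'
    obtain ⟨c, rfl⟩ := exists_add_of_le h
    have := hm (m' + c) (by simp [Finset.sum_add_distrib, hs]) (by rw [hμ, hμ, hμ'])
    rw [toLex_add, toLex_add] at this
    exact le_of_add_le_add_right this
  · intro m' hs _
    have : m' = 0 := by
      funext i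
      have := Finset.sum_eq_zero_iff.1 (hs.trans (by simp)) i (Finset.mem_univ i)
      simpa using this
    rw [this]
  · have himg : monomialSet y W k = μ '' {m ∈ L | ∑ i, m i = k} := by
      rw [monomialSet_eq_image]
      ext x
      constructor
      · rintro ⟨m, hm, rfl⟩
        have hfin := finite_setOf_sum_eq {m' | μ m' = μ m} k
        obtain ⟨m₀, ⟨h1, h2⟩, hmin⟩ := Set.exists_min_image _ (fun m => toLex m) hfin ⟨m, rfl, hm⟩
        refine ⟨m₀, ⟨fun m' hs hμ' => ?_, h2⟩, h1⟩
        exact hmin m' ⟨hμ'.trans h1, hs.trans h2⟩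
      · rintro ⟨m, ⟨-, hm⟩, rfl⟩
        exact ⟨m, hm, rfl⟩
    rw [himg]
    refine Set.InjOn.ncard_image ?_
    rintro m ⟨hm, hs⟩ m' ⟨hm', hs'⟩ h
    exact toLex.injective (le_antisymm (hm m' (hs'.trans hs.symm) h.symm)
      (hm' m (hs.trans hs'.symm) h))

end StandardMonomials

theorem hilbertSeries_rational (K : Type*) [Field K] (P : Finset Cell) :
    IsRationalSeries (hilbertSeries K P) := by
  obtain ⟨L, hL, hne, h⟩ := exists_lowerSet_ncard_monomialSet (vertexVar K P) (vertices P)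
  have : hilbertSeries K P = countingSeries L := by
    ext k
    simp [hilbertSeries, countingSeries, finrank_gradedPart, h]
  rw [this]
  exact countingSeries_rational _ L hL hne

/-! ### Pole order at 1 and growth of partial sums -/

section PoleOrder

open Filter Topology

theorem eventually_eval_lt_of_natDegree_lt {p q : Polynomial ℝ} (h : p.natDegree < q.natDegree)
    (hq : ∀ᶠ k : ℕ in atTop, 0 < q.eval (k : ℝ)) :
    ∀ᶠ k : ℕ in atTop, p.eval (k : ℝ) < q.eval (k : ℝ) := by
  have ht := (Polynomial.div_tendsto_atTop_zero_of_degree_lt p q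
    (Polynomial.degree_lt_degree h)).comp tendsto_natCast_atTop_atTop
  filter_upwards [hq, ht.eventually (gt_mem_nhds one_pos)] with k hk hk'
  simpa [div_lt_one hk] using hk'

theorem mk_sum_range_mul_one_sub_X (H : ℕ → ℤ) :
    (PowerSeries.mk fun k => ∑ j ∈ Finset.range (k + 1), H j) * (1 - PowerSeries.X) =
      PowerSeries.mk H := by
  ext k
  rw [mul_sub, mul_one, map_sub]
  rcases k with _ | k
  · simp
  · rw [PowerSeries.coeff_succ_mul_X]
    simp [Finset.sum_range_succ _ (k + 1)]

/-- The partial sums of the coefficients of `h / (1 - X) ^ d`, `h(1) ≠ 0`, are eventually given by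
a polynomial of degree `d`. -/
theorem exists_polynomial_partialSums {H : ℕ → ℤ} {d : ℕ} {h : Polynomial ℤ} (h1 : h.eval 1 ≠ 0)
    (e : PowerSeries.mk H * (1 - PowerSeries.X) ^ d = (h : PowerSeries ℤ)) :
    ∃ Q : Polynomial ℝ, Q.natDegree = d ∧
      ∀ᶠ k : ℕ in atTop, ((∑ j ∈ Finset.range (k + 1), H j : ℤ) : ℝ) = Q.eval (k : ℝ) := by
  let p : Polynomial ℝ := h.map (Int.castRingHom ℝ)
  have hp1 : p.eval 1 ≠ 0 := by
    have : p.eval 1 = ((h.eval 1 : ℤ) : ℝ) := by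
      simp [p, Polynomial.eval_map, Polynomial.eval₂_at_one]
    rw [this]
    exact_mod_cast h1
  have hp : p ≠ 0 := by
    rintro h
    simp [h] at hp1
  have hroot : p.rootMultiplicity 1 = 0 := Polynomial.rootMultiplicity_eq_zero hp1
  -- Passing to partial sums divides the series by `1 - X`, hence `d + 1`; the degree is still `d`
  -- because `p` does not vanish at 1.
  refine ⟨p.hilbertPoly (d + 1), ?_, ?_⟩
  · rw [Polynomial.natDegree_hilbertPoly_of_ne_zero_of_rootMultiplicity_lt hp (by omega), hroot]
    omega
  · filter_upwards [eventually_gt_atTop p.natDegree] with k hk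
    rw [← Polynomial.coeff_mul_invOneSubPow_eq_hilbertPoly_eval (d + 1) hk]
    have e' : (PowerSeries.mk fun k => ∑ j ∈ Finset.range (k + 1), H j) *
        (1 - PowerSeries.X) ^ (d + 1) = (h : PowerSeries ℤ) := by
      rw [pow_succ', ← mul_assoc, mk_sum_range_mul_one_sub_X, e]
    have e2 := congrArg (PowerSeries.map (Int.castRingHom ℝ)) e'
    rw [map_mul, map_pow, map_sub, map_one, PowerSeries.map_X,
      ← PowerSeries.invOneSubPow_inv_eq_one_sub_pow] at e2
    have e3 : PowerSeries.map (Int.castRingHom ℝ) (h : PowerSeries ℤ) = (p : PowerSeries ℝ) := by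
      ext k
      simp [p]
    rw [e3] at e2
    rw [← e2, mul_assoc, Units.inv_eq_val_inv, Units.inv_mul, mul_one]
    simp

/-- The pole order at `1` of a rational generating series is determined by the growth of the
partial sums of its coefficients. -/
theorem IsRationalSeries.mul_one_sub_X_pow {H : ℕ → ℕ} {D c : ℕ}
    (hr : IsRationalSeries (PowerSeries.mk fun k => (H k : ℤ)))
    (hlow : ∀ q, (q + 1) ^ D ≤ ∑ j ∈ Finset.range (D * q + 1), H j)
    (hup : ∀ k, ∑ j ∈ Finset.range (k + 1), H j ≤ (c * k + 1) ^ D) :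
    ∃ h : Polynomial ℤ, 0 < h.eval 1 ∧ (PowerSeries.mk fun k => (H k : ℤ)) *
      (1 - PowerSeries.X) ^ D = (h : PowerSeries ℤ) := by
  obtain ⟨d, h, h1, e⟩ := hr
  obtain ⟨Q, hQd, hQ⟩ := exists_polynomial_partialSums h1.ne' e
  suffices d = D by
    subst this
    exact ⟨h, h1, e⟩
  have hS : ∀ k, 1 ≤ ∑ j ∈ Finset.range (k + 1), H j := fun k => by
    have h0 : 1 ≤ H 0 := by simpa using hlow 0
    exact h0.trans (Finset.single_le_sum (f := H) (fun _ _ => Nat.zero_le _) (by simp))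
  apply le_antisymm
  -- If `d > D`, the polynomial of the partial sums outgrows the upper bound.
  · by_contra! hlt
    let R : Polynomial ℝ := (Polynomial.C (c : ℝ) * Polynomial.X + 1) ^ D
    have hR : R.natDegree < Q.natDegree := by
      rw [hQd]
      refine lt_of_le_of_lt ?_ hlt
      refine Polynomial.natDegree_pow_le_of_le D ?_ |>.trans (mul_one D).le
      compute_degree
    have hpos : ∀ᶠ k : ℕ in atTop, 0 < Q.eval (k : ℝ) := by
      filter_upwards [hQ] with k hk
      rw [← hk]
      exact_mod_cast hS k
    obtain ⟨k, hk, hk'⟩ := ((eventually_eval_lt_of_natDegree_lt hR hpos).and hQ).exists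
    rw [← hk'] at hk
    have := hup k
    have h2 : R.eval (k : ℝ) = (((c * k + 1) ^ D : ℕ) : ℝ) := by simp [R]
    rw [h2] at hk
    have hk : (c * k + 1) ^ D < ∑ j ∈ Finset.range (k + 1), H j := by exact_mod_cast hk
    omega
  · by_contra! hlt
    let R : Polynomial ℝ := (Polynomial.X + 1) ^ D
    have hRd : R.natDegree = D := by
      have := Polynomial.natDegree_X_add_C (1 : ℝ)
      rw [Polynomial.C_1] at this
      rw [Polynomial.natDegree_pow, this, mul_one]
    -- The lower bound concerns the partial sums up to `D * q`, so `Q` is evaluated along multiples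
    -- of `D`; here `D > d ≥ 0`, so these tend to infinity.
    let Q' : Polynomial ℝ := Q.comp (Polynomial.C (D : ℝ) * Polynomial.X)
    have hQ' : Q'.natDegree < R.natDegree := by
      rw [hRd]
      refine lt_of_le_of_lt (Polynomial.natDegree_comp_le.trans ?_) hlt
      rw [hQd]
      refine (Nat.mul_le_mul_left _ (?_ : _ ≤ 1)).trans (mul_one d).le
      compute_degree
    have hpos : ∀ᶠ k : ℕ in atTop, 0 < R.eval (k : ℝ) :=
      Eventually.of_forall fun k => by simp [R]; positivity
    have ht : Tendsto (fun k : ℕ => D * k) atTop atTop :=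
      tendsto_id.const_mul_atTop' (by omega)
    obtain ⟨k, hk, hk'⟩ := ((eventually_eval_lt_of_natDegree_lt hQ' hpos).and
      (ht.eventually hQ)).exists
    have h2 : R.eval (k : ℝ) = (((k + 1) ^ D : ℕ) : ℝ) := by simp [R]
    have h3 : Q'.eval (k : ℝ) = Q.eval ((D * k : ℕ) : ℝ) := by simp [Q']
    rw [h3, ← hk', h2] at hk
    have hk : ∑ j ∈ Finset.range (D * k + 1), H j < (k + 1) ^ D := by exact_mod_cast hk
    have := hlow k
    omega

end PoleOrder

/-! ### Krull dimension and transcendence degree -/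

section KrullDimension

/-- Krull dimension is invariant under injective integral ring extensions. -/
theorem ringKrullDim_eq_of_isIntegral {A B : Type*} [CommRing A] [CommRing B] [Algebra A B]
    [Algebra.IsIntegral A B] (hinj : Function.Injective (algebraMap A B)) :
    ringKrullDim A = ringKrullDim B := by
  apply le_antisymm
  -- Chains of primes lift by lying over and going up; the other inequality is incomparability.
  · refine iSup_le fun l => ?_
    obtain ⟨Q, -, hQ, hQ'⟩ := Ideal.exists_ideal_over_prime_of_isIntegral
      (S := B) l.head.asIdeal ⊥ (by
        rw [← RingHom.ker_eq_comap_bot, (RingHom.injective_iff_ker_eq_bot _).1 hinj]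
        exact bot_le)
    have : Q.LiesOver (RelSeries.head l).asIdeal := ⟨hQ'.symm⟩
    obtain ⟨L, hL, -⟩ := Ideal.exists_ltSeries_of_hasGoingUp l Q
    rw [← hL]
    exact le_iSup (fun L : LTSeries (PrimeSpectrum B) => ((L.length : ℕ∞) : WithBot ℕ∞)) L
  · refine Order.krullDim_le_of_strictMono (PrimeSpectrum.comap (algebraMap A B)) fun p q h => ?_
    exact Ideal.IsIntegral.comap_lt_comap (R := A) (I := p.asIdeal) (J := q.asIdeal) h

/-- The Krull dimension of an affine domain is its transcendence degree. -/
theorem ringKrullDim_eq_of_isTranscendenceBasis {K B ι : Type*} [Field K] [CommRing B] [IsDomain B]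
    [Algebra K B] [Algebra.FiniteType K B] [Finite ι] {x : ι → B}
    (hx : IsTranscendenceBasis K x) : ringKrullDim B = Nat.card ι := by
  -- Noether normalization: the images of the `s` polynomial variables form another transcendence
  -- basis, so `s` equals the cardinality of `ι`.
  obtain ⟨s, g, hg, hint⟩ := exists_integral_inj_algHom_of_fg K B
  algebraize [g.toRingHom]
  have : IsScalarTower K (MvPolynomial (Fin s) K) B := .of_algebraMap_eq' g.comp_algebraMap.symm
  have : Algebra.IsIntegral (MvPolynomial (Fin s) K) B := ⟨hint⟩
  have hinj : Function.Injective (algebraMap (MvPolynomial (Fin s) K) B) := hg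
  rw [← ringKrullDim_eq_of_isIntegral hinj, MvPolynomial.ringKrullDim_of_isNoetherianRing,
    ringKrullDim_eq_zero_of_field, zero_add]
  have : FaithfulSMul (MvPolynomial (Fin s) K) B :=
    (faithfulSMul_iff_algebraMap_injective _ _).2 hinj
  have h2 : IsTranscendenceBasis K fun i : Fin s => g (MvPolynomial.X i) :=
    IsTranscendenceBasis.algebraMap_comp (S := MvPolynomial (Fin s) K) (A := B)
      (IsTranscendenceBasis.mvPolynomial (Fin s) K)
  have h3 := IsTranscendenceBasis.lift_cardinalMk_eq h2 hx
  have h4 := congrArg Cardinal.toNat h3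
  simp only [Cardinal.toNat_lift] at h4
  exact congrArg _ h4

end KrullDimension

/-! ### Toric exponents of the vertices -/

section Exponents

variable {P : Finset Cell}

theorem subset_vertices (P : Finset Cell) : P ⊆ vertices P :=
  fun c hc => Finset.mem_biUnion.2 ⟨c, hc, by simp [cellVertices]⟩

theorem cell_corners_mem {c : Cell} (hc : c ∈ P) :
    (c.1 + 1, c.2) ∈ vertices P ∧ (c.1, c.2 + 1) ∈ vertices P ∧ (c.1 + 1, c.2 + 1) ∈ vertices P :=
  ⟨Finset.mem_biUnion.2 ⟨c, hc, by simp [cellVertices]⟩,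
    Finset.mem_biUnion.2 ⟨c, hc, by simp [cellVertices]⟩,
    Finset.mem_biUnion.2 ⟨c, hc, by simp [cellVertices]⟩⟩

theorem isInnerInterval_cell {c : Cell} (hc : c ∈ P) :
    IsInnerInterval P c (c.1 + 1, c.2 + 1) := by
  refine ⟨by simp, by simp, ?_⟩
  simpa using hc

/-- A bound for the coordinate sum on `P`. The other three corners of a cell have larger coordinate
sum than the lower left one, so recursion through them terminates. -/
theorem add_le_sum_abs {v : Vertex} (hv : v ∈ P) : v.1 + v.2 ≤ ∑ w ∈ P, |w.1 + w.2| :=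
  (le_abs_self _).trans (Finset.single_le_sum (f := fun w : Cell => |w.1 + w.2|)
    (fun _ _ => abs_nonneg _) hv)

/-- Induction on vertices: the lower left corner of a cell of `P` is reduced to the three other
corners of this cell. -/
theorem vertex_induction (P : Finset Cell) {p : Vertex → Prop} (h0 : ∀ v ∉ P, p v)
    (h1 : ∀ v ∈ P, p (v.1 + 1, v.2) → p (v.1, v.2 + 1) → p (v.1 + 1, v.2 + 1) → p v) (v : Vertex) :
    p v := by
  by_cases h : v ∈ P
  · exact h1 v h (vertex_induction P h0 h1 _) (vertex_induction P h0 h1 _)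
      (vertex_induction P h0 h1 _)
  · exact h0 v h
termination_by (∑ w ∈ P, |w.1 + w.2| + 1 - (v.1 + v.2)).toNat
decreasing_by all_goals have := add_le_sum_abs h; omega

/-- The exponent vector of `x_v` in the toric parametrization of `P`, with respect to the vertices
which are not the lower left corner of a cell of `P`. -/
noncomputable def exponent (P : Finset Cell) (v : Vertex) : Vertex →₀ ℤ :=
  if h : v ∈ P then
    exponent P (v.1 + 1, v.2) + exponent P (v.1, v.2 + 1) - exponent P (v.1 + 1, v.2 + 1)
  else Finsupp.single v 1
termination_by (∑ w ∈ P, |w.1 + w.2| + 1 - (v.1 + v.2)).toNat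
decreasing_by all_goals have := add_le_sum_abs h; omega

theorem exponent_of_notMem {v : Vertex} (h : v ∉ P) : exponent P v = Finsupp.single v 1 := by
  rw [exponent, dif_neg h]

theorem exponent_of_mem {v : Vertex} (h : v ∈ P) : exponent P v =
    exponent P (v.1 + 1, v.2) + exponent P (v.1, v.2 + 1) - exponent P (v.1 + 1, v.2 + 1) := by
  rw [exponent, dif_pos h]

/-- Only the `|V(P)| - rank P` vertices that are not lower left corners of cells occur, which fixes
the dimension of the exponent lattice in the growth estimate. -/
theorem support_exponent_subset (v : Vertex) (hv : v ∈ vertices P) :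
    (exponent P v).support ⊆ vertices P \ P := by
  revert hv
  refine vertex_induction P (p := fun v => v ∈ vertices P →
    (exponent P v).support ⊆ vertices P \ P) (fun v h hv => ?_) (fun v h h1 h2 h3 _ => ?_) v
  · rw [exponent_of_notMem h]
    refine Finsupp.support_single_subset.trans ?_
    simpa using ⟨hv, h⟩
  · obtain ⟨c1, c2, c3⟩ := cell_corners_mem h
    rw [exponent_of_mem h]
    exact Finsupp.support_sub.trans (Finset.union_subset
      (Finsupp.support_add.trans (Finset.union_subset (h1 c1) (h2 c2))) (h3 c3))

section Relation

variable {G : Type*} [AddCommGroup G] {g : Vertex → G}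

/-- The relations of two adjacent cells add up to that of their union, since the terms of the common
edge cancel. Columns are built from cells in this way, and rectangles from columns. -/
theorem column_relation (hg : ∀ v ∈ P, g v + g (v.1 + 1, v.2 + 1) =
    g (v.1, v.2 + 1) + g (v.1 + 1, v.2)) (h : ℕ) (x y : ℤ)
    (hP : ∀ j : ℕ, j < h → (x, y + j) ∈ P) :
    g (x, y) + g (x + 1, y + h) = g (x, y + h) + g (x + 1, y) := by
  induction h with
  | zero => simp
  | succ h ih =>
    have h1 := ih fun j hj => hP j (by omega)
    have h2 := hg _ (hP h (by omega))
    push_cast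
    rw [← add_assoc]
    dsimp only at h2
    have : g (x, y) + g (x + 1, y + h + 1) + (g (x + 1, y + h) + g (x, y + h)) =
        g (x, y + h + 1) + g (x + 1, y) + (g (x + 1, y + h) + g (x, y + h)) := by
      calc _ = (g (x, y) + g (x + 1, y + h)) + (g (x, y + h) + g (x + 1, y + h + 1)) := by abel
        _ = _ := by rw [h1, h2]; abel
    exact add_right_cancel this

theorem rectangle_relation (hg : ∀ v ∈ P, g v + g (v.1 + 1, v.2 + 1) =
    g (v.1, v.2 + 1) + g (v.1 + 1, v.2)) (w h : ℕ) (x y : ℤ)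
    (hP : ∀ i j : ℕ, i < w → j < h → (x + i, y + j) ∈ P) :
    g (x, y) + g (x + w, y + h) = g (x, y + h) + g (x + w, y) := by
  induction w with
  | zero => simp [add_comm]
  | succ w ih =>
    have h1 := ih fun i j hi hj => hP i j (by omega) hj
    have h2 := column_relation hg h (x + w) y fun j hj => hP w j (by omega) hj
    push_cast
    rw [← add_assoc]
    have : g (x, y) + g (x + w + 1, y + h) + (g (x + w, y + h) + g (x + w, y)) =
        g (x, y + h) + g (x + w + 1, y) + (g (x + w, y + h) + g (x + w, y)) := by
      calc _ = (g (x, y) + g (x + w, y + h)) + (g (x + w, y) + g (x + w + 1, y + h)) := by abel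
        _ = _ := by rw [h1, h2]; abel
    exact add_right_cancel this

theorem IsInnerInterval.relation (hg : ∀ v ∈ P, g v + g (v.1 + 1, v.2 + 1) =
    g (v.1, v.2 + 1) + g (v.1 + 1, v.2)) {a b : Vertex} (h : IsInnerInterval P a b) :
    g a + g b = g (a.1, b.2) + g (b.1, a.2) := by
  obtain ⟨h1, h2, h3⟩ := h
  have := rectangle_relation hg (b.1 - a.1).toNat (b.2 - a.2).toNat a.1 a.2 fun i j hi hj =>
    h3 (Finset.mem_Icc.2 ⟨⟨by simp, by simp⟩, ⟨by simp; omega, by simp; omega⟩⟩)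
  rwa [Int.toNat_of_nonneg (by omega), Int.toNat_of_nonneg (by omega), add_sub_cancel,
    add_sub_cancel] at this

end Relation

theorem exponent_relation {a b : Vertex} (h : IsInnerInterval P a b) :
    exponent P a + exponent P b = exponent P (a.1, b.2) + exponent P (b.1, a.2) := by
  refine h.relation fun v hv => ?_
  rw [exponent_of_mem hv]
  abel

end Exponents

/-! ### Transcendence basis and Krull dimension of the coordinate ring -/

section Toric

variable (K : Type*) [Field K] (P : Finset Cell)

/-- The toric parametrization of `K[P]` by Laurent monomials. -/
noncomputable def toricMap : CoordinateRing K P →ₐ[K] AddMonoidAlgebra K (Vertex →₀ ℤ) :=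
  liftVertex (fun v => AddMonoidAlgebra.single (exponent P v) 1) fun a b h => by
    rw [AddMonoidAlgebra.single_mul_single, AddMonoidAlgebra.single_mul_single,
      exponent_relation h]

variable {K P}

theorem mem_vertices_of_free {t : Vertex} (ht : t ∈ vertices P \ P) : t ∈ vertices P :=
  (Finset.mem_sdiff.1 ht).1

/-- The variables at the vertices which are not the lower left corner of a cell are algebraically
independent in `K[P]`. -/
theorem algebraicIndependent_free : AlgebraicIndependent K
    (fun t : {t // t ∈ vertices P \ P} => vertexVar K P t.1) := by
  let ι : ({t // t ∈ vertices P \ P} →₀ ℕ) →+ (Vertex →₀ ℤ) :=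
    (Finsupp.mapDomain.addMonoidHom Subtype.val).comp
      (Finsupp.mapRange.addMonoidHom (Nat.castAddMonoidHom ℤ))
  have hι : Function.Injective ι :=
    (Finsupp.mapDomain_injective Subtype.val_injective).comp
      (Finsupp.mapRange_injective _ (Nat.castAddMonoidHom ℤ).map_zero Nat.cast_injective)
  let f : MvPolynomial {t // t ∈ vertices P \ P} K →ₐ[K] AddMonoidAlgebra K (Vertex →₀ ℤ) :=
    AddMonoidAlgebra.mapDomainAlgHom K K ι
  -- The toric map sends free variables to distinct basis exponents, so on polynomials in them it is
  -- the embedding of the polynomial ring into the Laurent ring.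
  have hf : f = (toricMap K P).comp (MvPolynomial.aeval fun t => vertexVar K P t.1) := by
    apply MvPolynomial.algHom_ext
    intro t
    have h1 : f (MvPolynomial.X t) = AddMonoidAlgebra.single (ι (Finsupp.single t 1)) 1 :=
      AddMonoidAlgebra.mapDomain_single
    rw [h1, AlgHom.comp_apply, MvPolynomial.aeval_X, toricMap,
      liftVertex_vertexVar _ (mem_vertices_of_free t.2),
      exponent_of_notMem (Finset.mem_sdiff.1 t.2).2]
    simp [ι]
  have hinj : Function.Injective f := AddMonoidAlgebra.mapDomain_injective hι
  rw [hf] at hinj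
  exact Function.Injective.of_comp hinj

theorem coordinateRing_induction {p : CoordinateRing K P → Prop}
    (hC : ∀ c : K, p (algebraMap K _ c)) (hX : ∀ v ∈ vertices P, p (vertexVar K P v))
    (hadd : ∀ a b, p a → p b → p (a + b)) (hmul : ∀ a b, p a → p b → p (a * b))
    (x : CoordinateRing K P) : p x := by
  obtain ⟨f, rfl⟩ := Ideal.Quotient.mk_surjective x
  induction f using MvPolynomial.induction_on with
  | C c => exact hC c
  | add f g hf hg =>
    rw [map_add]
    exact hadd _ _ hf hg
  | mul_X f v hf =>
    rw [map_mul]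
    refine hmul _ _ hf ?_
    rw [← vertexVar_of_mem v.2]
    exact hX v.1 v.2

variable [IsDomain (CoordinateRing K P)]

/-- The minor of a single cell expresses its lower left variable as a quotient of the other three,
so every variable is a fraction over the subalgebra of free variables. Denominators stay nonzero
because the ring is a domain. -/
theorem exists_mul_vertexVar_mem_adjoin (v : Vertex) (hv : v ∈ vertices P) :
    ∃ a ∈ Algebra.adjoin K (Set.range fun t : {t // t ∈ vertices P \ P} => vertexVar K P t.1),
      a ≠ 0 ∧ a * vertexVar K P v ∈
        Algebra.adjoin K (Set.range fun t : {t // t ∈ vertices P \ P} => vertexVar K P t.1) := by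
  set S := Algebra.adjoin K (Set.range fun t : {t // t ∈ vertices P \ P} => vertexVar K P t.1)
  revert hv
  refine vertex_induction P (p := fun v => v ∈ vertices P → ∃ a ∈ S, a ≠ 0 ∧
    a * vertexVar K P v ∈ S) (fun v h hv => ?_) (fun v h h1 h2 h3 _ => ?_) v
  · refine ⟨1, S.one_mem, one_ne_zero, ?_⟩
    rw [one_mul]
    exact Algebra.subset_adjoin ⟨⟨v, Finset.mem_sdiff.2 ⟨hv, h⟩⟩, rfl⟩
  · obtain ⟨c1, c2, c3⟩ := cell_corners_mem h
    obtain ⟨a1, s1, n1, m1⟩ := h1 c1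
    obtain ⟨a2, s2, n2, m2⟩ := h2 c2
    obtain ⟨a3, s3, n3, m3⟩ := h3 c3
    have e := vertexVar_mul (K := K) (isInnerInterval_cell h)
    dsimp only at e
    refine ⟨a1 * a2 * (a3 * vertexVar K P (v.1 + 1, v.2 + 1)),
      S.mul_mem (S.mul_mem s1 s2) m3,
      mul_ne_zero (mul_ne_zero n1 n2) (mul_ne_zero n3 (vertexVar_ne_zero c3)), ?_⟩
    have : a1 * a2 * (a3 * vertexVar K P (v.1 + 1, v.2 + 1)) * vertexVar K P v =
        a3 * ((a1 * vertexVar K P (v.1 + 1, v.2)) * (a2 * vertexVar K P (v.1, v.2 + 1))) := by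
      linear_combination (a1 * a2 * a3) * e
    rw [this]
    exact S.mul_mem s3 (S.mul_mem m1 m2)

theorem isTranscendenceBasis_free : IsTranscendenceBasis K
    (fun t : {t // t ∈ vertices P \ P} => vertexVar K P t.1) := by
  rw [isTranscendenceBasis_iff_algebraicIndependent_isAlgebraic]
  refine ⟨algebraicIndependent_free, ⟨fun x => ?_⟩⟩
  set S := Algebra.adjoin K (Set.range fun t : {t // t ∈ vertices P \ P} => vertexVar K P t.1)
  induction x using coordinateRing_induction with
  | hC c =>
    rw [IsScalarTower.algebraMap_apply K S]
    exact isAlgebraic_algebraMap _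
  | hX v hv =>
    obtain ⟨a, s, n, m⟩ := exists_mul_vertexVar_mem_adjoin (K := K) v hv
    refine ⟨Polynomial.C ⟨a, s⟩ * Polynomial.X - Polynomial.C ⟨_, m⟩, fun h => n ?_, ?_⟩
    · have := congrArg (fun p => Polynomial.coeff p 1) h
      simpa [Polynomial.coeff_C, Subtype.ext_iff] using this
    · simp
  | hadd a b ha hb => exact ha.add hb
  | hmul a b ha hb => exact ha.mul hb

theorem card_free (P : Finset Cell) :
    (vertices P \ P).card = (vertices P).card - P.card :=
  Finset.card_sdiff_of_subset (subset_vertices P)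

/-- If the polyomino ideal is prime, the Krull dimension of `K[P]` is `|V(P)| - rank P`. -/
theorem ringKrullDim_coordinateRing :
    ringKrullDim (CoordinateRing K P) = (((vertices P).card - P.card : ℕ) : WithBot ℕ∞) := by
  rw [ringKrullDim_eq_of_isTranscendenceBasis (isTranscendenceBasis_free (K := K) (P := P)),
    Nat.card_eq_fintype_card, Fintype.card_coe, card_free]

end Toric

/-! ### Growth of the Hilbert function -/

section Growth

variable {K : Type*} [Field K] {P : Finset Cell}

/-- The residue classes of monomials of degree `k` in `K[P]` form a finite set. -/
theorem exists_finset_monomialSet (k : ℕ) : ∃ M : Finset (CoordinateRing K P),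
    (M : Set (CoordinateRing K P)) = monomialSet (vertexVar K P) (vertices P) k :=
  ⟨_, (monomialSet_finite (vertices P).finite_toSet k).coe_toFinset⟩

/-- The degree is an invariant of the class: the minors are homogeneous, so all variables may be
sent to `X`. -/
theorem map_monomial_eq_X_pow {x : CoordinateRing K P} {k : ℕ}
    (hx : x ∈ monomialSet (vertexVar K P) (vertices P) k) :
    liftVertex (P := P) (K := K) (fun _ => (Polynomial.X : Polynomial K)) (fun _ _ _ => rfl) x =
      Polynomial.X ^ k := by
  obtain ⟨s, hs, rfl, rfl⟩ := hx
  rw [map_multiset_prod, Multiset.map_map, Multiset.map_congr rfl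
    (g := fun _ => (Polynomial.X : Polynomial K)) fun v hv => liftVertex_vertexVar _ (hs v hv)]
  simp

theorem disjoint_monomialSet {i j : ℕ} (hij : i ≠ j) :
    Disjoint (monomialSet (vertexVar K P) (vertices P) i)
      (monomialSet (vertexVar K P) (vertices P) j) := by
  rw [Set.disjoint_left]
  intro x hi hj
  have := (map_monomial_eq_X_pow hi).symm.trans (map_monomial_eq_X_pow hj)
  exact hij (by simpa using congrArg Polynomial.natDegree this)

/-- The monomials in the free variables with all exponents at most `q` have pairwise distinct
classes by algebraic independence, and their degree is at most `q` times the number of free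
variables. -/
theorem pow_card_free_le (q : ℕ) : (q + 1) ^ (vertices P \ P).card ≤
    ∑ j ∈ Finset.range ((vertices P \ P).card * q + 1),
      (monomialSet (vertexVar K P) (vertices P) j).ncard := by
  classical
  choose M hM using exists_finset_monomialSet (K := K) (P := P)
  have hcard : ∀ j, (monomialSet (vertexVar K P) (vertices P) j).ncard = (M j).card := fun j => by
    rw [← hM, Set.ncard_coe_finset]
  simp only [hcard]
  refine le_trans ?_ Finset.card_biUnion_le
  have hd : (q + 1) ^ (vertices P \ P).card =
      (Finset.univ : Finset ({t // t ∈ vertices P \ P} → Fin (q + 1))).card := by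
    rw [Finset.card_univ, Fintype.card_fun, Fintype.card_coe, Fintype.card_fin]
  rw [hd]
  let F : ({t // t ∈ vertices P \ P} → Fin (q + 1)) → CoordinateRing K P := fun f =>
    ∏ t, vertexVar K P t.1 ^ (f t : ℕ)
  refine Finset.card_le_card_of_injOn F ?_ ?_
  · intro f _
    rw [Finset.mem_coe, Finset.mem_biUnion]
    refine ⟨∑ t, (f t : ℕ), ?_, ?_⟩
    · rw [Finset.mem_range, Nat.lt_succ_iff]
      refine (Finset.sum_le_card_nsmul _ _ q fun t _ => Nat.lt_succ_iff.1 (f t).2).trans ?_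
      rw [Finset.card_univ, Fintype.card_coe, smul_eq_mul]
    · rw [← Finset.mem_coe, hM]
      refine ⟨∑ t, (f t : ℕ) • {t.1}, ?_, by simp, ?_⟩
      · intro v hv
        obtain ⟨t, -, ht⟩ := Multiset.mem_sum.1 hv
        rw [Multiset.mem_singleton.1 (Multiset.mem_of_mem_nsmul ht)]
        exact mem_vertices_of_free t.2
      · rw [← Multiset.coe_mapAddMonoidHom, map_sum, Multiset.prod_sum]
        exact Finset.prod_congr rfl fun i _ => by
          simp [Multiset.map_nsmul, Multiset.prod_nsmul]
  · intro f _ g _ hfg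
    let m : ({t // t ∈ vertices P \ P} → Fin (q + 1)) → ({t // t ∈ vertices P \ P} →₀ ℕ) :=
      fun f => Finsupp.equivFunOnFinite.symm fun t => (f t : ℕ)
    have hF : ∀ f, F f = MvPolynomial.aeval (fun t : {t // t ∈ vertices P \ P} =>
        vertexVar K P t.1) (MvPolynomial.monomial (m f) (1 : K)) := by
      intro f
      rw [MvPolynomial.aeval_monomial, Finsupp.prod_fintype _ _ fun _ => pow_zero _]
      simp [F, m]
    have h1 : MvPolynomial.monomial (m f) (1 : K) = MvPolynomial.monomial (m g) 1 :=
      algebraicIndependent_free ((hF f).symm.trans (hfg.trans (hF g)))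
    have h2 := MvPolynomial.monomial_left_injective (one_ne_zero (α := K)) h1
    have h3 := Finsupp.equivFunOnFinite.symm.injective h2
    funext t
    exact Fin.ext (congrFun h3 t)

variable [IsDomain (CoordinateRing K P)]

variable (K P) in
/-- The variables of `K[P]` as units of the fraction field. -/
noncomputable def vertexUnit (v : Vertex) : (FractionRing (CoordinateRing K P))ˣ :=
  open Classical in
  if h : v ∈ vertices P then Units.mk0 (algebraMap _ _ (vertexVar K P v)) fun h' =>
    vertexVar_ne_zero h ((map_eq_zero_iff _
      (IsFractionRing.injective (CoordinateRing K P) (FractionRing (CoordinateRing K P)))).1 h')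
  else 1

theorem vertexUnit_val {v : Vertex} (hv : v ∈ vertices P) :
    (vertexUnit K P v : FractionRing (CoordinateRing K P)) =
      algebraMap _ _ (vertexVar K P v) := by
  rw [vertexUnit, dif_pos hv, Units.val_mk0]

variable (K P) in
/-- Evaluation of Laurent monomials in the fraction field of `K[P]`. -/
noncomputable def laurentEval :
    (Vertex →₀ ℤ) →+ Additive (FractionRing (CoordinateRing K P))ˣ :=
  Finsupp.liftAddHom fun v => zmultiplesHom _ (Additive.ofMul (vertexUnit K P v))

theorem laurentEval_single (v : Vertex) : laurentEval K P (Finsupp.single v 1) =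
    Additive.ofMul (vertexUnit K P v) := by
  simp [laurentEval]

theorem laurentEval_exponent (v : Vertex) (hv : v ∈ vertices P) :
    laurentEval K P (exponent P v) = Additive.ofMul (vertexUnit K P v) := by
  revert hv
  refine vertex_induction P (p := fun v => v ∈ vertices P → laurentEval K P (exponent P v) =
    Additive.ofMul (vertexUnit K P v)) (fun v h hv => ?_) (fun v h h1 h2 h3 hv => ?_) v
  · rw [exponent_of_notMem h, laurentEval_single]
  · obtain ⟨c1, c2, c3⟩ := cell_corners_mem h
    rw [exponent_of_mem h, map_sub, map_add, h1 c1, h2 c2, h3 c3, ← ofMul_mul, ← ofMul_div]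
    congr 1
    rw [div_eq_iff_eq_mul]
    ext
    rw [Units.val_mul, Units.val_mul, vertexUnit_val hv, vertexUnit_val c1, vertexUnit_val c2,
      vertexUnit_val c3, ← map_mul, ← map_mul]
    congr 1
    have := vertexVar_mul (K := K) (isInnerInterval_cell h)
    dsimp only at this
    rw [mul_comm, ← this]

/-- In the fraction field a monomial class is recovered from its exponent vector, so there are at
most as many classes as exponent vectors. -/
theorem laurentEval_sum_exponent (s : Multiset Vertex) (hs : ∀ v ∈ s, v ∈ vertices P) :
    (((laurentEval K P (s.map (exponent P)).sum).toMul :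
      (FractionRing (CoordinateRing K P))ˣ) : FractionRing (CoordinateRing K P)) =
      algebraMap _ _ (s.map (vertexVar K P)).prod := by
  induction s using Multiset.induction_on with
  | empty => simp
  | cons v s ih =>
    have hv := hs v (by simp)
    rw [Multiset.map_cons, Multiset.sum_cons, map_add, toMul_add, Units.val_mul,
      ih fun w hw => hs w (by simp [hw]), Multiset.map_cons, Multiset.prod_cons, map_mul,
      laurentEval_exponent v hv, toMul_ofMul, vertexUnit_val hv]

theorem exists_exponent_bound (P : Finset Cell) :
    ∃ B : ℕ, ∀ v ∈ vertices P, ∀ t, |exponent P v t| ≤ B := by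
  refine ⟨∑ v ∈ vertices P, ∑ t ∈ (exponent P v).support, (exponent P v t).natAbs,
    fun v hv t => ?_⟩
  rw [Int.abs_eq_natAbs]
  norm_cast
  refine le_trans ?_ (Finset.single_le_sum (f := fun v => ∑ t ∈ (exponent P v).support,
    (exponent P v t).natAbs) (fun _ _ => Nat.zero_le _) hv)
  by_cases ht : t ∈ (exponent P v).support
  · exact Finset.single_le_sum (f := fun t => (exponent P v t).natAbs)
      (fun _ _ => Nat.zero_le _) ht
  · rw [Finsupp.notMem_support_iff.1 ht]
    simp

theorem sum_exponent_support {s : Multiset Vertex} (hs : ∀ v ∈ s, v ∈ vertices P) :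
    (s.map (exponent P)).sum.support ⊆ vertices P \ P := by
  induction s using Multiset.induction_on with
  | empty => simp
  | cons v s ih =>
    rw [Multiset.map_cons, Multiset.sum_cons]
    exact Finsupp.support_add.trans (Finset.union_subset
      (support_exponent_subset v (hs v (by simp))) (ih fun w hw => hs w (by simp [hw])))

theorem abs_sum_exponent_le {B : ℕ} (hB : ∀ v ∈ vertices P, ∀ t, |exponent P v t| ≤ B)
    {s : Multiset Vertex} (hs : ∀ v ∈ s, v ∈ vertices P) (t : Vertex) :
    |(s.map (exponent P)).sum t| ≤ B * s.card := by
  induction s using Multiset.induction_on with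
  | empty => simp
  | cons v s ih =>
    rw [Multiset.map_cons, Multiset.sum_cons, Finsupp.add_apply, Multiset.card_cons]
    refine (abs_add_le _ _).trans ?_
    have h1 := hB v (hs v (by simp)) t
    have h2 := ih fun w hw => hs w (by simp [hw])
    push_cast
    linarith

-- With `B` bounding all coordinates of the exponents of the variables, monomials of degree at most
-- `k` have exponent vectors in the box $[-Bk,Bk]$ over the free vertices. Each side has $2Bk+1$
-- points, hence `c = 2 * B`. Classes of different degrees are disjoint, so the sum over degrees
-- counts one set.
variable (K P) in
theorem sum_ncard_monomialSet_le : ∃ c : ℕ, ∀ k, ∑ j ∈ Finset.range (k + 1),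
    (monomialSet (vertexVar K P) (vertices P) j).ncard ≤ (c * k + 1) ^ (vertices P \ P).card := by
  classical
  obtain ⟨B, hB⟩ := exists_exponent_bound P
  refine ⟨2 * B, fun k => ?_⟩
  choose M hM using exists_finset_monomialSet (K := K) (P := P)
  have hcard : ∀ j, (monomialSet (vertexVar K P) (vertices P) j).ncard = (M j).card := fun j => by
    rw [← hM, Set.ncard_coe_finset]
  simp only [hcard]
  rw [← Finset.card_biUnion fun i _ j _ hij => by
    rw [Function.onFun, ← Finset.disjoint_coe, hM, hM]
    exact disjoint_monomialSet hij]
  have hbox : ((vertices P \ P).finsupp fun _ => Finset.Icc (-(B * k : ℤ)) (B * k)).card =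
      (2 * B * k + 1) ^ (vertices P \ P).card := by
    rw [Finset.card_finsupp, Finset.prod_const, Int.card_Icc]
    congr 1
    have : (B * k + 1 - -(B * k) : ℤ) = ((2 * B * k + 1 : ℕ) : ℤ) := by push_cast; ring
    rw [this, Int.toNat_natCast]
  rw [← hbox, ← Finset.card_image_of_injective _
    (IsFractionRing.injective (CoordinateRing K P) (FractionRing (CoordinateRing K P)))]
  refine le_trans (Finset.card_le_card ?_) (Finset.card_image_le (s := (vertices P \ P).finsupp
    fun _ => Finset.Icc (-(B * k : ℤ)) (B * k)) (f := fun e =>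
      ((laurentEval K P e).toMul : FractionRing (CoordinateRing K P))))
  intro z hz
  obtain ⟨x, hx, rfl⟩ := Finset.mem_image.1 hz
  obtain ⟨j, hj, hxj⟩ := Finset.mem_biUnion.1 hx
  rw [← Finset.mem_coe, hM] at hxj
  obtain ⟨s, hs, rfl, rfl⟩ := hxj
  refine Finset.mem_image.2 ⟨(s.map (exponent P)).sum, ?_, laurentEval_sum_exponent s hs⟩
  rw [Finset.mem_finsupp_iff]
  refine ⟨sum_exponent_support hs, fun t _ => ?_⟩
  have h1 := abs_sum_exponent_le hB hs t
  have h2 : (B * s.card : ℤ) ≤ B * k := by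
    have : s.card ≤ k := Nat.lt_succ_iff.1 (Finset.mem_range.1 hj)
    exact_mod_cast Nat.mul_le_mul_left B this
  exact Finset.mem_Icc.2 (abs_le.1 (h1.trans h2))

variable (K P) in
/-- If the polyomino ideal is prime, the `h`-polynomial of `K[P]` exists and the Hilbert series
has a pole of order `|V(P)| - rank P` at `1`. -/
theorem exists_isHPolynomial : ∃ h : Polynomial ℤ, IsHPolynomial K P h ∧
    hilbertSeries K P * (1 - PowerSeries.X) ^ ((vertices P).card - P.card) =
      (h : PowerSeries ℤ) := by
  obtain ⟨c, hc⟩ := sum_ncard_monomialSet_le K P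
  have e : hilbertSeries K P = PowerSeries.mk fun k =>
      ((monomialSet (vertexVar K P) (vertices P) k).ncard : ℤ) := by
    ext k
    simp [hilbertSeries, finrank_gradedPart]
  have hr := hilbertSeries_rational K P
  rw [e] at hr
  obtain ⟨h, h1, h2⟩ := hr.mul_one_sub_X_pow pow_card_free_le hc
  rw [← e, card_free] at h2
  exact ⟨h, ⟨h1.ne', _, ringKrullDim_coordinateRing, h2⟩, h2⟩

end Growth

/-! ### Retracts and the decomposition of monomials -/

section Retract

variable {R V : Type*} [CommRing R] [IsDomain R] {y : V → R} {V₀ : Set V}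

/-- The variables in `V₀ \ S` can be set to `0` without changing those in `S`. -/
def IsRetract (y : V → R) (V₀ S : Set V) : Prop :=
  S ⊆ V₀ ∧ ∃ f : R →* R, (∀ v ∈ S, f (y v) = y v) ∧ ∀ v ∈ V₀, v ∉ S → f (y v) = 0

theorem ne_zero_of_mem_monomialSet (hy : ∀ v ∈ V₀, y v ≠ 0) {k : ℕ} {x : R}
    (hx : x ∈ monomialSet y V₀ k) : x ≠ 0 := by
  obtain ⟨s, hs, -, rfl⟩ := hx
  intro h
  obtain ⟨v, hv, h0⟩ := Multiset.mem_map.1 (Multiset.prod_eq_zero_iff.1 h)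
  exact hy v (hs v hv) h0

/-- If `v` were outside `S`, the retraction would fix the product, as a monomial in `S`, and also
kill it. Monomials are nonzero in the domain. All disjointness below rests on this. -/
theorem IsRetract.mem_of_mul_mem (hy : ∀ v ∈ V₀, y v ≠ 0) {S : Set V} (hS : IsRetract y V₀ S)
    {v : V} (hv : v ∈ V₀) {x : R} {k : ℕ} (hx : y v * x ∈ monomialSet y S k) : v ∈ S := by
  obtain ⟨hSV, f, hf, hf0⟩ := hS
  by_contra hvS
  have hne := ne_zero_of_mem_monomialSet hy (monomialSet_mono hSV k hx)
  have : f (y v * x) = y v * x := by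
    obtain ⟨s, hs, -, e⟩ := hx
    rw [← e, map_multiset_prod, Multiset.map_map]
    exact congrArg _ (Multiset.map_congr rfl fun v hv => hf v (hs v hv))
  rw [map_mul, hf0 v hv hvS] at this
  by_cases hx0 : x = 0
  · simp [hx0] at hne
  · exact hne (by rw [← this, zero_mul])

theorem ncard_image_mul {a : R} (ha : a ≠ 0) (X : Set R) : ((a * ·) '' X).ncard = X.ncard :=
  Set.ncard_image_of_injective _ (mul_right_injective₀ ha)

theorem mem_image_mul_of_mem {s : Multiset V} {S : Set V} (hs : ∀ v ∈ s, v ∈ S) {v : V}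
    (hv : v ∈ s) {k : ℕ} (hk : s.card = k + 1) :
    (s.map y).prod ∈ (y v * ·) '' monomialSet y S k := by
  obtain ⟨t, rfl⟩ := Multiset.exists_cons_of_mem hv
  refine ⟨(t.map y).prod, ⟨t, fun w hw => hs w (Multiset.mem_cons_of_mem hw), ?_, rfl⟩, by simp⟩
  simpa using hk

/-- The generating series counting the values of the monomials in the variables from `S`. -/
noncomputable def monomialSeries (y : V → R) (S : Set V) : PowerSeries ℤ :=
  PowerSeries.mk fun k => ((monomialSet y S k).ncard : ℤ)

/-- Removing a free variable. -/
theorem monomialSeries_insert (hy : ∀ v ∈ V₀, y v ≠ 0) (hfin : V₀.Finite) {S : Set V}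
    (hS : IsRetract y V₀ S) {v : V} (hv : v ∈ V₀) (hvS : v ∉ S) :
    monomialSeries y (insert v S) * (1 - PowerSeries.X) = monomialSeries y S := by
  have hSf : S.Finite := hfin.subset hS.1
  -- A monomial either contains `v`, or is a monomial in `S`; both cannot hold for one class because
  -- `S` is a retract.
  have hrec : ∀ k, (monomialSet y (insert v S) (k + 1)).ncard =
      (monomialSet y (insert v S) k).ncard + (monomialSet y S (k + 1)).ncard := by
    intro k
    have e : monomialSet y (insert v S) (k + 1) =
        (y v * ·) '' monomialSet y (insert v S) k ∪ monomialSet y S (k + 1) := by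
      apply Set.Subset.antisymm
      · rintro _ ⟨s, hs, hk, rfl⟩
        by_cases hvs : v ∈ s
        · exact Or.inl (mem_image_mul_of_mem hs hvs hk)
        · refine Or.inr ⟨s, fun w hw => (hs w hw).resolve_left ?_, hk, rfl⟩
          rintro rfl
          exact hvs hw
      · refine Set.union_subset ?_ (monomialSet_mono (Set.subset_insert v S) _)
        rintro _ ⟨x, hx, rfl⟩
        exact mul_mem_monomialSet (Set.mem_insert v S) hx
    have hd : Disjoint ((y v * ·) '' monomialSet y (insert v S) k) (monomialSet y S (k + 1)) := by
      rw [Set.disjoint_left]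
      rintro _ ⟨x, -, rfl⟩ hx
      exact hvS (hS.mem_of_mul_mem hy hv hx)
    rw [e, Set.ncard_union_eq hd ((monomialSet_finite (hSf.insert v) k).image _)
      (monomialSet_finite hSf _), ncard_image_mul (hy v hv)]
  ext k
  rw [mul_sub, mul_one, map_sub]
  rcases k with _ | k
  · simp [monomialSeries, monomialSet_zero]
  · rw [PowerSeries.coeff_succ_mul_X]
    simp [monomialSeries, hrec]

/-- Removing a finite set of free variables. -/
theorem monomialSeries_union (hy : ∀ v ∈ V₀, y v ≠ 0) (hfin : V₀.Finite) {S : Set V}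
    (T : Finset V) (hTV : ∀ v ∈ T, v ∈ V₀) (hTS : ∀ v ∈ T, v ∉ S)
    (hS : ∀ T' ⊆ T, IsRetract y V₀ (S ∪ T')) :
    monomialSeries y (S ∪ T) * (1 - PowerSeries.X) ^ T.card = monomialSeries y S := by
  classical
  induction T using Finset.induction_on with
  | empty => simp
  | insert v T hv ih =>
    rw [Finset.card_insert_of_notMem hv, pow_succ', ← mul_assoc, Finset.coe_insert,
      Set.union_insert, monomialSeries_insert hy hfin (hS T (Finset.subset_insert _ _))
        (hTV v (by simp))]
    · exact ih (fun w hw => hTV w (by simp [hw])) (fun w hw => hTS w (by simp [hw]))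
        fun T' hT' => hS T' (hT'.trans (Finset.subset_insert _ _))
    · rintro (h | h)
      · exact hTS v (by simp) h
      · exact hv h

/-- A cofactor of `a` leaving `W` contains some `v` outside `W`, and the exchange replaces `a`, `v`
by `b`, `v'`. -/
theorem image_mul_subset_of_exchange {a b : V} {W : Set V}
    (h : ∀ v ∈ V₀, v ∉ W → ∃ v' ∈ V₀, y a * y v = y b * y v') (k : ℕ) :
    (y a * ·) '' monomialSet y V₀ k ⊆
      (y b * ·) '' monomialSet y V₀ k ∪ (y a * ·) '' monomialSet y W k := by
  rintro _ ⟨_, ⟨s, hs, hk, rfl⟩, rfl⟩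
  by_cases hW : ∀ v ∈ s, v ∈ W
  · exact Or.inr ⟨_, ⟨s, hW, hk, rfl⟩, rfl⟩
  · push Not at hW
    obtain ⟨v, hv, hvW⟩ := hW
    obtain ⟨v', hv', e⟩ := h v (hs v hv) hvW
    obtain ⟨t, rfl⟩ := Multiset.exists_cons_of_mem hv
    refine Or.inl ⟨((v' ::ₘ t).map y).prod, ⟨v' ::ₘ t, ?_, by simpa using hk, rfl⟩, ?_⟩
    · intro w hw
      rcases Multiset.mem_cons.1 hw with rfl | hw
      exacts [hv', hs w (Multiset.mem_cons_of_mem hw)]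
    · simp only [Multiset.map_cons, Multiset.prod_cons, ← mul_assoc, e]

/-- Decomposition of the monomials according to the four corners `p`, `q`, `q'`, `o` of a cell. -/
theorem monomialSeries_decomposition (hy : ∀ v ∈ V₀, y v ≠ 0) (hfin : V₀.Finite) {p q q' o : V}
    {W₁ W₂ : Set V} (hp : p ∈ V₀) (hW₁ : IsRetract y V₀ W₁) (hW₂ : IsRetract y V₀ W₂)
    (hW₃ : IsRetract y V₀ (W₁ ∩ W₂)) (hW₄ : IsRetract y V₀ (V₀ \ {p, q, q', o}))
    (hq₁ : q ∈ W₁) (hq₂ : q ∉ W₂) (hq'₁ : q' ∉ W₁) (hq'₂ : q' ∈ W₂) (hp₁ : p ∉ W₁) (hp₂ : p ∉ W₂)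
    (ho₁ : o ∈ W₁) (ho₂ : o ∈ W₂)
    (h₁ : ∀ v ∈ V₀, v ∉ W₁ → ∃ v' ∈ V₀, y q * y v = y p * y v')
    (h₂ : ∀ v ∈ V₀, v ∉ W₂ → ∃ v' ∈ V₀, y q' * y v = y p * y v')
    (h₃ : ∀ v ∈ V₀, v ∉ W₁ → ∃ v' ∈ V₀, y o * y v = y q' * y v')
    (h₄ : ∀ v ∈ V₀, v ∉ W₂ → ∃ v' ∈ V₀, y o * y v = y q * y v') :
    monomialSeries y V₀ * (1 - PowerSeries.X) = monomialSeries y (V₀ \ {p, q, q', o}) +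
      PowerSeries.X * (monomialSeries y W₁ + monomialSeries y W₂ + monomialSeries y (W₁ ∩ W₂)) := by
  have hq : q ∈ V₀ := hW₁.1 hq₁
  have hq' : q' ∈ V₀ := hW₂.1 hq'₂
  have ho : o ∈ V₀ := hW₁.1 ho₁
  have hrec : ∀ k, (monomialSet y V₀ (k + 1)).ncard = (monomialSet y V₀ k).ncard +
      ((monomialSet y W₁ k).ncard + ((monomialSet y W₂ k).ncard +
        ((monomialSet y (W₁ ∩ W₂) k).ncard +
          (monomialSet y (V₀ \ {p, q, q', o}) (k + 1)).ncard))) := by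
    intro k
    -- The corners are split off with priority `p`, `q`, `q'`, `o`. A cofactor outside the permitted
    -- face is traded for a corner of higher priority, so the pieces cover everything.
    have e : monomialSet y V₀ (k + 1) = (y p * ·) '' monomialSet y V₀ k ∪
        ((y q * ·) '' monomialSet y W₁ k ∪ ((y q' * ·) '' monomialSet y W₂ k ∪
          ((y o * ·) '' monomialSet y (W₁ ∩ W₂) k ∪
            monomialSet y (V₀ \ {p, q, q', o}) (k + 1)))) := by
      have hA := image_mul_subset_of_exchange h₁ k
      have hB := image_mul_subset_of_exchange h₂ k
      apply Set.Subset.antisymm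
      · rintro _ ⟨s, hs, hk, rfl⟩
        by_cases hps : p ∈ s
        · exact Or.inl (mem_image_mul_of_mem hs hps hk)
        by_cases hqs : q ∈ s
        · rcases hA (mem_image_mul_of_mem hs hqs hk) with h | h
          exacts [Or.inl h, Or.inr (Or.inl h)]
        by_cases hqs' : q' ∈ s
        · rcases hB (mem_image_mul_of_mem hs hqs' hk) with h | h
          exacts [Or.inl h, Or.inr (Or.inr (Or.inl h))]
        by_cases hos : o ∈ s
        · obtain ⟨t, rfl⟩ := Multiset.exists_cons_of_mem hos
          have htV : ∀ v ∈ t, v ∈ V₀ := fun v hv => hs v (Multiset.mem_cons_of_mem hv)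
          have htk : t.card = k := by simpa using hk
          have hmem : ((o ::ₘ t).map y).prod ∈ (y o * ·) '' monomialSet y V₀ k :=
            mem_image_mul_of_mem hs hos hk
          by_cases ht₁ : ∀ v ∈ t, v ∈ W₁
          · by_cases ht₂ : ∀ v ∈ t, v ∈ W₂
            · exact Or.inr (Or.inr (Or.inr (Or.inl
                ⟨_, ⟨t, fun v hv => ⟨ht₁ v hv, ht₂ v hv⟩, htk, rfl⟩, by simp⟩)))
            · push Not at ht₂
              obtain ⟨v, hv, hvW⟩ := ht₂
              obtain ⟨v', hv', e⟩ := h₄ v (htV v hv) hvW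
              obtain ⟨u, rfl⟩ := Multiset.exists_cons_of_mem hv
              have : ((o ::ₘ v ::ₘ u).map y).prod ∈ (y q * ·) '' monomialSet y V₀ k := by
                refine ⟨((v' ::ₘ u).map y).prod, ⟨v' ::ₘ u, ?_, by simpa using htk, rfl⟩, ?_⟩
                · intro w hw
                  rcases Multiset.mem_cons.1 hw with rfl | hw
                  exacts [hv', htV w (Multiset.mem_cons_of_mem hw)]
                · simp only [Multiset.map_cons, Multiset.prod_cons, ← mul_assoc, e]
              rcases hA this with h | h
              exacts [Or.inl h, Or.inr (Or.inl h)]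
          · push Not at ht₁
            obtain ⟨v, hv, hvW⟩ := ht₁
            obtain ⟨v', hv', e⟩ := h₃ v (htV v hv) hvW
            obtain ⟨u, rfl⟩ := Multiset.exists_cons_of_mem hv
            have : ((o ::ₘ v ::ₘ u).map y).prod ∈ (y q' * ·) '' monomialSet y V₀ k := by
              refine ⟨((v' ::ₘ u).map y).prod, ⟨v' ::ₘ u, ?_, by simpa using htk, rfl⟩, ?_⟩
              · intro w hw
                rcases Multiset.mem_cons.1 hw with rfl | hw
                exacts [hv', htV w (Multiset.mem_cons_of_mem hw)]
              · simp only [Multiset.map_cons, Multiset.prod_cons, ← mul_assoc, e]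
            rcases hB this with h | h
            exacts [Or.inl h, Or.inr (Or.inr (Or.inl h))]
        · refine Or.inr (Or.inr (Or.inr (Or.inr ⟨s, fun w hw => ⟨hs w hw, ?_⟩, hk, rfl⟩)))
          rintro (rfl | rfl | rfl | rfl) <;> contradiction
      · have himg : ∀ {a : V} {W : Set V}, a ∈ V₀ → W ⊆ V₀ →
            (y a * ·) '' monomialSet y W k ⊆ monomialSet y V₀ (k + 1) := by
          rintro a W ha hW _ ⟨x, hx, rfl⟩
          exact mul_mem_monomialSet ha (monomialSet_mono hW k hx)
        exact Set.union_subset (himg hp subset_rfl) (Set.union_subset (himg hq hW₁.1)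
          (Set.union_subset (himg hq' hW₂.1) (Set.union_subset (himg ho hW₃.1)
            (monomialSet_mono Set.sdiff_subset _))))
    have himg : ∀ {a : V} {W : Set V}, a ∈ W →
        (y a * ·) '' monomialSet y W k ⊆ monomialSet y W (k + 1) := by
      rintro a W ha _ ⟨x, hx, rfl⟩
      exact mul_mem_monomialSet ha hx
    have himg₃ : (y o * ·) '' monomialSet y (W₁ ∩ W₂) k ⊆ monomialSet y (W₁ ∩ W₂) (k + 1) :=
      himg ⟨ho₁, ho₂⟩
    -- Each later piece consists of monomials in a retract that omits the earlier corner.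
    have hdisj : ∀ {a : V} {X : Set R} {W : Set V}, a ∈ V₀ → IsRetract y V₀ W → a ∉ W →
        ∀ Y ⊆ monomialSet y W (k + 1), Disjoint ((y a * ·) '' X) Y := by
      intro a X W ha hW haW Y hY
      rw [Set.disjoint_left]
      rintro _ ⟨x, -, rfl⟩ hx
      exact haW (hW.mem_of_mul_mem hy ha (hY hx))
    have hd₁ : Disjoint ((y p * ·) '' monomialSet y V₀ k)
        ((y q * ·) '' monomialSet y W₁ k ∪ ((y q' * ·) '' monomialSet y W₂ k ∪
          ((y o * ·) '' monomialSet y (W₁ ∩ W₂) k ∪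
            monomialSet y (V₀ \ {p, q, q', o}) (k + 1)))) := by
      simp only [Set.disjoint_union_right]
      exact ⟨hdisj hp hW₁ hp₁ _ (himg hq₁), hdisj hp hW₂ hp₂ _ (himg hq'₂),
        hdisj hp hW₃ (fun h => hp₁ h.1) _ himg₃, hdisj hp hW₄ (by simp) _ subset_rfl⟩
    have hd₂ : Disjoint ((y q * ·) '' monomialSet y W₁ k) ((y q' * ·) '' monomialSet y W₂ k ∪
          ((y o * ·) '' monomialSet y (W₁ ∩ W₂) k ∪
            monomialSet y (V₀ \ {p, q, q', o}) (k + 1))) := by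
      simp only [Set.disjoint_union_right]
      exact ⟨hdisj hq hW₂ hq₂ _ (himg hq'₂),
        hdisj hq hW₃ (fun h => hq₂ h.2) _ himg₃, hdisj hq hW₄ (by simp) _ subset_rfl⟩
    have hd₃ : Disjoint ((y q' * ·) '' monomialSet y W₂ k)
          ((y o * ·) '' monomialSet y (W₁ ∩ W₂) k ∪
            monomialSet y (V₀ \ {p, q, q', o}) (k + 1)) := by
      simp only [Set.disjoint_union_right]
      exact ⟨hdisj hq' hW₃ (fun h => hq'₁ h.1) _ himg₃, hdisj hq' hW₄ (by simp) _ subset_rfl⟩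
    have hd₄ : Disjoint ((y o * ·) '' monomialSet y (W₁ ∩ W₂) k)
            (monomialSet y (V₀ \ {p, q, q', o}) (k + 1)) :=
      hdisj ho hW₄ (by simp) _ subset_rfl
    have f₀ := (monomialSet_finite (y := y) hfin k).image (y p * ·)
    have f₁ := (monomialSet_finite (y := y) (hfin.subset hW₁.1) k).image (y q * ·)
    have f₂ := (monomialSet_finite (y := y) (hfin.subset hW₂.1) k).image (y q' * ·)
    have f₃ := (monomialSet_finite (y := y) (hfin.subset hW₃.1) k).image (y o * ·)
    have f₄ := monomialSet_finite (y := y) (hfin.subset hW₄.1) (k + 1)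
    rw [e, Set.ncard_union_eq hd₁ f₀ (f₁.union (f₂.union (f₃.union f₄))),
      Set.ncard_union_eq hd₂ f₁ (f₂.union (f₃.union f₄)),
      Set.ncard_union_eq hd₃ f₂ (f₃.union f₄), Set.ncard_union_eq hd₄ f₃ f₄,
      ncard_image_mul (hy p hp), ncard_image_mul (hy q hq), ncard_image_mul (hy q' hq'),
      ncard_image_mul (hy o ho)]
  ext k
  rw [mul_sub, mul_one, map_sub, map_add]
  rcases k with _ | k
  · simp [monomialSeries, monomialSet_zero]
  · rw [PowerSeries.coeff_succ_mul_X, PowerSeries.coeff_succ_X_mul]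
    simp only [monomialSeries, PowerSeries.coeff_mk, hrec, map_add]
    push_cast
    ring

end Retract

/-! ### Face retractions and split embeddings -/

section Embedding

variable {K : Type*} [Field K] {P P' : Finset Cell}

theorem hilbertSeries_eq (K : Type*) [Field K] (P : Finset Cell)
    [IsDomain (CoordinateRing K P)] :
    hilbertSeries K P = monomialSeries (vertexVar K P) (vertices P) := by
  ext k
  simp [hilbertSeries, monomialSeries, finrank_gradedPart]

/-- When `S` contains both or none of the diagonals, every minor survives the vanishing of the
variables off `S`: it is either unchanged or becomes $0=0$. -/
theorem isRetract_of_closed [IsDomain (CoordinateRing K P)] {S : Set Vertex}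
    (h : ∀ a b, IsInnerInterval P a b → ((a ∈ S ∧ b ∈ S) ↔ ((a.1, b.2) ∈ S ∧ (b.1, a.2) ∈ S))) :
    IsRetract (vertexVar K P) (vertices P) (vertices P ∩ S) := by
  classical
  have hz : ∀ a b, IsInnerInterval P a b →
      (if a ∈ S then vertexVar K P a else 0) * (if b ∈ S then vertexVar K P b else 0) =
      (if (a.1, b.2) ∈ S then vertexVar K P (a.1, b.2) else 0) *
        (if (b.1, a.2) ∈ S then vertexVar K P (b.1, a.2) else 0) := by
    intro a b hab
    have e := vertexVar_mul (K := K) hab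
    by_cases hS : a ∈ S ∧ b ∈ S
    · obtain ⟨h1, h2⟩ := (h a b hab).1 hS
      rw [if_pos hS.1, if_pos hS.2, if_pos h1, if_pos h2, e]
    · have hS' := mt (h a b hab).2 hS
      rw [not_and_or] at hS hS'
      rcases hS with hS | hS <;> rcases hS' with hS' | hS' <;>
        simp only [if_neg hS, if_neg hS', mul_zero, zero_mul]
  let ρ : CoordinateRing K P →ₐ[K] CoordinateRing K P :=
    liftVertex (fun v => if v ∈ S then vertexVar K P v else 0) hz
  refine ⟨Set.inter_subset_left, (ρ : CoordinateRing K P →* CoordinateRing K P), ?_, ?_⟩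
  · rintro v ⟨hv, hS⟩
    exact (liftVertex_vertexVar hz hv).trans (if_pos hS)
  · intro v hv hS
    exact (liftVertex_vertexVar hz hv).trans (if_neg fun h => hS ⟨hv, h⟩)

/-- An embedding of `K[P']` into the domain `K[P]` which is split by setting variables to `0`. -/
theorem isDomain_and_hilbertSeries_of_embedding [IsDomain (CoordinateRing K P)]
    {φ ψ : Vertex → Vertex} {S : Set Vertex} [DecidablePred (· ∈ S)]
    (hφ : ∀ v ∈ vertices P', φ v ∈ vertices P ∧ φ v ∈ S ∧ ψ (φ v) = v)
    (hψ : ∀ v ∈ vertices P, v ∈ S → ψ v ∈ vertices P' ∧ φ (ψ v) = v)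
    (h₁ : ∀ a b, IsInnerInterval P' a b → vertexVar K P (φ a) * vertexVar K P (φ b) =
      vertexVar K P (φ (a.1, b.2)) * vertexVar K P (φ (b.1, a.2)))
    (h₂ : ∀ a b, IsInnerInterval P a b →
      (if a ∈ S then vertexVar K P' (ψ a) else 0) * (if b ∈ S then vertexVar K P' (ψ b) else 0) =
      (if (a.1, b.2) ∈ S then vertexVar K P' (ψ (a.1, b.2)) else 0) *
        (if (b.1, a.2) ∈ S then vertexVar K P' (ψ (b.1, a.2)) else 0)) :
    IsDomain (CoordinateRing K P') ∧
      hilbertSeries K P' = monomialSeries (vertexVar K P) (vertices P ∩ S) := by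
  let ι : CoordinateRing K P' →ₐ[K] CoordinateRing K P :=
    liftVertex (fun v => vertexVar K P (φ v)) h₁
  let ρ : CoordinateRing K P →ₐ[K] CoordinateRing K P' :=
    liftVertex (fun v => if v ∈ S then vertexVar K P' (ψ v) else 0) h₂
  have hι : ∀ v ∈ vertices P', ι (vertexVar K P' v) = vertexVar K P (φ v) := fun v hv =>
    liftVertex_vertexVar h₁ hv
  -- The left inverse makes `ι` injective; `K[P']` is then a domain, and `ι` identifies its
  -- monomials with those of `K[P]` in `S`.
  have hρι : ρ.comp ι = AlgHom.id K _ := by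
    apply coordinateRing_algHom_ext
    intro v hv
    obtain ⟨m1, m2, m3⟩ := hφ v hv
    rw [AlgHom.comp_apply, hι v hv]
    refine (liftVertex_vertexVar h₂ m1).trans ?_
    rw [if_pos m2, m3]
    rfl
  have hinj : Function.Injective ι := by
    have : Function.LeftInverse ρ ι := fun x => DFunLike.congr_fun hρι x
    exact this.injective
  have hdom : IsDomain (CoordinateRing K P') := hinj.isDomain ι.toRingHom
  refine ⟨hdom, ?_⟩
  ext k
  rw [hilbertSeries_eq, monomialSeries, monomialSeries, PowerSeries.coeff_mk, PowerSeries.coeff_mk]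
  congr 1
  rw [← Set.ncard_image_of_injective _ hinj]
  congr 1
  apply Set.Subset.antisymm
  · rintro _ ⟨x, hx, rfl⟩
    exact map_mem_monomialSet (W' := ↑(vertices P) ∩ S)
      (ι : CoordinateRing K P' →* CoordinateRing K P) φ
      (fun v hv => ⟨(hφ v hv).1, (hφ v hv).2.1⟩) (fun v hv => hι v hv) hx
  · rintro _ ⟨s, hs, hk, rfl⟩
    refine ⟨((s.map ψ).map (vertexVar K P')).prod, ⟨s.map ψ, ?_, by simpa using hk, rfl⟩, ?_⟩
    · intro v hv
      obtain ⟨w, hw, rfl⟩ := Multiset.mem_map.1 hv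
      exact (hψ w (hs w hw).1 (hs w hw).2).1
    · rw [map_multiset_prod, Multiset.map_map, Multiset.map_map]
      refine congrArg _ (Multiset.map_congr rfl fun v hv => ?_)
      obtain ⟨m1, m2⟩ := hψ v (hs v hv).1 (hs v hv).2
      exact (hι _ m1).trans (by rw [m2])

end Embedding

/-! ### Geometry of the two arms and of the rectangles in P -/

/-- All cells of the rectangle with corners `(x₁, y₁)` and `(x₂, y₂)` satisfy `p`. -/
def RectangleIn (p : ℤ → ℤ → Prop) (x₁ x₂ y₁ y₂ : ℤ) : Prop :=
  x₁ < x₂ ∧ y₁ < y₂ ∧ ∀ x y, x₁ ≤ x → x < x₂ → y₁ ≤ y → y < y₂ → p x y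

theorem RectangleIn.swap {p : ℤ → ℤ → Prop} {x₁ x₂ y₁ y₂ : ℤ} (h : RectangleIn p x₁ x₂ y₁ y₂) :
    RectangleIn (fun x y => p y x) y₁ y₂ x₁ x₂ :=
  ⟨h.2.1, h.1, fun x y a b c d => h.2.2 y x c d a b⟩

/-- The lattice points of the horizontal arm. -/
def InRow (x₀ y₀ r x y : ℤ) : Prop := (x₀ ≤ x ∧ x ≤ x₀ + r + 1) ∧ (y = y₀ ∨ y = y₀ + 1)

/-- The geometry of an `(L, C)`-polyomino: `p` and `c` are the sets of cells of `P` and `C`, `v` is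
the set of vertices of `C`, the arms meet in the cell `(x₀, y₀)`, and `C` is attached to the side
of height `α` of the horizontal arm, and not to that of height `υ`, and to the side with abscissa
`β` of the vertical arm, and not to that with abscissa `γ`. -/
structure Frame (p c v : ℤ → ℤ → Prop) (x₀ y₀ r s α υ β γ : ℤ) : Prop where
  two_le_r : 2 ≤ r
  two_le_s : 2 ≤ s
  row : (α = y₀ ∧ υ = y₀ + 1) ∨ (α = y₀ + 1 ∧ υ = y₀)
  col : (β = x₀ ∧ γ = x₀ + 1) ∨ (β = x₀ + 1 ∧ γ = x₀)
  mem : ∀ x y, p x y ↔ (y = y₀ ∧ x₀ ≤ x ∧ x ≤ x₀ + r) ∨ (x = x₀ ∧ y₀ ≤ y ∧ y ≤ y₀ + s) ∨ c x y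
  vertex : ∀ x y, v x y ↔ c x y ∨ c (x - 1) y ∨ c x (y - 1) ∨ c (x - 1) (y - 1)
  row_inter : ∀ x y, v x y → InRow x₀ y₀ r x y → y = α ∧ (x = x₀ + r ∨ x = x₀ + r + 1)
  col_inter : ∀ x y, v x y → InRow y₀ x₀ s y x → x = β ∧ (y = y₀ + s ∨ y = y₀ + s + 1)
  row_mem : v (x₀ + r) α ∧ v (x₀ + r + 1) α
  col_mem : v β (y₀ + s) ∧ v β (y₀ + s + 1)

namespace Frame

variable {p c v : ℤ → ℤ → Prop} {x₀ y₀ r s α υ β γ : ℤ}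

theorem swap (h : Frame p c v x₀ y₀ r s α υ β γ) :
    Frame (fun x y => p y x) (fun x y => c y x) (fun x y => v y x) y₀ x₀ s r β γ α υ where
  two_le_r := h.two_le_s
  two_le_s := h.two_le_r
  row := h.col
  col := h.row
  mem x y := by rw [h.mem y x]; tauto
  vertex x y := by rw [h.vertex y x]; tauto
  row_inter x y hv hi := h.col_inter y x hv hi
  col_inter x y hv hi := h.row_inter y x hv hi
  row_mem := h.col_mem
  col_mem := h.row_mem

theorem vertex_of_cell (h : Frame p c v x₀ y₀ r s α υ β γ) {x y : ℤ} (hc : c x y) :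
    v x y ∧ v (x + 1) y ∧ v x (y + 1) ∧ v (x + 1) (y + 1) := by
  simp only [h.vertex, add_sub_cancel_right]
  exact ⟨Or.inl hc, Or.inr (Or.inl hc), Or.inr (Or.inr (Or.inl hc)), Or.inr (Or.inr (Or.inr hc))⟩

theorem vertex_of_rectangle (h : Frame p c v x₀ y₀ r s α υ β γ) {x₁ x₂ y₁ y₂ : ℤ}
    (hR : RectangleIn c x₁ x₂ y₁ y₂) : v x₁ y₁ ∧ v x₂ y₁ ∧ v x₁ y₂ ∧ v x₂ y₂ := by
  obtain ⟨hx, hy, hR⟩ := hR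
  have h1 := (h.vertex_of_cell (hR x₁ y₁ le_rfl hx le_rfl hy)).1
  have h2 := (h.vertex_of_cell (hR (x₂ - 1) y₁ (by omega) (by omega) le_rfl hy)).2.1
  have h3 := (h.vertex_of_cell (hR x₁ (y₂ - 1) le_rfl hx (by omega) (by omega))).2.2.1
  have h4 := (h.vertex_of_cell (hR (x₂ - 1) (y₂ - 1) (by omega) (by omega) (by omega)
    (by omega))).2.2.2
  rw [sub_add_cancel] at h2 h3 h4
  rw [sub_add_cancel] at h4
  exact ⟨h1, h2, h3, h4⟩

/-- No cell of `P` lies directly to the left or to the right of the horizontal arm. -/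
theorem row_cell (h : Frame p c v x₀ y₀ r s α υ β γ) {x₁ x₂ : ℤ}
    (hR : ∀ x, x₁ ≤ x → x < x₂ → p x y₀) {i : ℤ} (hi : x₁ ≤ i) (hi' : i < x₂)
    (hrow : x₀ ≤ i ∧ i ≤ x₀ + r) : x₀ ≤ x₁ ∧ x₂ ≤ x₀ + r + 1 := by
  have h2 := h.two_le_r
  have h3 := h.two_le_s
  have hrow' := h.row
  constructor
  · by_contra! hlt
    have hp := hR (x₀ - 1) (by omega) (by omega)
    rw [h.mem] at hp
    rcases hp with hp | hp | hp
    · omega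
    · omega
    · have hv := (h.vertex_of_cell hp).2.1
      have := h.row_inter _ _ hv ⟨by omega, by omega⟩
      omega
  · by_contra! hlt
    have hp := hR (x₀ + r + 1) (by omega) (by omega)
    rw [h.mem] at hp
    rcases hp with hp | hp | hp
    · omega
    · omega
    · obtain ⟨v1, -, v2, -⟩ := h.vertex_of_cell hp
      have := h.row_inter _ _ v1 ⟨by omega, by omega⟩
      have := h.row_inter _ _ v2 ⟨by omega, by omega⟩
      omega

/-- The corners of a rectangle of `P` crossing the end of the horizontal arm. -/
def CrossesRow (v : ℤ → ℤ → Prop) (x₀ r υ x₁ x₂ y₁ y₂ : ℤ) : Prop :=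
  x₁ = x₀ + r ∧ x₂ = x₀ + r + 1 ∧
    ((y₁ = υ ∧ v x₁ y₂ ∧ v x₂ y₂) ∨ (y₂ = υ ∧ v x₁ y₁ ∧ v x₂ y₁))

/-- A rectangle of `P` containing a cell of the horizontal arm. -/
theorem rectangle_row (h : Frame p c v x₀ y₀ r s α υ β γ) {x₁ x₂ y₁ y₂ : ℤ}
    (hR : RectangleIn p x₁ x₂ y₁ y₂) (hy : y₁ ≤ y₀ ∧ y₀ < y₂) {i : ℤ} (hi : x₁ ≤ i ∧ i < x₂)
    (hrow : x₀ ≤ i ∧ i ≤ x₀ + r) :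
    (y₁ = y₀ ∧ y₂ = y₀ + 1 ∧ x₀ ≤ x₁ ∧ x₂ ≤ x₀ + r + 1) ∨
    (x₁ = x₀ ∧ x₂ = x₀ + 1 ∧ y₀ ≤ y₁ ∧ y₂ ≤ y₀ + s + 1) ∨
    CrossesRow v x₀ r υ x₁ x₂ y₁ y₂ := by
  have h2 := h.two_le_r
  have h3 := h.two_le_s
  have hrow' := h.row
  have hcol' := h.col
  obtain ⟨hx, -, hR⟩ := hR
  obtain ⟨hx₁, hx₂⟩ := h.row_cell (fun x a b => hR x y₀ a b hy.1 hy.2) hi.1 hi.2 hrow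
  by_cases hlow : y₁ < y₀
  -- A cell just below the arm belongs to `C`, and both its upper corners lie on the arm. So it sits
  -- under the last cell of the arm.
  · have key : ∀ x, x₁ ≤ x → x < x₂ → x = x₀ + r ∧ α = y₀ := by
      intro x a b
      have hp := hR x (y₀ - 1) a b (by omega) (by omega)
      rw [h.mem] at hp
      rcases hp with hp | hp | hp
      · omega
      · omega
      · obtain ⟨-, -, v1, v2⟩ := h.vertex_of_cell hp
        rw [sub_add_cancel] at v1 v2
        have := h.row_inter _ _ v1 ⟨by omega, by omega⟩
        have := h.row_inter _ _ v2 ⟨by omega, by omega⟩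
        omega
    have k1 := key x₁ le_rfl hx
    have k2 := key (x₂ - 1) (by omega) (by omega)
    -- The rectangle cannot leave the arm on both sides, since `C` touches the arm only at height
    -- `α`.
    have hy₂ : y₂ = y₀ + 1 := by
      by_contra hne
      have hp := hR x₁ (y₀ + 1) le_rfl hx (by omega) (by omega)
      rw [h.mem] at hp
      rcases hp with hp | hp | hp
      · omega
      · omega
      · have := h.row_inter _ _ (h.vertex_of_cell hp).1 ⟨by omega, by omega⟩
        omega
    refine Or.inr (Or.inr ⟨k1.1, by omega, Or.inr ⟨by omega, ?_⟩⟩)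
    have hp := hR x₁ y₁ le_rfl hx le_rfl (by omega)
    rw [h.mem] at hp
    rcases hp with hp | hp | hp
    · omega
    · omega
    · obtain ⟨v1, v2, -⟩ := h.vertex_of_cell hp
      rw [show x₂ = x₁ + 1 by omega]
      exact ⟨v1, v2⟩
  by_cases hup : y₀ + 1 < y₂
  · have key : ∀ x, x₁ ≤ x → x < x₂ → x = x₀ ∨ (x = x₀ + r ∧ α = y₀ + 1) := by
      intro x a b
      have hp := hR x (y₀ + 1) a b (by omega) (by omega)
      rw [h.mem] at hp
      rcases hp with hp | hp | hp
      · omega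
      · omega
      · obtain ⟨v1, v2, -⟩ := h.vertex_of_cell hp
        have := h.row_inter _ _ v1 ⟨by omega, by omega⟩
        have := h.row_inter _ _ v2 ⟨by omega, by omega⟩
        omega
    have hx' : x₂ = x₁ + 1 := by
      by_contra hne
      have k1 := key x₁ le_rfl hx
      have k2 := key (x₁ + 1) (by omega) (by omega)
      omega
    rcases key x₁ le_rfl hx with k | k
    · have := h.swap.row_cell (x₁ := y₁) (x₂ := y₂) (fun y a b => by
        rw [← k]; exact hR x₁ y le_rfl hx a b) hy.1 hy.2 ⟨by omega, by omega⟩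
      exact Or.inr (Or.inl ⟨k, by omega, this.1, this.2⟩)
    · refine Or.inr (Or.inr ⟨k.1, by omega, Or.inl ⟨by omega, ?_⟩⟩)
      have hp := hR x₁ (y₂ - 1) le_rfl hx (by omega) (by omega)
      rw [h.mem] at hp
      rcases hp with hp | hp | hp
      · omega
      · omega
      · obtain ⟨-, -, v1, v2⟩ := h.vertex_of_cell hp
        rw [sub_add_cancel] at v1 v2
        rw [hx']
        exact ⟨v1, v2⟩
  · exact Or.inl ⟨by omega, by omega, hx₁, hx₂⟩

/-- The classification of the rectangles contained in an `(L, C)`-polyomino. -/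
theorem rectangle_cases (h : Frame p c v x₀ y₀ r s α υ β γ) {x₁ x₂ y₁ y₂ : ℤ}
    (hR : RectangleIn p x₁ x₂ y₁ y₂) :
    (y₁ = y₀ ∧ y₂ = y₀ + 1 ∧ x₀ ≤ x₁ ∧ x₂ ≤ x₀ + r + 1) ∨
    (x₁ = x₀ ∧ x₂ = x₀ + 1 ∧ y₀ ≤ y₁ ∧ y₂ ≤ y₀ + s + 1) ∨
    RectangleIn c x₁ x₂ y₁ y₂ ∨ CrossesRow v x₀ r υ x₁ x₂ y₁ y₂ ∨
    CrossesRow (fun x y => v y x) y₀ s γ y₁ y₂ x₁ x₂ := by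
  by_cases hc : RectangleIn c x₁ x₂ y₁ y₂
  · exact Or.inr (Or.inr (Or.inl hc))
  -- A rectangle not contained in `C` has a cell in one of the arms; the vertical arm is handled by
  -- exchanging the coordinates.
  · have : ∃ x y, x₁ ≤ x ∧ x < x₂ ∧ y₁ ≤ y ∧ y < y₂ ∧ ¬ c x y := by
      by_contra! hne
      exact hc ⟨hR.1, hR.2.1, hne⟩
    obtain ⟨x, y, a, b, a', b', hcxy⟩ := this
    have hp := hR.2.2 x y a b a' b'
    rw [h.mem] at hp
    rcases hp with ⟨rfl, hp⟩ | ⟨rfl, hp⟩ | hp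
    · rcases h.rectangle_row hR ⟨a', b'⟩ ⟨a, b⟩ hp with h' | h' | h'
      exacts [Or.inl h', Or.inr (Or.inl h'), Or.inr (Or.inr (Or.inr (Or.inl h')))]
    · rcases h.swap.rectangle_row hR.swap ⟨a, b⟩ ⟨a', b'⟩ hp with h' | h' | h'
      exacts [Or.inr (Or.inl h'), Or.inl h', Or.inr (Or.inr (Or.inr (Or.inr h')))]
    · exact absurd hp hcxy

/-! ### Closed sets of vertices -/

/-- A set of vertices containing both or none of the diagonals of every rectangle in `p`. -/
def Closed (p S : ℤ → ℤ → Prop) : Prop :=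
  ∀ x₁ x₂ y₁ y₂, RectangleIn p x₁ x₂ y₁ y₂ → ((S x₁ y₁ ∧ S x₂ y₂) ↔ (S x₁ y₂ ∧ S x₂ y₁))

theorem Closed.swap {S : ℤ → ℤ → Prop} (h : Closed p S) :
    Closed (fun x y => p y x) (fun x y => S y x) := fun x₁ x₂ y₁ y₂ hR => by
  rw [h y₁ y₂ x₁ x₂ hR.swap, and_comm]

/-- A rectangle with an edge at height `υ` has a vertex outside `S` on each diagonal. All other
rectangles have their four corners in `S`. -/
theorem closed_row (h : Frame p c v x₀ y₀ r s α υ β γ) {S : ℤ → ℤ → Prop}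
    (h₁ : ∀ x, x₀ ≤ x → x ≤ x₀ + r + 1 → ¬ S x υ)
    (h₂ : ∀ x y, (x = x₀ ∨ x = x₀ + 1) → y₀ ≤ y → y ≤ y₀ + s + 1 → y ≠ υ → S x y)
    (h₃ : ∀ x y, v x y → S x y) : Closed p S := by
  intro x₁ x₂ y₁ y₂ hR
  have h2 := h.two_le_r
  have h3 := h.two_le_s
  have hrow := h.row
  have hcol := h.col
  have hx := hR.1
  have hy := hR.2.1
  rcases h.rectangle_cases hR with h' | h' | h' | h' | h'
  · have a₁ := h₁ x₁ (by omega) (by omega)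
    have a₂ := h₁ x₂ (by omega) (by omega)
    have : y₁ = υ ∨ y₂ = υ := by omega
    rcases this with rfl | rfl <;> tauto
  · by_cases e₁ : y₁ = υ
    · have a₁ := h₁ x₁ (by omega) (by omega)
      have a₂ := h₁ x₂ (by omega) (by omega)
      rw [e₁]; tauto
    by_cases e₂ : y₂ = υ
    · have a₁ := h₁ x₁ (by omega) (by omega)
      have a₂ := h₁ x₂ (by omega) (by omega)
      rw [e₂]; tauto
    have b₁ := h₂ x₁ y₁ (by omega) (by omega) (by omega) e₁
    have b₂ := h₂ x₁ y₂ (by omega) (by omega) (by omega) e₂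
    have b₃ := h₂ x₂ y₁ (by omega) (by omega) (by omega) e₁
    have b₄ := h₂ x₂ y₂ (by omega) (by omega) (by omega) e₂
    tauto
  · obtain ⟨v1, v2, v3, v4⟩ := h.vertex_of_rectangle h'
    have := h₃ _ _ v1
    have := h₃ _ _ v2
    have := h₃ _ _ v3
    have := h₃ _ _ v4
    tauto
  · obtain ⟨e₁, e₂, h'⟩ := h'
    have a₁ := h₁ x₁ (by omega) (by omega)
    have a₂ := h₁ x₂ (by omega) (by omega)
    have : y₁ = υ ∨ y₂ = υ := by tauto
    rcases this with rfl | rfl <;> tauto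
  · obtain ⟨e₁, e₂, h'⟩ := h'
    have key : ∀ x y, (x = γ ∨ v x y) → (y = y₁ ∨ y = y₂) → S x y := by
      rintro x y (rfl | hv) e
      · exact h₂ _ _ (by omega) (by omega) (by omega) (by omega)
      · exact h₃ _ _ hv
    have b₁ : S x₁ y₁ := key _ _ (by tauto) (by tauto)
    have b₂ : S x₁ y₂ := key _ _ (by tauto) (by tauto)
    have b₃ : S x₂ y₁ := key _ _ (by tauto) (by tauto)
    have b₄ : S x₂ y₂ := key _ _ (by tauto) (by tauto)
    tauto

/-- Every rectangle not inside `C` has a whole edge on a detached side, so neither of its diagonals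
lies in `S`. -/
theorem closed_row_col (h : Frame p c v x₀ y₀ r s α υ β γ) {S : ℤ → ℤ → Prop}
    (h₁ : ∀ x, x₀ ≤ x → x ≤ x₀ + r + 1 → ¬ S x υ)
    (h₂ : ∀ y, y₀ ≤ y → y ≤ y₀ + s + 1 → ¬ S γ y)
    (h₃ : ∀ x y, v x y → S x y) : Closed p S := by
  intro x₁ x₂ y₁ y₂ hR
  have h2 := h.two_le_r
  have h3 := h.two_le_s
  have hrow := h.row
  have hcol := h.col
  have hx := hR.1
  have hy := hR.2.1
  have krow : (y₁ = υ ∨ y₂ = υ) → x₀ ≤ x₁ → x₂ ≤ x₀ + r + 1 →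
      ((S x₁ y₁ ∧ S x₂ y₂) ↔ (S x₁ y₂ ∧ S x₂ y₁)) := by
    intro e a b
    have a₁ := h₁ x₁ (by omega) (by omega)
    have a₂ := h₁ x₂ (by omega) (by omega)
    rcases e with rfl | rfl <;> tauto
  have kcol : (x₁ = γ ∨ x₂ = γ) → y₀ ≤ y₁ → y₂ ≤ y₀ + s + 1 →
      ((S x₁ y₁ ∧ S x₂ y₂) ↔ (S x₁ y₂ ∧ S x₂ y₁)) := by
    intro e a b
    have a₁ := h₂ y₁ (by omega) (by omega)
    have a₂ := h₂ y₂ (by omega) (by omega)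
    rcases e with rfl | rfl <;> tauto
  rcases h.rectangle_cases hR with h' | h' | h' | h' | h'
  · exact krow (by omega) (by omega) (by omega)
  · exact kcol (by omega) (by omega) (by omega)
  · obtain ⟨v1, v2, v3, v4⟩ := h.vertex_of_rectangle h'
    have := h₃ _ _ v1
    have := h₃ _ _ v2
    have := h₃ _ _ v3
    have := h₃ _ _ v4
    tauto
  · obtain ⟨e₁, e₂, h'⟩ := h'
    exact krow (by tauto) (by omega) (by omega)
  · obtain ⟨e₁, e₂, h'⟩ := h'
    exact kcol (by tauto) (by omega) (by omega)

/-- The four corners of the cell where the arms meet. -/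
def IsCorner (x₀ y₀ x y : ℤ) : Prop := (x = x₀ ∨ x = x₀ + 1) ∧ (y = y₀ ∨ y = y₀ + 1)

theorem not_isCorner_of_vertex (h : Frame p c v x₀ y₀ r s α υ β γ) {x y : ℤ} (hv : v x y) :
    ¬ IsCorner x₀ y₀ x y := by
  rintro ⟨hx, hy⟩
  have h2 := h.two_le_r
  have := h.row_inter x y hv ⟨by omega, by omega⟩
  omega

/-- Either an edge of the rectangle consists of two corners of the common cell, so that both
diagonals are hit, or the rectangle avoids these corners and the three removed cells. -/
theorem rectangle_corner_cases (h : Frame p c v x₀ y₀ r s α υ β γ) {x₁ x₂ y₁ y₂ : ℤ}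
    (hR : RectangleIn p x₁ x₂ y₁ y₂) :
    (y₁ = y₀ ∧ y₂ = y₀ + 1 ∧ (x₁ = x₀ ∨ x₁ = x₀ + 1)) ∨
    (x₁ = x₀ ∧ x₂ = x₀ + 1 ∧ (y₁ = y₀ ∨ y₁ = y₀ + 1)) ∨
    (¬ IsCorner x₀ y₀ x₁ y₁ ∧ ¬ IsCorner x₀ y₀ x₁ y₂ ∧ ¬ IsCorner x₀ y₀ x₂ y₁ ∧
      ¬ IsCorner x₀ y₀ x₂ y₂ ∧ ∀ x y, x₁ ≤ x → x < x₂ → y₁ ≤ y → y < y₂ →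
        ¬ (y = y₀ ∧ (x = x₀ ∨ x = x₀ + 1)) ∧ ¬ (x = x₀ ∧ y = y₀ + 1)) := by
  have h2 := h.two_le_r
  have h3 := h.two_le_s
  have hrow := h.row
  have hcol := h.col
  have hx := hR.1
  have hy := hR.2.1
  rcases h.rectangle_cases hR with h' | h' | h' | h' | h'
  · by_cases e : x₁ = x₀ ∨ x₁ = x₀ + 1
    · exact Or.inl ⟨h'.1, h'.2.1, e⟩
    · refine Or.inr (Or.inr ⟨?_, ?_, ?_, ?_, ?_⟩)
      iterate 4 (unfold IsCorner; omega)
      intros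
      omega
  · by_cases e : y₁ = y₀ ∨ y₁ = y₀ + 1
    · exact Or.inr (Or.inl ⟨h'.1, h'.2.1, e⟩)
    · refine Or.inr (Or.inr ⟨?_, ?_, ?_, ?_, ?_⟩)
      iterate 4 (unfold IsCorner; omega)
      intros
      omega
  · obtain ⟨v1, v2, v3, v4⟩ := h.vertex_of_rectangle h'
    refine Or.inr (Or.inr ⟨h.not_isCorner_of_vertex v1, h.not_isCorner_of_vertex v3,
      h.not_isCorner_of_vertex v2, h.not_isCorner_of_vertex v4, fun x y a b a' b' => ?_⟩)
    have hv := (h.vertex_of_cell (h'.2.2 x y a b a' b')).1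
    constructor
    · rintro ⟨rfl, e⟩
      have := h.row_inter _ _ hv ⟨by omega, by omega⟩
      omega
    · rintro ⟨rfl, e⟩
      have := h.row_inter _ _ hv ⟨by omega, by omega⟩
      omega
  · obtain ⟨e₁, e₂, h'⟩ := h'
    refine Or.inr (Or.inr ⟨?_, ?_, ?_, ?_, ?_⟩)
    iterate 4 (unfold IsCorner; omega)
    intros
    omega
  · obtain ⟨e₁, e₂, h'⟩ := h'
    refine Or.inr (Or.inr ⟨?_, ?_, ?_, ?_, ?_⟩)
    iterate 4 (unfold IsCorner; omega)
    intros
    omega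

theorem closed_not_isCorner (h : Frame p c v x₀ y₀ r s α υ β γ) :
    Closed p fun x y => ¬ IsCorner x₀ y₀ x y := by
  intro x₁ x₂ y₁ y₂ hR
  rcases h.rectangle_corner_cases hR with h' | h' | h'
  · have a : IsCorner x₀ y₀ x₁ y₁ := ⟨h'.2.2, by omega⟩
    have b : IsCorner x₀ y₀ x₁ y₂ := ⟨h'.2.2, by omega⟩
    tauto
  · have a : IsCorner x₀ y₀ x₁ y₁ := ⟨by omega, h'.2.2⟩
    have b : IsCorner x₀ y₀ x₂ y₁ := ⟨by omega, h'.2.2⟩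
    tauto
  · tauto

end Frame

/-! ### Vertices and relations after removing cells -/

/-- The lattice point `(x, y)` is a vertex of a cell satisfying `p`. -/
def VertexOf (p : ℤ → ℤ → Prop) (x y : ℤ) : Prop :=
  p x y ∨ p (x - 1) y ∨ p x (y - 1) ∨ p (x - 1) (y - 1)

theorem vertexOf_swap {p : ℤ → ℤ → Prop} {x y : ℤ} :
    VertexOf (fun x y => p y x) x y ↔ VertexOf p y x := by
  unfold VertexOf
  tauto

/-- The values `Y` satisfy the relations given by the rectangles in `p`. -/
def RelationsIn {B : Type*} [CommRing B] (p : ℤ → ℤ → Prop) (Y : ℤ → ℤ → B) : Prop :=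
  ∀ x₁ x₂ y₁ y₂, RectangleIn p x₁ x₂ y₁ y₂ → Y x₁ y₁ * Y x₂ y₂ = Y x₁ y₂ * Y x₂ y₁

theorem RelationsIn.swap {B : Type*} [CommRing B] {p : ℤ → ℤ → Prop} {Y : ℤ → ℤ → B}
    (h : RelationsIn p Y) : RelationsIn (fun x y => p y x) fun x y => Y y x :=
  fun x₁ x₂ y₁ y₂ hR => by rw [h y₁ y₂ x₁ x₂ hR.swap, mul_comm]

/-- The map on ordinates moving `(x₀, a)` and `(x₀ + 1, a)` to height `b`. -/
def shiftRow (x₀ a b x y : ℤ) : ℤ := if (x = x₀ ∨ x = x₀ + 1) ∧ y = a then b else y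

theorem shiftRow_of_not {x₀ a b x y : ℤ} (h : ¬ ((x = x₀ ∨ x = x₀ + 1) ∧ y = a)) :
    shiftRow x₀ a b x y = y := if_neg h

theorem shiftRow_of {x₀ a b x y : ℤ} (h : (x = x₀ ∨ x = x₀ + 1) ∧ y = a) :
    shiftRow x₀ a b x y = b := if_pos h

namespace Frame

variable {p c v : ℤ → ℤ → Prop} {x₀ y₀ r s α υ β γ : ℤ}

theorem not_row_of_cell (h : Frame p c v x₀ y₀ r s α υ β γ) {x y : ℤ} (hc : c x y) :
    ¬ (y = y₀ ∧ x₀ ≤ x ∧ x ≤ x₀ + r) := by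
  rintro ⟨rfl, a, b⟩
  obtain ⟨v1, -, v2, -⟩ := h.vertex_of_cell hc
  have := h.row_inter _ _ v1 ⟨by omega, by omega⟩
  have := h.row_inter _ _ v2 ⟨by omega, by omega⟩
  omega

theorem not_shift_of_vertex (h : Frame p c v x₀ y₀ r s α υ β γ) {x y a : ℤ} (hv : v x y)
    (ha : a = y₀ ∨ a = y₀ + 1) : ¬ ((x = x₀ ∨ x = x₀ + 1) ∧ y = a) := by
  rintro ⟨hx, rfl⟩
  exact h.not_isCorner_of_vertex hv ⟨hx, ha⟩

theorem vertexOf_of_row {q : ℤ → ℤ → Prop} {y₀ a b x y : ℤ} (hab : a ≤ b)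
    (hq : ∀ x, a ≤ x → x ≤ b → q x y₀) (hx : a ≤ x ∧ x ≤ b + 1) (hy : y = y₀ ∨ y = y₀ + 1) :
    VertexOf q x y := by
  have : ∃ i, a ≤ i ∧ i ≤ b ∧ (x = i ∨ x = i + 1) := by
    by_cases e : x = b + 1
    · exact ⟨b, hab, le_rfl, Or.inr e⟩
    · exact ⟨x, by omega, by omega, Or.inl rfl⟩
  obtain ⟨i, h1, h2, h3⟩ := this
  have := hq i h1 h2
  unfold VertexOf
  rcases h3 with rfl | rfl <;> rcases hy with rfl | rfl <;>
    (try simp only [add_sub_cancel_right]) <;> tauto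

/-- The vertices of `P`. -/
theorem vertexOf_iff (h : Frame p c v x₀ y₀ r s α υ β γ) {x y : ℤ} :
    VertexOf p x y ↔ v x y ∨ InRow x₀ y₀ r x y ∨ InRow y₀ x₀ s y x := by
  have h2 := h.two_le_r
  have h3 := h.two_le_s
  constructor
  · intro hv
    have key : ∀ i j, p i j → (x = i ∨ x = i + 1) → (y = j ∨ y = j + 1) →
        v x y ∨ InRow x₀ y₀ r x y ∨ InRow y₀ x₀ s y x := by
      intro i j hp hi hj
      rw [h.mem] at hp
      rcases hp with hp | hp | hp
      · exact Or.inr (Or.inl ⟨by omega, by omega⟩)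
      · exact Or.inr (Or.inr ⟨by omega, by omega⟩)
      · obtain ⟨v1, v2, v3, v4⟩ := h.vertex_of_cell hp
        rcases hi with rfl | rfl <;> rcases hj with rfl | rfl <;> tauto
    rcases hv with hv | hv | hv | hv
    exacts [key _ _ hv (by omega) (by omega), key _ _ hv (by omega) (by omega),
      key _ _ hv (by omega) (by omega), key _ _ hv (by omega) (by omega)]
  · rintro (hv | ⟨hx, hy⟩ | ⟨hy, hx⟩)
    · rw [h.vertex] at hv
      have : ∀ i j, c i j → p i j := fun i j hc => (h.mem i j).2 (Or.inr (Or.inr hc))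
      exact hv.imp (this _ _) (Or.imp (this _ _) (Or.imp (this _ _) (this _ _)))
    · exact vertexOf_of_row (a := x₀) (b := x₀ + r) (by omega)
        (fun x a b => (h.mem x y₀).2 (Or.inl ⟨rfl, a, b⟩)) hx hy
    · exact vertexOf_swap.1 (vertexOf_of_row (q := fun x y => p y x) (a := y₀) (b := y₀ + s)
        (by omega) (fun y a b => (h.mem x₀ y).2 (Or.inr (Or.inl ⟨rfl, a, b⟩))) hy hx)

/-! ### Removing the horizontal arm -/

/-- The cells of `P` outside the horizontal arm. -/
def NotRow (p : ℤ → ℤ → Prop) (x₀ y₀ r x y : ℤ) : Prop :=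
  p x y ∧ ¬ (y = y₀ ∧ x₀ ≤ x ∧ x ≤ x₀ + r)

/-- The vertices of `P` remaining after setting to `0` the detached side of the horizontal arm,
without the free vertices on its other side. -/
def RowSet (x₀ r α υ x y : ℤ) : Prop :=
  ¬ (y = υ ∧ x₀ ≤ x ∧ x ≤ x₀ + r + 1) ∧ ¬ (y = α ∧ x₀ + 2 ≤ x ∧ x ≤ x₀ + r - 1)

theorem rowSet_of_vertex (h : Frame p c v x₀ y₀ r s α υ β γ) {x y : ℤ} (hv : v x y) :
    RowSet x₀ r α υ x y := by
  have hrow := h.row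
  constructor
  · rintro ⟨rfl, a, b⟩
    have := h.row_inter _ _ hv ⟨by omega, by omega⟩
    omega
  · rintro ⟨rfl, a, b⟩
    have := h.row_inter _ _ hv ⟨by omega, by omega⟩
    omega

theorem vertexOf_notRow_iff (h : Frame p c v x₀ y₀ r s α υ β γ) {x y : ℤ} :
    VertexOf (NotRow p x₀ y₀ r) x y ↔
      v x y ∨ ((x = x₀ ∨ x = x₀ + 1) ∧ y₀ + 1 ≤ y ∧ y ≤ y₀ + s + 1) := by
  have h2 := h.two_le_r
  have h3 := h.two_le_s
  constructor
  · intro hv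
    have key : ∀ i j, NotRow p x₀ y₀ r i j → (x = i ∨ x = i + 1) → (y = j ∨ y = j + 1) →
        v x y ∨ ((x = x₀ ∨ x = x₀ + 1) ∧ y₀ + 1 ≤ y ∧ y ≤ y₀ + s + 1) := by
      rintro i j ⟨hp, hn⟩ hi hj
      rw [h.mem] at hp
      rcases hp with hp | hp | hp
      · exact absurd hp hn
      · exact Or.inr ⟨by omega, by omega⟩
      · obtain ⟨v1, v2, v3, v4⟩ := h.vertex_of_cell hp
        rcases hi with rfl | rfl <;> rcases hj with rfl | rfl <;> tauto
    rcases hv with hv | hv | hv | hv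
    exacts [key _ _ hv (by omega) (by omega), key _ _ hv (by omega) (by omega),
      key _ _ hv (by omega) (by omega), key _ _ hv (by omega) (by omega)]
  · rintro (hv | ⟨hx, hy⟩)
    · rw [h.vertex] at hv
      have : ∀ i j, c i j → NotRow p x₀ y₀ r i j := fun i j hc =>
        ⟨(h.mem i j).2 (Or.inr (Or.inr hc)), h.not_row_of_cell hc⟩
      exact hv.imp (this _ _) (Or.imp (this _ _) (Or.imp (this _ _) (this _ _)))
    · exact vertexOf_swap.1 (vertexOf_of_row (q := fun x y => NotRow p x₀ y₀ r y x) (a := y₀ + 1)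
        (b := y₀ + s) (by omega) (fun y a b => ⟨(h.mem x₀ y).2 (Or.inr (Or.inl ⟨rfl, by omega, b⟩)),
          by omega⟩) (by omega) hx)

/-- Without the horizontal arm, the vertical arm ends at height `y₀ + 1`, whereas the edge kept by
`RowSet` is at height `α`. The map slides this edge down when `α = y₀` and is the identity when `α =
y₀ + 1`. -/
theorem shiftRow_mem (h : Frame p c v x₀ y₀ r s α υ β γ) {x y : ℤ}
    (hv : VertexOf (NotRow p x₀ y₀ r) x y) :
    VertexOf p x (shiftRow x₀ (y₀ + 1) α x y) ∧ RowSet x₀ r α υ x (shiftRow x₀ (y₀ + 1) α x y) ∧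
      shiftRow x₀ α (y₀ + 1) x (shiftRow x₀ (y₀ + 1) α x y) = y := by
  have h2 := h.two_le_r
  have h3 := h.two_le_s
  have hrow := h.row
  rw [vertexOf_notRow_iff h] at hv
  rw [vertexOf_iff h]
  by_cases e : (x = x₀ ∨ x = x₀ + 1) ∧ y = y₀ + 1
  · rw [shiftRow_of e, shiftRow_of ⟨e.1, rfl⟩]
    exact ⟨Or.inr (Or.inl ⟨by omega, by omega⟩), by unfold RowSet; omega, e.2.symm⟩
  · rw [shiftRow_of_not e]
    rcases hv with hv | hv
    · exact ⟨Or.inl hv, h.rowSet_of_vertex hv,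
        shiftRow_of_not (h.not_shift_of_vertex hv (by omega))⟩
    · exact ⟨Or.inr (Or.inr ⟨by omega, by omega⟩), by unfold RowSet; omega,
        shiftRow_of_not (by omega)⟩

theorem shiftRow_mem' (h : Frame p c v x₀ y₀ r s α υ β γ) {x y : ℤ} (hv : VertexOf p x y)
    (hS : RowSet x₀ r α υ x y) : VertexOf (NotRow p x₀ y₀ r) x (shiftRow x₀ α (y₀ + 1) x y) ∧
      shiftRow x₀ (y₀ + 1) α x (shiftRow x₀ α (y₀ + 1) x y) = y := by
  have h2 := h.two_le_r
  have h3 := h.two_le_s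
  have hrow := h.row
  rw [vertexOf_notRow_iff h]
  rw [vertexOf_iff h] at hv
  by_cases e : (x = x₀ ∨ x = x₀ + 1) ∧ y = α
  · rw [shiftRow_of e, shiftRow_of ⟨e.1, rfl⟩]
    exact ⟨Or.inr ⟨by omega, by omega⟩, e.2.symm⟩
  · rw [shiftRow_of_not e]
    -- Apart from the moved edge, the only points of the horizontal arm kept by `RowSet` are the two
    -- at its end, which belong to `C` by `row_mem`.
    have main : v x y ∨ ((x = x₀ ∨ x = x₀ + 1) ∧ y₀ + 2 ≤ y ∧ y ≤ y₀ + s + 1) := by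
      rcases hv with hv | hv | hv
      · exact Or.inl hv
      · obtain ⟨hx, hy⟩ := hv
        obtain ⟨s1, s2⟩ := hS
        left
        have hya : y = α := by omega
        have : x = x₀ + r ∨ x = x₀ + r + 1 := by omega
        rcases this with rfl | rfl
        · rw [hya]; exact h.row_mem.1
        · rw [hya]; exact h.row_mem.2
      · obtain ⟨hy, hx⟩ := hv
        obtain ⟨s1, s2⟩ := hS
        exact Or.inr ⟨hx, by omega, by omega⟩
    rcases main with hv | hv
    · exact ⟨Or.inl hv, shiftRow_of_not (h.not_shift_of_vertex hv (by omega))⟩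
    · exact ⟨Or.inr ⟨by omega, by omega⟩, shiftRow_of_not (by omega)⟩

variable {B : Type*} [CommRing B] {Y Z : ℤ → ℤ → B}

/-- Only rectangles of the vertical arm with lower edge at height `y₀ + 1` are affected; sliding
that edge to `α` leaves them inside the vertical arm. -/
theorem relationsIn_shiftRow (h : Frame p c v x₀ y₀ r s α υ β γ) (hY : RelationsIn p Y) :
    RelationsIn (NotRow p x₀ y₀ r) fun x y => Y x (shiftRow x₀ (y₀ + 1) α x y) := by
  intro x₁ x₂ y₁ y₂ hR
  have h2 := h.two_le_r
  have h3 := h.two_le_s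
  have hrow := h.row
  have hx := hR.1
  have hy := hR.2.1
  have hR' : RectangleIn p x₁ x₂ y₁ y₂ :=
    ⟨hx, hy, fun x y a b a' b' => (hR.2.2 x y a b a' b').1⟩
  have hfix : (¬ ((x₁ = x₀ ∨ x₁ = x₀ + 1) ∧ y₁ = y₀ + 1)) →
      (¬ ((x₁ = x₀ ∨ x₁ = x₀ + 1) ∧ y₂ = y₀ + 1)) →
      (¬ ((x₂ = x₀ ∨ x₂ = x₀ + 1) ∧ y₁ = y₀ + 1)) →
      (¬ ((x₂ = x₀ ∨ x₂ = x₀ + 1) ∧ y₂ = y₀ + 1)) →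
      Y x₁ (shiftRow x₀ (y₀ + 1) α x₁ y₁) * Y x₂ (shiftRow x₀ (y₀ + 1) α x₂ y₂) =
      Y x₁ (shiftRow x₀ (y₀ + 1) α x₁ y₂) * Y x₂ (shiftRow x₀ (y₀ + 1) α x₂ y₁) := by
    intro a b c d
    rw [shiftRow_of_not a, shiftRow_of_not b, shiftRow_of_not c, shiftRow_of_not d]
    exact hY _ _ _ _ hR'
  rcases h.rectangle_cases hR' with h' | h' | h' | h' | h'
  · exact absurd (⟨h'.1, by omega, by omega⟩) (hR.2.2 x₁ y₁ le_rfl hx le_rfl hy).2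
  · have hn := (hR.2.2 x₁ y₁ le_rfl hx le_rfl hy).2
    by_cases e : y₁ = y₀ + 1
    · dsimp only
      rw [shiftRow_of ⟨Or.inl h'.1, e⟩, shiftRow_of ⟨Or.inr h'.2.1, e⟩,
        shiftRow_of_not (by omega), shiftRow_of_not (by omega)]
      refine hY _ _ _ _ ⟨hx, by omega, fun x y a b a' b' => ?_⟩
      exact (h.mem x y).2 (Or.inr (Or.inl ⟨by omega, by omega, by omega⟩))
    · exact hfix (by omega) (by omega) (by omega) (by omega)
  · obtain ⟨v1, v2, v3, v4⟩ := h.vertex_of_rectangle h'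
    exact hfix (h.not_shift_of_vertex v1 (Or.inr rfl)) (h.not_shift_of_vertex v3 (Or.inr rfl))
      (h.not_shift_of_vertex v2 (Or.inr rfl)) (h.not_shift_of_vertex v4 (Or.inr rfl))
  · obtain ⟨e₁, e₂, -⟩ := h'
    exact hfix (by omega) (by omega) (by omega) (by omega)
  · obtain ⟨e₁, e₂, -⟩ := h'
    exact hfix (by omega) (by omega) (by omega) (by omega)

/-- The converse of the slide: a rectangle with an edge at height `υ` gives $0=0$, and one of the
vertical arm standing at height `α` is shortened to start at `y₀ + 1`. -/
theorem relationsIn_of_notRow (h : Frame p c v x₀ y₀ r s α υ β γ)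
    (hY : RelationsIn (NotRow p x₀ y₀ r) Y)
    (hZ : ∀ x y, RowSet x₀ r α υ x y → Z x y = Y x (shiftRow x₀ α (y₀ + 1) x y))
    (hZ₀ : ∀ x y, ¬ RowSet x₀ r α υ x y → Z x y = 0) : RelationsIn p Z := by
  intro x₁ x₂ y₁ y₂ hR
  have h2 := h.two_le_r
  have h3 := h.two_le_s
  have hrow := h.row
  have hcol := h.col
  have hx := hR.1
  have hy := hR.2.1
  have hzero : (y₁ = υ ∨ y₂ = υ) → x₀ ≤ x₁ → x₂ ≤ x₀ + r + 1 →
      Z x₁ y₁ * Z x₂ y₂ = Z x₁ y₂ * Z x₂ y₁ := by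
    intro e a b
    have a₁ := hZ₀ x₁ υ (fun hS => hS.1 ⟨rfl, by omega, by omega⟩)
    have a₂ := hZ₀ x₂ υ (fun hS => hS.1 ⟨rfl, by omega, by omega⟩)
    rcases e with rfl | rfl <;> simp only [a₁, a₂, mul_zero, zero_mul]
  have hfix : RectangleIn (NotRow p x₀ y₀ r) x₁ x₂ y₁ y₂ → (∀ x y, (x = x₁ ∨ x = x₂) →
      (y = y₁ ∨ y = y₂) → RowSet x₀ r α υ x y ∧ ¬ ((x = x₀ ∨ x = x₀ + 1) ∧ y = α)) →
      Z x₁ y₁ * Z x₂ y₂ = Z x₁ y₂ * Z x₂ y₁ := by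
    intro hR' hS
    have key : ∀ x y, (x = x₁ ∨ x = x₂) → (y = y₁ ∨ y = y₂) → Z x y = Y x y := by
      intro x y a b
      rw [hZ x y (hS x y a b).1, shiftRow_of_not (hS x y a b).2]
    rw [key _ _ (Or.inl rfl) (Or.inl rfl), key _ _ (Or.inl rfl) (Or.inr rfl),
      key _ _ (Or.inr rfl) (Or.inl rfl), key _ _ (Or.inr rfl) (Or.inr rfl)]
    exact hY _ _ _ _ hR'
  rcases h.rectangle_cases hR with h' | h' | h' | h' | h'
  · exact hzero (by omega) (by omega) (by omega)
  · by_cases e : y₁ = υ ∨ y₂ = υ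
    · exact hzero e (by omega) (by omega)
    by_cases e₁ : y₁ = α
    · rw [hZ x₁ y₁ (by unfold RowSet; omega), hZ x₁ y₂ (by unfold RowSet; omega),
        hZ x₂ y₁ (by unfold RowSet; omega), hZ x₂ y₂ (by unfold RowSet; omega),
        shiftRow_of ⟨by omega, e₁⟩, shiftRow_of ⟨by omega, e₁⟩, shiftRow_of_not (by omega),
        shiftRow_of_not (by omega)]
      refine hY _ _ _ _ ⟨hx, by omega, fun x y a b a' b' => ⟨?_, by omega⟩⟩
      exact (h.mem x y).2 (Or.inr (Or.inl ⟨by omega, by omega, by omega⟩))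
    · refine hfix ⟨hx, hy, fun x y a b a' b' => ⟨hR.2.2 x y a b a' b', by omega⟩⟩ ?_
      intro x y a b
      exact ⟨by unfold RowSet; omega, by omega⟩
  · obtain ⟨v1, v2, v3, v4⟩ := h.vertex_of_rectangle h'
    refine hfix ⟨hx, hy, fun x y a b a' b' => ⟨hR.2.2 x y a b a' b',
      h.not_row_of_cell (h'.2.2 x y a b a' b')⟩⟩ ?_
    intro x y a b
    have hv : v x y := by rcases a with rfl | rfl <;> rcases b with rfl | rfl <;> assumption
    exact ⟨h.rowSet_of_vertex hv, h.not_shift_of_vertex hv (by omega)⟩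
  · obtain ⟨e₁, e₂, h'⟩ := h'
    exact hzero (by tauto) (by omega) (by omega)
  · obtain ⟨e₁, e₂, h'⟩ := h'
    refine hfix ⟨hx, hy, fun x y a b a' b' => ⟨hR.2.2 x y a b a' b', by omega⟩⟩ ?_
    intro x y a b
    exact ⟨by unfold RowSet; omega, by omega⟩

/-! ### Removing both arms -/

theorem relationsIn_of_notArms (h : Frame p c v x₀ y₀ r s α υ β γ) (hY : RelationsIn c Y)
    (hZ : ∀ x y, v x y → Z x y = Y x y) (hZ₀ : ∀ x y, ¬ v x y → Z x y = 0) :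
    RelationsIn p Z := by
  intro x₁ x₂ y₁ y₂ hR
  have h2 := h.two_le_r
  have h3 := h.two_le_s
  have hrow := h.row
  have hcol := h.col
  have hx := hR.1
  have hy := hR.2.1
  have krow : (y₁ = υ ∨ y₂ = υ) → x₀ ≤ x₁ → x₂ ≤ x₀ + r + 1 →
      Z x₁ y₁ * Z x₂ y₂ = Z x₁ y₂ * Z x₂ y₁ := by
    intro e a b
    have key : ∀ x, x₀ ≤ x → x ≤ x₀ + r + 1 → Z x υ = 0 := by
      intro x a b
      refine hZ₀ _ _ fun hv => ?_
      have := h.row_inter _ _ hv ⟨⟨a, b⟩, by omega⟩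
      omega
    have a₁ := key x₁ (by omega) (by omega)
    have a₂ := key x₂ (by omega) (by omega)
    rcases e with rfl | rfl <;> simp only [a₁, a₂, mul_zero, zero_mul]
  have kcol : (x₁ = γ ∨ x₂ = γ) → y₀ ≤ y₁ → y₂ ≤ y₀ + s + 1 →
      Z x₁ y₁ * Z x₂ y₂ = Z x₁ y₂ * Z x₂ y₁ := by
    intro e a b
    have key : ∀ y, y₀ ≤ y → y ≤ y₀ + s + 1 → Z γ y = 0 := by
      intro y a b
      refine hZ₀ _ _ fun hv => ?_
      have := h.col_inter _ _ hv ⟨⟨a, b⟩, by omega⟩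
      omega
    have a₁ := key y₁ (by omega) (by omega)
    have a₂ := key y₂ (by omega) (by omega)
    rcases e with rfl | rfl <;> simp only [a₁, a₂, mul_zero, zero_mul]
  rcases h.rectangle_cases hR with h' | h' | h' | h' | h'
  · exact krow (by omega) (by omega) (by omega)
  · exact kcol (by omega) (by omega) (by omega)
  · obtain ⟨v1, v2, v3, v4⟩ := h.vertex_of_rectangle h'
    rw [hZ _ _ v1, hZ _ _ v2, hZ _ _ v3, hZ _ _ v4]
    exact hY _ _ _ _ h'
  · obtain ⟨e₁, e₂, h'⟩ := h'
    exact krow (by tauto) (by omega) (by omega)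
  · obtain ⟨e₁, e₂, h'⟩ := h'
    exact kcol (by tauto) (by omega) (by omega)

/-! ### Removing the three cells around the corner -/

/-- The cells of `P` except the common cell of the arms and its two neighbours in the arms. -/
def NotCorner (p : ℤ → ℤ → Prop) (x₀ y₀ x y : ℤ) : Prop :=
  p x y ∧ ¬ (y = y₀ ∧ (x = x₀ ∨ x = x₀ + 1)) ∧ ¬ (x = x₀ ∧ y = y₀ + 1)

theorem vertexOf_notCorner_iff (h : Frame p c v x₀ y₀ r s α υ β γ) {x y : ℤ} :
    VertexOf (NotCorner p x₀ y₀) x y ↔ VertexOf p x y ∧ ¬ IsCorner x₀ y₀ x y := by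
  have h2 := h.two_le_r
  have h3 := h.two_le_s
  have hc : ∀ i j, c i j → NotCorner p x₀ y₀ i j := by
    intro i j hc
    have h1 := h.not_row_of_cell hc
    have h2 := h.swap.not_row_of_cell hc
    exact ⟨(h.mem i j).2 (Or.inr (Or.inr hc)), by omega, by omega⟩
  constructor
  · intro hv
    refine ⟨hv.imp And.left (Or.imp And.left (Or.imp And.left And.left)), ?_⟩
    have key : ∀ i j, NotCorner p x₀ y₀ i j → (x = i ∨ x = i + 1) → (y = j ∨ y = j + 1) →
        ¬ IsCorner x₀ y₀ x y := by
      rintro i j ⟨hp, hn⟩ hi hj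
      rw [h.mem] at hp
      rcases hp with hp | hp | hp
      · unfold IsCorner; omega
      · unfold IsCorner; omega
      · obtain ⟨v1, v2, v3, v4⟩ := h.vertex_of_cell hp
        apply h.not_isCorner_of_vertex
        rcases hi with rfl | rfl <;> rcases hj with rfl | rfl <;> assumption
    rcases hv with hv | hv | hv | hv
    exacts [key _ _ hv (by omega) (by omega), key _ _ hv (by omega) (by omega),
      key _ _ hv (by omega) (by omega), key _ _ hv (by omega) (by omega)]
  · rintro ⟨hv, hn⟩
    rw [vertexOf_iff h] at hv
    unfold IsCorner at hn
    rcases hv with hv | ⟨hx, hy⟩ | ⟨hy, hx⟩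
    · rw [h.vertex] at hv
      exact hv.imp (hc _ _) (Or.imp (hc _ _) (Or.imp (hc _ _) (hc _ _)))
    · exact vertexOf_of_row (a := x₀ + 2) (b := x₀ + r) (by omega)
        (fun x a b => ⟨(h.mem x y₀).2 (Or.inl ⟨rfl, by omega, b⟩), by omega, by omega⟩)
        (by omega) hy
    · exact vertexOf_swap.1 (vertexOf_of_row (q := fun x y => NotCorner p x₀ y₀ y x) (a := y₀ + 2)
        (b := y₀ + s) (by omega) (fun y a b => ⟨(h.mem x₀ y).2 (Or.inr (Or.inl ⟨rfl, by omega, b⟩)),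
          by omega, by omega⟩) (by omega) hx)

theorem relationsIn_of_notCorner (h : Frame p c v x₀ y₀ r s α υ β γ)
    (hY : RelationsIn (NotCorner p x₀ y₀) Y)
    (hZ : ∀ x y, ¬ IsCorner x₀ y₀ x y → Z x y = Y x y)
    (hZ₀ : ∀ x y, IsCorner x₀ y₀ x y → Z x y = 0) : RelationsIn p Z := by
  intro x₁ x₂ y₁ y₂ hR
  rcases h.rectangle_corner_cases hR with h' | h' | ⟨n1, n2, n3, n4, h'⟩
  · rw [hZ₀ x₁ y₁ ⟨h'.2.2, by omega⟩, hZ₀ x₁ y₂ ⟨h'.2.2, by omega⟩, zero_mul, zero_mul]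
  · rw [hZ₀ x₁ y₁ ⟨by omega, h'.2.2⟩, hZ₀ x₂ y₁ ⟨by omega, h'.2.2⟩, zero_mul, mul_zero]
  · rw [hZ _ _ n1, hZ _ _ n2, hZ _ _ n3, hZ _ _ n4]
    exact hY _ _ _ _ ⟨hR.1, hR.2.1, fun x y a b a' b' =>
      ⟨hR.2.2 x y a b a' b', h' x y a b a' b'⟩⟩

end Frame

/-! ### From predicates on ℤ² to finite sets of cells -/

section Bridge

variable {K : Type*} [Field K] {P P' C : Finset Cell}

theorem mem_vertices_iff {x y : ℤ} :
    (x, y) ∈ vertices P ↔ VertexOf (fun x y => (x, y) ∈ P) x y := by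
  simp only [vertices, Finset.mem_biUnion, cellVertices, Finset.mem_insert, Finset.mem_singleton,
    VertexOf]
  constructor
  · rintro ⟨⟨i, j⟩, hc, h⟩
    simp only [Prod.mk.injEq] at h
    rcases h with ⟨rfl, rfl⟩ | ⟨rfl, rfl⟩ | ⟨rfl, rfl⟩ | ⟨rfl, rfl⟩ <;>
      (try simp only [add_sub_cancel_right]) <;> tauto
  · rintro (h | h | h | h)
    exacts [⟨_, h, by simp⟩, ⟨_, h, by simp⟩, ⟨_, h, by simp⟩, ⟨_, h, by simp⟩]

theorem isInnerInterval_iff {a b : Vertex} :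
    IsInnerInterval P a b ↔ RectangleIn (fun x y => (x, y) ∈ P) a.1 b.1 a.2 b.2 := by
  unfold IsInnerInterval RectangleIn
  refine and_congr_right fun _ => and_congr_right fun _ => ⟨fun h x y a1 a2 a3 a4 => ?_, ?_⟩
  · exact h (Finset.mem_Icc.2 ⟨⟨a1, a3⟩, ⟨by dsimp only; omega, by dsimp only; omega⟩⟩)
  · rintro h ⟨x, y⟩ hxy
    obtain ⟨⟨h1, h2⟩, ⟨h3, h4⟩⟩ := Finset.mem_Icc.1 hxy
    dsimp only at h1 h2 h3 h4
    exact h x y h1 (by omega) h2 (by omega)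

theorem relationsIn_vertexVar :
    RelationsIn (fun x y => (x, y) ∈ P) fun x y => vertexVar K P (x, y) :=
  fun _ _ _ _ hR => vertexVar_mul (a := (_, _)) (b := (_, _)) (isInnerInterval_iff.2 hR)

/-- Here the relations are required for arbitrary values `Y`, so that purely geometric lemmas on
`RelationsIn` supply both the embedding and its retraction. -/
theorem embedding_of_relations [IsDomain (CoordinateRing K P)] {p' S : ℤ → ℤ → Prop}
    {φ ψ : ℤ → ℤ → ℤ × ℤ} (hp' : ∀ x y, (x, y) ∈ P' ↔ p' x y)
    (hφ : ∀ x y, VertexOf p' x y → VertexOf (fun x y => (x, y) ∈ P) (φ x y).1 (φ x y).2 ∧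
      S (φ x y).1 (φ x y).2 ∧ ψ (φ x y).1 (φ x y).2 = (x, y))
    (hψ : ∀ x y, VertexOf (fun x y => (x, y) ∈ P) x y → S x y →
      VertexOf p' (ψ x y).1 (ψ x y).2 ∧ φ (ψ x y).1 (ψ x y).2 = (x, y))
    (h₁ : ∀ Y : ℤ → ℤ → CoordinateRing K P, RelationsIn (fun x y => (x, y) ∈ P) Y →
      RelationsIn p' fun x y => Y (φ x y).1 (φ x y).2)
    (h₂ : ∀ Y Z : ℤ → ℤ → CoordinateRing K P', RelationsIn p' Y →
      (∀ x y, S x y → Z x y = Y (ψ x y).1 (ψ x y).2) → (∀ x y, ¬ S x y → Z x y = 0) →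
      RelationsIn (fun x y => (x, y) ∈ P) Z) :
    IsDomain (CoordinateRing K P') ∧ hilbertSeries K P' =
      monomialSeries (vertexVar K P) (vertices P ∩ {v : Vertex | S v.1 v.2}) := by
  classical
  obtain rfl : (fun x y => (x, y) ∈ P') = p' := by
    funext x y
    exact propext (hp' x y)
  refine isDomain_and_hilbertSeries_of_embedding (φ := fun v => φ v.1 v.2)
    (ψ := fun v => ψ v.1 v.2) (S := {v : Vertex | S v.1 v.2}) ?_ ?_ ?_ ?_
  · rintro ⟨x, y⟩ hv
    obtain ⟨a, b, c⟩ := hφ x y (mem_vertices_iff.1 hv)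
    exact ⟨mem_vertices_iff.2 a, b, c⟩
  · rintro ⟨x, y⟩ hv hS
    obtain ⟨a, b⟩ := hψ x y (mem_vertices_iff.1 hv) hS
    exact ⟨mem_vertices_iff.2 a, b⟩
  · intro a b hab
    exact h₁ _ relationsIn_vertexVar _ _ _ _ (isInnerInterval_iff.1 hab)
  · intro a b hab
    exact h₂ _ (fun x y => if S x y then vertexVar K P' (ψ x y) else 0) relationsIn_vertexVar
      (fun x y h => if_pos h) (fun x y h => if_neg h) _ _ _ _ (isInnerInterval_iff.1 hab)

theorem isRetract_of_frameClosed [IsDomain (CoordinateRing K P)] {S : ℤ → ℤ → Prop}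
    (h : Frame.Closed (fun x y => (x, y) ∈ P) S) :
    IsRetract (vertexVar K P) (vertices P) (vertices P ∩ {v : Vertex | S v.1 v.2}) :=
  isRetract_of_closed fun _ _ hab => h _ _ _ _ (isInnerInterval_iff.1 hab)

theorem mem_horizontalArm {A : Cell} {r : ℕ} {x y : ℤ} :
    (x, y) ∈ horizontalArm A r ↔ y = A.2 ∧ A.1 ≤ x ∧ x ≤ A.1 + r := by
  simp only [horizontalArm, cellRight, Finset.mem_Icc, Prod.le_def]
  omega

theorem mem_verticalArm {A : Cell} {s : ℕ} {x y : ℤ} :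
    (x, y) ∈ verticalArm A s ↔ x = A.1 ∧ A.2 ≤ y ∧ y ≤ A.2 + s := by
  simp only [verticalArm, cellUp, Finset.mem_Icc, Prod.le_def]
  omega

theorem mem_vertices_of_inRow {A : Cell} {r s : ℕ} {x y : ℤ} (h : InRow A.1 A.2 r x y) :
    (x, y) ∈ vertices (horizontalArm A r ∪ verticalArm A s) :=
  mem_vertices_iff.2 (Frame.vertexOf_of_row (a := A.1) (b := A.1 + r) (by omega)
    (fun _ a b => Finset.mem_union_left _ (mem_horizontalArm.2 ⟨rfl, a, b⟩)) h.1 h.2)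

theorem mem_vertices_of_inCol {A : Cell} {r s : ℕ} {x y : ℤ} (h : InRow A.2 A.1 s y x) :
    (x, y) ∈ vertices (horizontalArm A r ∪ verticalArm A s) :=
  mem_vertices_iff.2 (vertexOf_swap.1 (Frame.vertexOf_of_row
    (q := fun x y => (y, x) ∈ horizontalArm A r ∪ verticalArm A s) (a := A.2) (b := A.2 + s)
    (by omega) (fun _ a b => Finset.mem_union_right _ (mem_verticalArm.2 ⟨rfl, a, b⟩)) h.1 h.2))

/-- The four gluing patterns are the choices of the two parameters: `α` is the height of the $b_j$
or of the $c_j$, and `β` the abscissa of the $a_i$ or of the $d_i$. -/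
theorem IsLCPolyomino.exists_frame {A : Cell} {r s : ℕ} (hP : IsLCPolyomino P A r s C) :
    ∃ α υ β γ : ℤ, Frame (fun x y => (x, y) ∈ P) (fun x y => (x, y) ∈ C)
      (fun x y => (x, y) ∈ vertices C) A.1 A.2 r s α υ β γ := by
  have h2 := hP.two_le_r
  have h3 := hP.two_le_s
  have key : ∃ α υ β γ : ℤ, ((α = A.2 ∧ υ = A.2 + 1) ∨ (α = A.2 + 1 ∧ υ = A.2)) ∧
      ((β = A.1 ∧ γ = A.1 + 1) ∨ (β = A.1 + 1 ∧ γ = A.1)) ∧ ∀ x y : ℤ,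
        (x, y) ∈ vertices (horizontalArm A r ∪ verticalArm A s) ∩ vertices C ↔
          (x = β ∧ (y = A.2 + s ∨ y = A.2 + s + 1)) ∨
            (y = α ∧ (x = A.1 + r ∨ x = A.1 + r + 1)) := by
    rcases hP.inter with h | h | h | h
    · refine ⟨A.2 + 1, A.2, A.1 + 1, A.1, by omega, by omega, fun x y => ?_⟩
      rw [h]
      simp only [vertexA, vertexB, cellUp, cellRight, Finset.mem_insert, Finset.mem_singleton,
        Prod.mk.injEq]
      omega
    · refine ⟨A.2, A.2 + 1, A.1 + 1, A.1, by omega, by omega, fun x y => ?_⟩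
      rw [h]
      simp only [vertexA, vertexC, cellUp, cellRight, Finset.mem_insert, Finset.mem_singleton,
        Prod.mk.injEq]
      omega
    · refine ⟨A.2 + 1, A.2, A.1, A.1 + 1, by omega, by omega, fun x y => ?_⟩
      rw [h]
      simp only [vertexD, vertexB, cellUp, cellRight, Finset.mem_insert, Finset.mem_singleton,
        Prod.mk.injEq]
      omega
    · refine ⟨A.2, A.2 + 1, A.1, A.1 + 1, by omega, by omega, fun x y => ?_⟩
      rw [h]
      simp only [vertexD, vertexC, cellUp, cellRight, Finset.mem_insert, Finset.mem_singleton,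
        Prod.mk.injEq]
      omega
  obtain ⟨α, υ, β, γ, hα, hβ, hint⟩ := key
  refine ⟨α, υ, β, γ, ⟨by omega, by omega, hα, hβ, fun x y => ?_, fun x y => mem_vertices_iff,
    fun x y hv hi => ?_, fun x y hv hi => ?_, ⟨?_, ?_⟩, ⟨?_, ?_⟩⟩⟩
  · rw [hP.eq_union, Finset.mem_union, Finset.mem_union, mem_horizontalArm, mem_verticalArm,
      or_assoc]
  · have := (hint x y).1 (Finset.mem_inter.2 ⟨mem_vertices_of_inRow hi, hv⟩)
    obtain ⟨hi1, hi2⟩ := hi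
    omega
  · have := (hint x y).1 (Finset.mem_inter.2 ⟨mem_vertices_of_inCol hi, hv⟩)
    obtain ⟨hi1, hi2⟩ := hi
    omega
  · exact (Finset.mem_inter.1 ((hint _ _).2 (by omega))).2
  · exact (Finset.mem_inter.1 ((hint _ _).2 (by omega))).2
  · exact (Finset.mem_inter.1 ((hint _ _).2 (by omega))).2
  · exact (Finset.mem_inter.1 ((hint _ _).2 (by omega))).2

end Bridge

/-! ### Exchange relations along an arm -/

section Arms

variable {p c v : ℤ → ℤ → Prop} {x₀ y₀ r s α υ β γ : ℤ} {B : Type*} [CommRing B] {Y : ℤ → ℤ → B}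

/-- No order of `i` and `j` is assumed: exchanging them, or the roles of `α` and `υ`, only reverses
or commutes the minor, and `i = j` is trivial. -/
theorem Frame.row_relation (h : Frame p c v x₀ y₀ r s α υ β γ) (hY : RelationsIn p Y) {i j : ℤ}
    (hi : x₀ ≤ i ∧ i ≤ x₀ + r + 1) (hj : x₀ ≤ j ∧ j ≤ x₀ + r + 1) :
    Y i α * Y j υ = Y i υ * Y j α := by
  have key : ∀ i j, x₀ ≤ i → i < j → j ≤ x₀ + r + 1 →
      Y i y₀ * Y j (y₀ + 1) = Y i (y₀ + 1) * Y j y₀ := fun i j a b c' =>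
    hY i j y₀ (y₀ + 1) ⟨b, by omega, fun x y a b a' b' =>
      (h.mem x y).2 (Or.inl ⟨by omega, by omega, by omega⟩)⟩
  rcases lt_trichotomy i j with hij | rfl | hij
  · have := key i j hi.1 hij hj.2
    rcases h.row with ⟨rfl, rfl⟩ | ⟨rfl, rfl⟩
    exacts [this, this.symm]
  · exact mul_comm _ _
  · have := key j i hj.1 hij hi.2
    rcases h.row with ⟨rfl, rfl⟩ | ⟨rfl, rfl⟩
    · rw [mul_comm, ← this, mul_comm]
    · rw [mul_comm, this, mul_comm]

end Arms

/-! ### The faces of K[P] and their series -/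

section LC

open Polyomino.Frame

variable {K : Type*} [Field K] {P C : Finset Cell} {A : Cell} {r s : ℕ} {α υ β γ : ℤ}

/-- The frame of the `(L, C)`-polyomino `P` is given by the parameters `α`, `υ`, `β`, `γ`. -/
abbrev IsFrame (P C : Finset Cell) (A : Cell) (r s : ℕ) (α υ β γ : ℤ) : Prop :=
  Frame (fun x y => (x, y) ∈ P) (fun x y => (x, y) ∈ C) (fun x y => (x, y) ∈ vertices C)
    A.1 A.2 r s α υ β γ

/-- The vertices of `P` outside the detached side of the horizontal arm. -/
def rowFace (P : Finset Cell) (A : Cell) (r : ℕ) (υ : ℤ) : Set Vertex :=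
  (vertices P : Set Vertex) ∩ {v : Vertex | ¬ (v.2 = υ ∧ A.1 ≤ v.1 ∧ v.1 ≤ A.1 + r + 1)}

/-- The vertices of `P` outside the detached side of the vertical arm. -/
def colFace (P : Finset Cell) (A : Cell) (s : ℕ) (γ : ℤ) : Set Vertex :=
  (vertices P : Set Vertex) ∩ {v : Vertex | ¬ (v.1 = γ ∧ A.2 ≤ v.2 ∧ v.2 ≤ A.2 + s + 1)}

/-- The free vertices on the attached side of the horizontal arm. -/
noncomputable def freeRow (A : Cell) (r : ℕ) (α : ℤ) : Finset Vertex :=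
  Finset.Icc (A.1 + 2) (A.1 + r - 1) ×ˢ {α}

/-- The free vertices on the attached side of the vertical arm. -/
noncomputable def freeCol (A : Cell) (s : ℕ) (β : ℤ) : Finset Vertex :=
  {β} ×ˢ Finset.Icc (A.2 + 2) (A.2 + s - 1)

theorem mem_freeRow {v : Vertex} :
    v ∈ freeRow A r α ↔ (A.1 + 2 ≤ v.1 ∧ v.1 ≤ A.1 + r - 1) ∧ v.2 = α := by
  rw [freeRow, Finset.mem_product, Finset.mem_Icc, Finset.mem_singleton]

theorem mem_freeCol {v : Vertex} :
    v ∈ freeCol A s β ↔ v.1 = β ∧ (A.2 + 2 ≤ v.2 ∧ v.2 ≤ A.2 + s - 1) := by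
  rw [freeCol, Finset.mem_product, Finset.mem_Icc, Finset.mem_singleton]

theorem card_freeRow (hr : 2 ≤ r) : (freeRow A r α).card = r - 2 := by
  rw [freeRow, Finset.card_product, Finset.card_singleton, Int.card_Icc]
  omega

theorem card_freeCol (hs : 2 ≤ s) : (freeCol A s β).card = s - 2 := by
  rw [freeCol, Finset.card_product, Finset.card_singleton, Int.card_Icc]
  omega

namespace IsFrame

theorem mem_vertices (h : IsFrame P C A r s α υ β γ) {x y : ℤ} : (x, y) ∈ vertices P ↔
    (x, y) ∈ vertices C ∨ InRow A.1 A.2 r x y ∨ InRow A.2 A.1 s y x := by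
  rw [mem_vertices_iff, Frame.vertexOf_iff h]

section Faces

variable [IsDomain (CoordinateRing K P)]

/-- The set `T` is arbitrary because `monomialSeries_union` strips free variables one at a time and
needs every intermediate set to be a retract. -/
theorem isRetract_row (h : IsFrame P C A r s α υ β γ) {T : Set Vertex}
    (hT : T ⊆ vertices P) (hT' : ∀ v ∈ T, v.2 ≠ υ) :
    IsRetract (vertexVar K P) (vertices P)
      ((vertices P : Set Vertex) ∩ {v : Vertex | RowSet A.1 r α υ v.1 v.2} ∪ T) := by
  have h2 := h.two_le_r
  have h3 := h.two_le_s
  have hrow := h.row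
  have hcl : Frame.Closed (fun x y => (x, y) ∈ P)
      (fun x y => RowSet A.1 r α υ x y ∨ (x, y) ∈ T) := by
    refine Frame.closed_row h ?_ ?_ ?_
    · rintro x a b (hS | hS)
      · exact hS.1 ⟨rfl, a, b⟩
      · exact hT' _ hS rfl
    · intro x y a b c d
      exact Or.inl (by unfold RowSet; omega)
    · intro x y hv
      exact Or.inl (Frame.rowSet_of_vertex h hv)
  convert isRetract_of_frameClosed (K := K) hcl using 1
  ext v
  constructor
  · rintro (⟨h1, h2⟩ | h1)
    exacts [⟨h1, Or.inl h2⟩, ⟨hT h1, Or.inr h1⟩]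
  · rintro ⟨h1, h2 | h2⟩
    exacts [Or.inl ⟨h1, h2⟩, Or.inr h2]

theorem isRetract_col (h : IsFrame P C A r s α υ β γ) {T : Set Vertex}
    (hT : T ⊆ vertices P) (hT' : ∀ v ∈ T, v.1 ≠ γ) :
    IsRetract (vertexVar K P) (vertices P)
      ((vertices P : Set Vertex) ∩ {v : Vertex | RowSet A.2 s β γ v.2 v.1} ∪ T) := by
  have h2 := h.two_le_r
  have h3 := h.two_le_s
  have hcol := h.col
  have hcl : Frame.Closed (fun x y => (y, x) ∈ P)
      (fun x y => RowSet A.2 s β γ x y ∨ (y, x) ∈ T) := by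
    refine Frame.closed_row h.swap ?_ ?_ ?_
    · rintro x a b (hS | hS)
      · exact hS.1 ⟨rfl, a, b⟩
      · exact hT' _ hS rfl
    · intro x y a b c d
      exact Or.inl (by unfold RowSet; omega)
    · intro x y hv
      exact Or.inl (Frame.rowSet_of_vertex h.swap hv)
  convert isRetract_of_frameClosed (K := K) hcl.swap using 1
  ext v
  constructor
  · rintro (⟨h1, h2⟩ | h1)
    exacts [⟨h1, Or.inl h2⟩, ⟨hT h1, Or.inr h1⟩]
  · rintro ⟨h1, h2 | h2⟩
    exacts [Or.inl ⟨h1, h2⟩, Or.inr h2]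

theorem not_row_of_vertex (h : IsFrame P C A r s α υ β γ) {x y : ℤ} (hv : (x, y) ∈ vertices C) :
    ¬ (y = υ ∧ A.1 ≤ x ∧ x ≤ A.1 + r + 1) := (h.rowSet_of_vertex hv).1

theorem not_col_of_vertex (h : IsFrame P C A r s α υ β γ) {x y : ℤ} (hv : (x, y) ∈ vertices C) :
    ¬ (x = γ ∧ A.2 ≤ y ∧ y ≤ A.2 + s + 1) := (h.swap.rowSet_of_vertex hv).1

theorem isRetract_row_col (h : IsFrame P C A r s α υ β γ) {T : Set Vertex}
    (hT : T ⊆ vertices P) (hT' : ∀ v ∈ T, v.2 ≠ υ ∧ v.1 ≠ γ) :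
    IsRetract (vertexVar K P) (vertices P)
      ((vertices P : Set Vertex) ∩ {v : Vertex | (v.1, v.2) ∈ vertices C} ∪ T) := by
  have hcl : Frame.Closed (fun x y => (x, y) ∈ P)
      (fun x y => (x, y) ∈ vertices C ∨ (x, y) ∈ T) := by
    refine Frame.closed_row_col h ?_ ?_ ?_
    · rintro x a b (hS | hS)
      · exact h.not_row_of_vertex hS ⟨rfl, a, b⟩
      · exact (hT' _ hS).1 rfl
    · rintro y a b (hS | hS)
      · exact h.not_col_of_vertex hS ⟨rfl, a, b⟩
      · exact (hT' _ hS).2 rfl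
    · intro x y hv
      exact Or.inl hv
  convert isRetract_of_frameClosed (K := K) hcl using 1
  ext v
  constructor
  · rintro (⟨h1, h2⟩ | h1)
    exacts [⟨h1, Or.inl h2⟩, ⟨hT h1, Or.inr h1⟩]
  · rintro ⟨h1, h2 | h2⟩
    exacts [Or.inl ⟨h1, h2⟩, Or.inr h2]

end Faces

theorem rowFace_eq (h : IsFrame P C A r s α υ β γ) : rowFace P A r υ =
    (vertices P : Set Vertex) ∩ {v : Vertex | RowSet A.1 r α υ v.1 v.2} ∪
      (freeRow A r α : Set Vertex) := by
  have h2 := h.two_le_r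
  have hrow := h.row
  ext ⟨x, y⟩
  constructor
  · rintro ⟨hv, hn⟩
    by_cases e : (x, y) ∈ freeRow A r α
    · exact Or.inr e
    · refine Or.inl ⟨hv, hn, ?_⟩
      rw [mem_freeRow] at e
      dsimp only at e ⊢
      omega
  · rintro (⟨hv, hn⟩ | hv)
    · exact ⟨hv, hn.1⟩
    · rw [Finset.mem_coe, mem_freeRow] at hv
      dsimp only at hv
      exact ⟨h.mem_vertices.2 (Or.inr (Or.inl ⟨by omega, by omega⟩)), by
        rw [Set.mem_ofPred_eq]; dsimp only; omega⟩

theorem colFace_eq (h : IsFrame P C A r s α υ β γ) : colFace P A s γ =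
    (vertices P : Set Vertex) ∩ {v : Vertex | RowSet A.2 s β γ v.2 v.1} ∪
      (freeCol A s β : Set Vertex) := by
  have h2 := h.two_le_s
  have hcol := h.col
  ext ⟨x, y⟩
  constructor
  · rintro ⟨hv, hn⟩
    by_cases e : (x, y) ∈ freeCol A s β
    · exact Or.inr e
    · refine Or.inl ⟨hv, hn, ?_⟩
      rw [mem_freeCol] at e
      dsimp only at e ⊢
      omega
  · rintro (⟨hv, hn⟩ | hv)
    · exact ⟨hv, hn.1⟩
    · rw [Finset.mem_coe, mem_freeCol] at hv
      dsimp only at hv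
      exact ⟨h.mem_vertices.2 (Or.inr (Or.inr ⟨by omega, by omega⟩)), by
        rw [Set.mem_ofPred_eq]; dsimp only; omega⟩

/-- The free vertices of `P` outside the detached sides of the arms. -/
noncomputable def _root_.Polyomino.freeBoth (A : Cell) (r s : ℕ) (α β : ℤ) : Finset Vertex :=
  insert (β, α) (freeRow A r α ∪ freeCol A s β)

theorem mem_freeBoth {v : Vertex} : v ∈ freeBoth A r s α β ↔ (v.1 = β ∧ v.2 = α) ∨
    ((A.1 + 2 ≤ v.1 ∧ v.1 ≤ A.1 + r - 1) ∧ v.2 = α) ∨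
    (v.1 = β ∧ (A.2 + 2 ≤ v.2 ∧ v.2 ≤ A.2 + s - 1)) := by
  rw [freeBoth, Finset.mem_insert, Finset.mem_union, mem_freeRow, mem_freeCol, Prod.ext_iff]

theorem card_freeBoth (h : IsFrame P C A r s α υ β γ) :
    (freeBoth A r s α β).card = r + s - 3 := by
  have h2 := h.two_le_r
  have h3 := h.two_le_s
  have hrow := h.row
  have hcol := h.col
  rw [freeBoth, Finset.card_insert_of_notMem, Finset.card_union_of_disjoint,
    card_freeRow (by omega), card_freeCol (by omega)]
  · omega
  · rw [Finset.disjoint_left]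
    intro v hv hv'
    rw [mem_freeRow] at hv
    rw [mem_freeCol] at hv'
    omega
  · rw [Finset.mem_union, mem_freeRow, mem_freeCol]
    dsimp only
    omega

theorem freeBoth_subset (h : IsFrame P C A r s α υ β γ) : freeBoth A r s α β ⊆ vertices P := by
  have hrow := h.row
  have hcol := h.col
  have h2 := h.two_le_r
  have h3 := h.two_le_s
  rintro ⟨x, y⟩ hv
  rw [mem_freeBoth] at hv
  dsimp only at hv
  rw [h.mem_vertices]
  unfold InRow
  omega

theorem rowFace_inter_colFace_eq (h : IsFrame P C A r s α υ β γ) :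
    rowFace P A r υ ∩ colFace P A s γ =
      (vertices P : Set Vertex) ∩ {v : Vertex | (v.1, v.2) ∈ vertices C} ∪
        (freeBoth A r s α β : Set Vertex) := by
  have hrow := h.row
  have hcol := h.col
  have h2 := h.two_le_r
  have h3 := h.two_le_s
  ext ⟨x, y⟩
  constructor
  · rintro ⟨⟨hv, hn⟩, ⟨-, hn'⟩⟩
    by_cases e : (x, y) ∈ vertices C
    · exact Or.inl ⟨hv, e⟩
    · right
      rw [Finset.mem_coe, mem_freeBoth]
      rw [Set.mem_ofPred_eq] at hn hn'
      dsimp only at hn hn' ⊢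
      have e₁ : ¬ (x = A.1 + r ∧ y = α) := by
        rintro ⟨rfl, rfl⟩; exact e h.row_mem.1
      have e₂ : ¬ (x = A.1 + r + 1 ∧ y = α) := by
        rintro ⟨rfl, rfl⟩; exact e h.row_mem.2
      have e₃ : ¬ (x = β ∧ y = A.2 + s) := by
        rintro ⟨rfl, rfl⟩; exact e h.col_mem.1
      have e₄ : ¬ (x = β ∧ y = A.2 + s + 1) := by
        rintro ⟨rfl, rfl⟩; exact e h.col_mem.2
      rcases h.mem_vertices.1 hv with hv | ⟨hx, hy⟩ | ⟨hy, hx⟩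
      · exact absurd hv e
      · clear e₃ e₄
        have hy' : y = α := by omega
        by_cases hx' : A.1 + 2 ≤ x
        · exact Or.inr (Or.inl ⟨⟨hx', by omega⟩, hy'⟩)
        · exact Or.inl ⟨by omega, hy'⟩
      · clear e₁ e₂
        have hx' : x = β := by omega
        by_cases hy' : A.2 + 2 ≤ y
        · exact Or.inr (Or.inr ⟨hx', hy', by omega⟩)
        · exact Or.inl ⟨hx', by omega⟩
  · rintro (⟨hv, hC⟩ | hv)
    · exact ⟨⟨hv, h.not_row_of_vertex hC⟩, ⟨hv, h.not_col_of_vertex hC⟩⟩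
    · have hV := h.freeBoth_subset hv
      rw [Finset.mem_coe, mem_freeBoth] at hv
      dsimp only at hv
      refine ⟨⟨hV, ?_⟩, ⟨hV, ?_⟩⟩ <;> rw [Set.mem_ofPred_eq] <;> dsimp only <;> omega

section Series

theorem forall_vertexVar_ne_zero : ∀ v ∈ (vertices P : Set Vertex), vertexVar K P v ≠ 0 :=
  fun _ hv => vertexVar_ne_zero hv

variable [IsDomain (CoordinateRing K P)]

/-- `RowSet` carries the monomials of the polyomino without the horizontal arm, up to sliding one
edge. The rest of the face consists of the `r - 2` vertices of the attached side lying neither on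
the vertical arm nor on `C`; they are free. -/
theorem rowFace_series (h : IsFrame P C A r s α υ β γ) :
    IsDomain (CoordinateRing K (P \ horizontalArm A r)) ∧
      monomialSeries (vertexVar K P) (rowFace P A r υ) * (1 - PowerSeries.X) ^ (r - 2) =
        hilbertSeries K (P \ horizontalArm A r) := by
  have h2 := h.two_le_r
  have hrow := h.row
  obtain ⟨hdom, hs⟩ := embedding_of_relations (K := K) (P := P) (P' := P \ horizontalArm A r)
    (p' := NotRow (fun x y => (x, y) ∈ P) A.1 A.2 r) (S := RowSet A.1 r α υ)
    (φ := fun x y => (x, shiftRow A.1 (A.2 + 1) α x y))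
    (ψ := fun x y => (x, shiftRow A.1 α (A.2 + 1) x y))
    (fun x y => by rw [Finset.mem_sdiff, mem_horizontalArm]; rfl)
    (fun x y hv => by
      obtain ⟨a, b, c⟩ := h.shiftRow_mem hv
      exact ⟨a, b, Prod.ext rfl c⟩)
    (fun x y hv hS => by
      obtain ⟨a, b⟩ := h.shiftRow_mem' hv hS
      exact ⟨a, Prod.ext rfl b⟩)
    (fun Y hY => h.relationsIn_shiftRow hY)
    (fun Y Z hY hZ hZ₀ => h.relationsIn_of_notRow hY hZ hZ₀)
  refine ⟨hdom, ?_⟩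
  have hsub : ∀ v ∈ freeRow A r α, v ∈ vertices P := fun v hv => by
    rw [mem_freeRow] at hv
    exact h.mem_vertices.2 (Or.inr (Or.inl ⟨by omega, by omega⟩))
  rw [hs, h.rowFace_eq, ← card_freeRow (A := A) (α := α) (by omega : 2 ≤ r)]
  refine monomialSeries_union forall_vertexVar_ne_zero (vertices P).finite_toSet _ hsub ?_ ?_
  · intro v hv hS
    rw [mem_freeRow] at hv
    exact hS.2.2 ⟨hv.2, by omega⟩
  · intro T hT
    exact h.isRetract_row (fun v hv => hsub v (hT hv)) fun v hv => by
      have := mem_freeRow.1 (hT hv)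
      omega

theorem colFace_series (h : IsFrame P C A r s α υ β γ) :
    IsDomain (CoordinateRing K (P \ verticalArm A s)) ∧
      monomialSeries (vertexVar K P) (colFace P A s γ) * (1 - PowerSeries.X) ^ (s - 2) =
        hilbertSeries K (P \ verticalArm A s) := by
  have h2 := h.two_le_s
  have hcol := h.col
  obtain ⟨hdom, hs⟩ := embedding_of_relations (K := K) (P := P) (P' := P \ verticalArm A s)
    (p' := fun x y => NotRow (fun x y => (y, x) ∈ P) A.2 A.1 s y x)
    (S := fun x y => RowSet A.2 s β γ y x)
    (φ := fun x y => (shiftRow A.2 (A.1 + 1) β y x, y))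
    (ψ := fun x y => (shiftRow A.2 β (A.1 + 1) y x, y))
    (fun x y => by rw [Finset.mem_sdiff, mem_verticalArm]; rfl)
    (fun x y hv => by
      obtain ⟨a, b, c⟩ := h.swap.shiftRow_mem (vertexOf_swap.2 hv)
      exact ⟨vertexOf_swap.1 a, b, Prod.ext c rfl⟩)
    (fun x y hv hS => by
      obtain ⟨a, b⟩ := h.swap.shiftRow_mem' (vertexOf_swap.2 hv) hS
      exact ⟨vertexOf_swap.1 a, Prod.ext b rfl⟩)
    (fun Y hY => (h.swap.relationsIn_shiftRow hY.swap).swap)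
    (fun Y Z hY hZ hZ₀ => (h.swap.relationsIn_of_notRow hY.swap (fun x y => hZ y x)
      (fun x y => hZ₀ y x)).swap)
  refine ⟨hdom, ?_⟩
  have hsub : ∀ v ∈ freeCol A s β, v ∈ vertices P := fun v hv => by
    rw [mem_freeCol] at hv
    exact h.mem_vertices.2 (Or.inr (Or.inr ⟨by omega, by omega⟩))
  rw [hs, h.colFace_eq, ← card_freeCol (A := A) (β := β) (by omega : 2 ≤ s)]
  refine monomialSeries_union forall_vertexVar_ne_zero (vertices P).finite_toSet _ hsub ?_ ?_
  · intro v hv hS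
    rw [mem_freeCol] at hv
    exact hS.2.2 ⟨hv.1, by omega⟩
  · intro T hT
    exact h.isRetract_col (fun v hv => hsub v (hT hv)) fun v hv => by
      have := mem_freeCol.1 (hT hv)
      omega

/-- Besides the vertices of `C`, the intersection contains `r - 2` and `s - 2` free vertices on the
attached sides and the corner `(β, α)`, whence the exponent `r + s - 3`. -/
theorem rowFace_inter_colFace_series (h : IsFrame P C A r s α υ β γ) :
    IsDomain (CoordinateRing K C) ∧
      monomialSeries (vertexVar K P) (rowFace P A r υ ∩ colFace P A s γ) *
        (1 - PowerSeries.X) ^ (r + s - 3) = hilbertSeries K C := by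
  have h2 := h.two_le_r
  have h3 := h.two_le_s
  have hrow := h.row
  have hcol := h.col
  have hVC : ∀ x y, VertexOf (fun x y => (x, y) ∈ C) x y ↔ (x, y) ∈ vertices C :=
    fun x y => mem_vertices_iff.symm
  obtain ⟨hdom, hs⟩ := embedding_of_relations (K := K) (P := P) (P' := C)
    (p' := fun x y => (x, y) ∈ C) (S := fun x y => (x, y) ∈ vertices C)
    (φ := fun x y => (x, y)) (ψ := fun x y => (x, y)) (fun x y => Iff.rfl)
    (fun x y hv => by
      rw [hVC] at hv
      exact ⟨mem_vertices_iff.1 (h.mem_vertices.2 (Or.inl hv)), hv, rfl⟩)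
    (fun x y hv hS => ⟨(hVC x y).2 hS, rfl⟩)
    (fun Y hY x₁ x₂ y₁ y₂ hR => hY _ _ _ _ ⟨hR.1, hR.2.1, fun x y a b a' b' =>
      (h.mem x y).2 (Or.inr (Or.inr (hR.2.2 x y a b a' b')))⟩)
    (fun Y Z hY hZ hZ₀ => h.relationsIn_of_notArms hY hZ hZ₀)
  refine ⟨hdom, ?_⟩
  have hsub := h.freeBoth_subset
  rw [hs, h.rowFace_inter_colFace_eq, ← h.card_freeBoth]
  refine monomialSeries_union forall_vertexVar_ne_zero (vertices P).finite_toSet _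
    (fun v hv => hsub hv) ?_ ?_
  · rintro ⟨x, y⟩ hv ⟨-, hS⟩
    rw [mem_freeBoth] at hv
    dsimp only at hv
    have e₁ := h.row_inter x y hS
    have e₂ := h.col_inter x y hS
    unfold InRow at e₁ e₂
    omega
  · intro T hT
    exact h.isRetract_row_col (fun v hv => hsub (hT hv)) fun v hv => by
      have := mem_freeBoth.1 (hT hv)
      omega

theorem notCorner_series (h : IsFrame P C A r s α υ β γ) :
    IsDomain (CoordinateRing K (P \ {A, cellRight A 1, cellUp A 1})) ∧
      monomialSeries (vertexVar K P)
        ((vertices P : Set Vertex) ∩ {v : Vertex | ¬ IsCorner A.1 A.2 v.1 v.2}) =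
        hilbertSeries K (P \ {A, cellRight A 1, cellUp A 1}) := by
  obtain ⟨hdom, hs⟩ := embedding_of_relations (K := K) (P := P)
    (P' := P \ {A, cellRight A 1, cellUp A 1})
    (p' := NotCorner (fun x y => (x, y) ∈ P) A.1 A.2)
    (S := fun x y => ¬ IsCorner A.1 A.2 x y)
    (φ := fun x y => (x, y)) (ψ := fun x y => (x, y)) (fun x y => by
      rw [Finset.mem_sdiff]
      refine and_congr_right fun _ => ?_
      simp only [cellRight, cellUp, Finset.mem_insert, Finset.mem_singleton, Prod.ext_iff]
      omega)
    (fun x y hv => by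
      rw [h.vertexOf_notCorner_iff] at hv
      exact ⟨hv.1, hv.2, rfl⟩)
    (fun x y hv hS => ⟨h.vertexOf_notCorner_iff.2 ⟨hv, hS⟩, rfl⟩)
    (fun Y hY x₁ x₂ y₁ y₂ hR => hY _ _ _ _ ⟨hR.1, hR.2.1, fun x y a b a' b' =>
      (hR.2.2 x y a b a' b').1⟩)
    (fun Y Z hY hZ hZ₀ => h.relationsIn_of_notCorner hY hZ fun x y hc => hZ₀ x y (not_not.2 hc))
  exact ⟨hdom, hs.symm⟩

/-- This is `monomialSeries_decomposition` with `p = (γ, υ)`, `q = (γ, α)`, `q' = (β, υ)`, `o = (β,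
α)`; the exchange hypotheses are the minors of the arms. -/
theorem hilbertSeries_mul_one_sub_X (h : IsFrame P C A r s α υ β γ) :
    hilbertSeries K P * (1 - PowerSeries.X) =
      hilbertSeries K (P \ {A, cellRight A 1, cellUp A 1}) +
        PowerSeries.X * (monomialSeries (vertexVar K P) (rowFace P A r υ) +
          monomialSeries (vertexVar K P) (colFace P A s γ) +
          monomialSeries (vertexVar K P) (rowFace P A r υ ∩ colFace P A s γ)) := by
  have h2 := h.two_le_r
  have h3 := h.two_le_s
  have hrow := h.row
  have hcol := h.col
  have hW₄ : (vertices P : Set Vertex) \ {(γ, υ), (γ, α), (β, υ), (β, α)} =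
      (vertices P : Set Vertex) ∩ {v : Vertex | ¬ IsCorner A.1 A.2 v.1 v.2} := by
    ext ⟨x, y⟩
    refine and_congr_right fun _ => not_congr ?_
    simp only [Set.mem_insert_iff, Set.mem_singleton_iff, Prod.mk.injEq, Frame.IsCorner]
    omega
  have hrowV : ∀ x y, A.1 ≤ x → x ≤ A.1 + r + 1 → (y = A.2 ∨ y = A.2 + 1) → (x, y) ∈ vertices P :=
    fun x y a b e => h.mem_vertices.2 (Or.inr (Or.inl ⟨⟨a, b⟩, e⟩))
  have hcolV : ∀ x y, A.2 ≤ y → y ≤ A.2 + s + 1 → (x = A.1 ∨ x = A.1 + 1) → (x, y) ∈ vertices P :=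
    fun x y a b e => h.mem_vertices.2 (Or.inr (Or.inr ⟨⟨a, b⟩, e⟩))
  have hR := relationsIn_vertexVar (K := K) (P := P)
  rw [hilbertSeries_eq, ← h.notCorner_series.2, ← hW₄]
  refine monomialSeries_decomposition (V₀ := (vertices P : Set Vertex)) forall_vertexVar_ne_zero
    (vertices P).finite_toSet (hrowV _ _ (by omega) (by omega) (by omega)) ?_ ?_ ?_ ?_
    ⟨hrowV _ _ (by omega) (by omega) (by omega), ?_⟩ (fun hm => hm.2 ⟨rfl, ?_⟩)
    (fun hm => hm.2 ⟨rfl, ?_⟩) ⟨hrowV _ _ (by omega) (by omega) (by omega), ?_⟩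
    (fun hm => hm.2 ⟨rfl, ?_⟩) (fun hm => hm.2 ⟨rfl, ?_⟩)
    ⟨hrowV _ _ (by omega) (by omega) (by omega), ?_⟩
    ⟨hrowV _ _ (by omega) (by omega) (by omega), ?_⟩ ?_ ?_ ?_ ?_
  · rw [h.rowFace_eq]
    refine h.isRetract_row (fun v hv => ?_) fun v hv => ?_
    · have := mem_freeRow.1 hv
      exact hrowV _ _ (by omega) (by omega) (by omega)
    · have := mem_freeRow.1 hv
      omega
  · rw [h.colFace_eq]
    refine h.isRetract_col (fun v hv => ?_) fun v hv => ?_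
    · have := mem_freeCol.1 hv
      exact hcolV _ _ (by omega) (by omega) (by omega)
    · have := mem_freeCol.1 hv
      omega
  · rw [h.rowFace_inter_colFace_eq]
    refine h.isRetract_row_col (fun v hv => h.freeBoth_subset hv) fun v hv => ?_
    have := mem_freeBoth.1 hv
    omega
  · rw [hW₄]
    exact isRetract_of_frameClosed h.closed_not_isCorner
  iterate 8 (try rw [Set.mem_ofPred_eq]); dsimp only; omega
  all_goals
    rintro ⟨x, y⟩ hv hn
  · have hn : y = υ ∧ A.1 ≤ x ∧ x ≤ A.1 + r + 1 := by
      by_contra hn'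
      exact hn ⟨hv, hn'⟩
    obtain ⟨rfl, hx⟩ := hn
    refine ⟨(x, α), hrowV _ _ hx.1 hx.2 (by omega), ?_⟩
    exact h.row_relation hR (by omega) hx
  · have hn : x = γ ∧ A.2 ≤ y ∧ y ≤ A.2 + s + 1 := by
      by_contra hn'
      exact hn ⟨hv, hn'⟩
    obtain ⟨rfl, hy⟩ := hn
    refine ⟨(β, y), hcolV _ _ hy.1 hy.2 (by omega), ?_⟩
    exact h.swap.row_relation hR.swap (by omega) hy
  · have hn : y = υ ∧ A.1 ≤ x ∧ x ≤ A.1 + r + 1 := by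
      by_contra hn'
      exact hn ⟨hv, hn'⟩
    obtain ⟨rfl, hx⟩ := hn
    refine ⟨(x, α), hrowV _ _ hx.1 hx.2 (by omega), ?_⟩
    exact h.row_relation hR (by omega) hx
  · have hn : x = γ ∧ A.2 ≤ y ∧ y ≤ A.2 + s + 1 := by
      by_contra hn'
      exact hn ⟨hv, hn'⟩
    obtain ⟨rfl, hy⟩ := hn
    refine ⟨(β, y), hcolV _ _ hy.1 hy.2 (by omega), ?_⟩
    exact h.swap.row_relation hR.swap (by omega) hy

end Series

end IsFrame

end LC

/-! ### Counting vertices and cells -/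

section Counting

open Polyomino.Frame

theorem Frame.card_vertexOf_row {p c v : ℤ → ℤ → Prop} {x₀ y₀ s α υ β γ : ℤ} {r : ℕ}
    (h : Frame p c v x₀ y₀ r s α υ β γ) {W W' : Finset Vertex}
    (hW : ∀ x y, (x, y) ∈ W ↔ VertexOf p x y)
    (hW' : ∀ x y, (x, y) ∈ W' ↔ VertexOf (NotRow p x₀ y₀ r) x y) : W.card = W'.card + 2 * r := by
  classical
  have h2 := h.two_le_r
  have hrow := h.row
  have e₁ : W'.card = (W.filter fun v => RowSet x₀ r α υ v.1 v.2).card := by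
    refine Finset.card_bij' (fun v _ => (v.1, shiftRow x₀ (y₀ + 1) α v.1 v.2))
      (fun v _ => (v.1, shiftRow x₀ α (y₀ + 1) v.1 v.2)) ?_ ?_ ?_ ?_
    · rintro ⟨x, y⟩ hv
      have := h.shiftRow_mem ((hW' x y).1 hv)
      exact Finset.mem_filter.2 ⟨(hW _ _).2 this.1, this.2.1⟩
    · rintro ⟨x, y⟩ hv
      obtain ⟨hv, hS⟩ := Finset.mem_filter.1 hv
      exact (hW' _ _).2 (h.shiftRow_mem' ((hW x y).1 hv) hS).1
    · rintro ⟨x, y⟩ hv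
      exact Prod.ext rfl (h.shiftRow_mem ((hW' x y).1 hv)).2.2
    · rintro ⟨x, y⟩ hv
      obtain ⟨hv, hS⟩ := Finset.mem_filter.1 hv
      exact Prod.ext rfl (h.shiftRow_mem' ((hW x y).1 hv) hS).2
  -- The lost vertices are the `r + 2` on the detached side and the `r - 2` free ones, `2 * r` in
  -- all.
  have e₂ : (W.filter fun v => ¬ RowSet x₀ r α υ v.1 v.2) =
      Finset.Icc x₀ (x₀ + r + 1) ×ˢ {υ} ∪ Finset.Icc (x₀ + 2) (x₀ + r - 1) ×ˢ {α} := by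
    ext ⟨x, y⟩
    rw [Finset.mem_filter, Finset.mem_union, Finset.mem_product, Finset.mem_product, Finset.mem_Icc,
      Finset.mem_Icc, Finset.mem_singleton, Finset.mem_singleton, hW, h.vertexOf_iff]
    unfold RowSet
    dsimp only
    constructor
    · rintro ⟨-, hS⟩
      omega
    · intro hS
      exact ⟨Or.inr (Or.inl ⟨by omega, by omega⟩), by omega⟩
  have e₃ : (W.filter fun v => ¬ RowSet x₀ r α υ v.1 v.2).card = 2 * r := by
    rw [e₂, Finset.card_union_of_disjoint, Finset.card_product, Finset.card_product,
      Finset.card_singleton, Finset.card_singleton, Int.card_Icc, Int.card_Icc]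
    · omega
    · rw [Finset.disjoint_left]
      rintro ⟨x, y⟩ a b
      have a' := Finset.mem_singleton.1 (Finset.mem_product.1 a).2
      have b' := Finset.mem_singleton.1 (Finset.mem_product.1 b).2
      dsimp only at a' b'
      omega
  rw [← Finset.card_filter_add_card_filter_not fun v : Vertex => RowSet x₀ r α υ v.1 v.2, e₁, e₃]

variable {P C : Finset Cell} {A : Cell} {r s : ℕ} {α υ β γ : ℤ}

theorem card_horizontalArm : (horizontalArm A r).card = r + 1 := by
  rw [show horizontalArm A r = Finset.Icc A.1 (A.1 + r) ×ˢ {A.2} from ?_, Finset.card_product,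
    Finset.card_singleton, Int.card_Icc]
  · omega
  · ext ⟨x, y⟩
    rw [mem_horizontalArm, Finset.mem_product, Finset.mem_Icc, Finset.mem_singleton, and_comm]

theorem card_verticalArm : (verticalArm A s).card = s + 1 := by
  rw [show verticalArm A s = {A.1} ×ˢ Finset.Icc A.2 (A.2 + s) from ?_, Finset.card_product,
    Finset.card_singleton, Int.card_Icc]
  · omega
  · ext ⟨x, y⟩
    rw [mem_verticalArm, Finset.mem_product, Finset.mem_Icc, Finset.mem_singleton]

theorem card_arms : (horizontalArm A r ∪ verticalArm A s).card = r + s + 1 := by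
  have h := Finset.card_union_add_card_inter (horizontalArm A r) (verticalArm A s)
  have e : horizontalArm A r ∩ verticalArm A s = {A} := by
    ext ⟨x, y⟩
    rw [Finset.mem_inter, mem_horizontalArm, mem_verticalArm, Finset.mem_singleton, Prod.ext_iff]
    dsimp only
    omega
  rw [e, card_horizontalArm, card_verticalArm, Finset.card_singleton] at h
  omega

namespace IsFrame

theorem card_sdiff_horizontalArm (h : IsFrame P C A r s α υ β γ) :
    (P \ horizontalArm A r).card + (r + 1) = P.card := by
  rw [← card_horizontalArm (A := A) (r := r)]
  refine Finset.card_sdiff_add_card_eq_card ?_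
  rintro ⟨x, y⟩ hx
  exact (h.mem x y).2 (Or.inl (mem_horizontalArm.1 hx))

theorem card_sdiff_verticalArm (h : IsFrame P C A r s α υ β γ) :
    (P \ verticalArm A s).card + (s + 1) = P.card := by
  rw [← card_verticalArm (A := A) (s := s)]
  refine Finset.card_sdiff_add_card_eq_card ?_
  rintro ⟨x, y⟩ hx
  exact (h.mem x y).2 (Or.inr (Or.inl (mem_verticalArm.1 hx)))

theorem card_sdiff_corner (h : IsFrame P C A r s α υ β γ) :
    (P \ {A, cellRight A 1, cellUp A 1}).card + 3 = P.card := by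
  have h2 := h.two_le_r
  have h3 := h.two_le_s
  have e : ({A, cellRight A 1, cellUp A 1} : Finset Cell).card = 3 := by
    refine Finset.card_eq_three.2 ⟨_, _, _, ?_, ?_, ?_, rfl⟩ <;>
      simp only [cellRight, cellUp, ne_eq, Prod.ext_iff] <;> omega
  rw [← e]
  refine Finset.card_sdiff_add_card_eq_card ?_
  rintro ⟨x, y⟩ hx
  simp only [cellRight, cellUp, Finset.mem_insert, Finset.mem_singleton, Prod.ext_iff] at hx
  rw [h.mem x y]
  omega

theorem card_vertices_row (h : IsFrame P C A r s α υ β γ) :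
    (vertices P).card = (vertices (P \ horizontalArm A r)).card + 2 * r := by
  refine Frame.card_vertexOf_row h (fun x y => mem_vertices_iff) fun x y => ?_
  rw [mem_vertices_iff]
  have : (fun x y => (x, y) ∈ P \ horizontalArm A r) =
      NotRow (fun x y => (x, y) ∈ P) A.1 A.2 r := by
    funext x y
    rw [Finset.mem_sdiff, mem_horizontalArm]
    rfl
  rw [this]

theorem card_vertices_col (h : IsFrame P C A r s α υ β γ) :
    (vertices P).card = (vertices (P \ verticalArm A s)).card + 2 * s := by
  have hmem : ∀ (Q : Finset Cell) (x y : ℤ),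
      (x, y) ∈ (vertices Q).map (Equiv.prodComm ℤ ℤ).toEmbedding ↔
        VertexOf (fun x y => (y, x) ∈ Q) x y := by
    intro Q x y
    rw [vertexOf_swap (p := fun x y => (x, y) ∈ Q), ← mem_vertices_iff, Finset.mem_map_equiv]
    rfl
  have := Frame.card_vertexOf_row h.swap (hmem P) (W' :=
    (vertices (P \ verticalArm A s)).map (Equiv.prodComm ℤ ℤ).toEmbedding) fun x y => by
      rw [hmem]
      have : (fun x y => (y, x) ∈ P \ verticalArm A s) =
          NotRow (fun x y => (y, x) ∈ P) A.2 A.1 s := by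
        funext x y
        rw [Finset.mem_sdiff, mem_verticalArm]
        rfl
      rw [this]
  rwa [Finset.card_map, Finset.card_map] at this

theorem card_vertices_corner (h : IsFrame P C A r s α υ β γ) :
    (vertices P).card = (vertices (P \ {A, cellRight A 1, cellUp A 1})).card + 4 := by
  have h2 := h.two_le_r
  have e₁ : vertices (P \ {A, cellRight A 1, cellUp A 1}) =
      vertices P \ ({A.1, A.1 + 1} ×ˢ {A.2, A.2 + 1}) := by
    ext ⟨x, y⟩
    have : (fun x y => (x, y) ∈ P \ {A, cellRight A 1, cellUp A 1}) =
        NotCorner (fun x y => (x, y) ∈ P) A.1 A.2 := by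
      funext x y
      rw [Finset.mem_sdiff]
      refine propext (and_congr_right fun _ => ?_)
      simp only [cellRight, cellUp, Finset.mem_insert, Finset.mem_singleton, Prod.ext_iff]
      omega
    rw [mem_vertices_iff, this, h.vertexOf_notCorner_iff, Finset.mem_sdiff, mem_vertices_iff]
    refine and_congr_right fun _ => not_congr ?_
    simp only [Finset.mem_product, Finset.mem_insert, Finset.mem_singleton, Frame.IsCorner]
  have e₂ : (({A.1, A.1 + 1} : Finset ℤ) ×ˢ ({A.2, A.2 + 1} : Finset ℤ)).card = 4 := by
    rw [Finset.card_product, Finset.card_pair (by omega), Finset.card_pair (by omega)]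
  rw [e₁, ← e₂]
  refine (Finset.card_sdiff_add_card_eq_card ?_).symm
  rintro ⟨x, y⟩ hx
  simp only [Finset.mem_product, Finset.mem_insert, Finset.mem_singleton] at hx
  exact h.mem_vertices.2 (Or.inr (Or.inl ⟨by omega, hx.2⟩))

theorem card_vertices_arms (h : IsFrame P C A r s α υ β γ) :
    (vertices P).card = (vertices C).card + (2 * r + 2 * s) := by
  have h2 := h.two_le_r
  have h3 := h.two_le_s
  have hrow := h.row
  have hcol := h.col
  set R : Finset Vertex := Finset.Icc A.1 (A.1 + r + 1) ×ˢ {υ} with hR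
  -- Erasing `υ` omits the corner `(γ, υ)`, which is already counted in `R`.
  set L : Finset Vertex := {γ} ×ˢ (Finset.Icc A.2 (A.2 + s + 1)).erase υ with hL
  have mR : ∀ x y, (x, y) ∈ R ↔ (A.1 ≤ x ∧ x ≤ A.1 + r + 1) ∧ y = υ := fun x y => by
    rw [hR, Finset.mem_product, Finset.mem_Icc, Finset.mem_singleton]
  have mL : ∀ x y, (x, y) ∈ L ↔ x = γ ∧ y ≠ υ ∧ A.2 ≤ y ∧ y ≤ A.2 + s + 1 := fun x y => by
    rw [hL, Finset.mem_product, Finset.mem_erase, Finset.mem_Icc, Finset.mem_singleton]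
  have cR : R.card = r + 2 := by
    rw [hR, Finset.card_product, Finset.card_singleton, Int.card_Icc]
    omega
  have cL : L.card = s + 1 := by
    rw [hL, Finset.card_product, Finset.card_singleton, Finset.card_erase_of_mem, Int.card_Icc]
    · omega
    · rw [Finset.mem_Icc]
      omega
  have hdRL : Disjoint R L := by
    rw [Finset.disjoint_left]
    rintro ⟨x, y⟩ a b
    exact ((mL x y).1 b).2.1 ((mR x y).1 a).2
  have hdF : Disjoint (R ∪ L) (freeBoth A r s α β) := by
    rw [Finset.disjoint_left]
    rintro ⟨x, y⟩ a b
    rw [Finset.mem_union, mR, mL] at a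
    rw [mem_freeBoth] at b
    dsimp only at b
    omega
  have hdC : Disjoint (vertices C) (R ∪ L ∪ freeBoth A r s α β) := by
    rw [Finset.disjoint_left]
    rintro ⟨x, y⟩ a b
    have e₁ := h.row_inter x y a
    have e₂ := h.col_inter x y a
    rw [Finset.mem_union, Finset.mem_union, mR, mL, mem_freeBoth] at b
    dsimp only at b
    unfold InRow at e₁ e₂
    omega
  have hV : vertices P = vertices C ∪ (R ∪ L ∪ freeBoth A r s α β) := by
    ext ⟨x, y⟩
    rw [Finset.mem_union]
    constructor
    · intro hv
      by_cases hR' : y = υ ∧ A.1 ≤ x ∧ x ≤ A.1 + r + 1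
      · exact Or.inr (Finset.mem_union_left _ (Finset.mem_union_left _ ((mR x y).2 hR'.symm)))
      by_cases hL' : x = γ ∧ A.2 ≤ y ∧ y ≤ A.2 + s + 1
      · have : y ≠ υ := by
          rintro rfl
          exact hR' ⟨rfl, by omega, by omega⟩
        exact Or.inr (Finset.mem_union_left _ (Finset.mem_union_right _
          ((mL x y).2 ⟨hL'.1, this, hL'.2⟩)))
      have := h.rowFace_inter_colFace_eq.subset (show (x, y) ∈ _ from ⟨⟨hv, hR'⟩, ⟨hv, hL'⟩⟩)
      rcases this with ⟨-, hC⟩ | hF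
      · exact Or.inl hC
      · exact Or.inr (Finset.mem_union_right _ hF)
    · rintro (hv | hv)
      · exact h.mem_vertices.2 (Or.inl hv)
      · rcases Finset.mem_union.1 hv with hv | hv
        · rcases Finset.mem_union.1 hv with hv | hv
          · rw [mR] at hv
            exact h.mem_vertices.2 (Or.inr (Or.inl ⟨hv.1, by omega⟩))
          · rw [mL] at hv
            exact h.mem_vertices.2 (Or.inr (Or.inr ⟨hv.2.2, by omega⟩))
        · exact h.freeBoth_subset hv
  rw [hV, Finset.card_union_of_disjoint hdC, Finset.card_union_of_disjoint hdF,
    Finset.card_union_of_disjoint hdRL, cR, cL, h.card_freeBoth]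
  omega

end IsFrame

end Counting

/-! ### Assembly of the formula -/

theorem IsLCPolyomino.sdiff_arms {P C : Finset Cell} {A : Cell} {r s : ℕ}
    (hP : IsLCPolyomino P A r s C) : P \ (horizontalArm A r ∪ verticalArm A s) = C := by
  rw [hP.eq_union, Finset.union_sdiff_left]
  exact hP.disjoint.symm.sdiff_eq_left

theorem IsLCPolyomino.card_arms_add {P C : Finset Cell} {A : Cell} {r s : ℕ}
    (hP : IsLCPolyomino P A r s C) : P.card = C.card + (r + s + 1) := by
  rw [hP.eq_union, Finset.card_union_of_disjoint hP.disjoint, card_arms, add_comm]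

end Polyomino

open Polyomino

theorem mainTheorem5 (K : Type*) [Field K] (P C : Finset Polyomino.Cell) (A : Polyomino.Cell)
    (r s : ℕ) (hP : Polyomino.IsLCPolyomino P A r s C)
    (hprime : (Polyomino.polyominoIdeal K P).IsPrime)
    (hC : Polyomino.IsSimple C) :
    (∃ h₁ h₂ h₃ h₄ : Polynomial ℤ,
      Polyomino.IsHPolynomial K (P \ Polyomino.horizontalArm A r) h₁ ∧
      Polyomino.IsHPolynomial K (P \ Polyomino.verticalArm A s) h₂ ∧
      Polyomino.IsHPolynomial K
        (P \ (Polyomino.horizontalArm A r ∪ Polyomino.verticalArm A s)) h₃ ∧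
      Polyomino.IsHPolynomial K
        (P \ {A, Polyomino.cellRight A 1, Polyomino.cellUp A 1}) h₄ ∧
      Polyomino.hilbertSeries K P *
          (1 - PowerSeries.X) ^ ((Polyomino.vertices P).card - P.card) =
        ((h₄ + Polynomial.X * (h₁ + h₂ + (1 - Polynomial.X) * h₃) : Polynomial ℤ) :
          PowerSeries ℤ)) ∧
    ringKrullDim (Polyomino.CoordinateRing K P) =
      (((Polyomino.vertices P).card - P.card : ℕ) : WithBot ℕ∞) := by
  have : IsDomain (CoordinateRing K P) := Ideal.Quotient.isDomain _
  refine ⟨?_, ringKrullDim_coordinateRing⟩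
  obtain ⟨α, υ, β, γ, h⟩ := hP.exists_frame
  replace h : IsFrame P C A r s α υ β γ := h
  obtain ⟨d₁, s₁⟩ := h.rowFace_series (K := K)
  obtain ⟨d₂, s₂⟩ := h.colFace_series (K := K)
  obtain ⟨d₃, s₃⟩ := h.rowFace_inter_colFace_series (K := K)
  obtain ⟨d₄, -⟩ := h.notCorner_series (K := K)
  obtain ⟨h₁, H₁, e₁⟩ := exists_isHPolynomial K (P \ horizontalArm A r)
  obtain ⟨h₂, H₂, e₂⟩ := exists_isHPolynomial K (P \ verticalArm A s)
  obtain ⟨h₃, H₃, e₃⟩ := exists_isHPolynomial K C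
  obtain ⟨h₄, H₄, e₄⟩ := exists_isHPolynomial K (P \ {A, cellRight A 1, cellUp A 1})
  rw [hP.sdiff_arms]
  refine ⟨h₁, h₂, h₃, h₄, H₁, H₂, H₃, H₄, ?_⟩
  have hr := hP.two_le_r
  have hs := hP.two_le_s
  have v₁ := h.card_vertices_row
  have v₂ := h.card_vertices_col
  have v₃ := h.card_vertices_arms
  have v₄ := h.card_vertices_corner
  have p₁ := h.card_sdiff_horizontalArm
  have p₂ := h.card_sdiff_verticalArm
  have p₃ := hP.card_arms_add
  have p₄ := h.card_sdiff_corner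
  have l₁ := card_le_card_vertices (P \ horizontalArm A r)
  have l₂ := card_le_card_vertices (P \ verticalArm A s)
  have l₃ := card_le_card_vertices C
  have l₄ := card_le_card_vertices (P \ {A, cellRight A 1, cellUp A 1})
  set D₁ := (vertices (P \ horizontalArm A r)).card - (P \ horizontalArm A r).card
  set D₂ := (vertices (P \ verticalArm A s)).card - (P \ verticalArm A s).card
  set D₃ := (vertices C).card - C.card
  set D₄ := (vertices (P \ {A, cellRight A 1, cellUp A 1})).card -
    (P \ {A, cellRight A 1, cellUp A 1}).card with hD₄
  -- The Krull dimensions of the pieces, enlarged by their free variables, equal `D₄` for the two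
  -- one-arm faces but only `D₄ - 1` for the face of `C`.
  have k : (vertices P).card - P.card = 1 + D₄ := by omega
  have k₁ : D₄ = (r - 2) + D₁ := by omega
  have k₂ : D₄ = (s - 2) + D₂ := by omega
  have k₃ : D₄ = (r + s - 3) + D₃ + 1 := by omega
  rw [← s₁, mul_assoc, ← pow_add, ← k₁] at e₁
  rw [← s₂, mul_assoc, ← pow_add, ← k₂] at e₂
  rw [← s₃, mul_assoc, ← pow_add] at e₃
  -- The missing unit in the pole order is the source of the factor $1-t$ in front of `h₃`.
  have e₃' : monomialSeries (vertexVar K P) (rowFace P A r υ ∩ colFace P A s γ) *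
      (1 - PowerSeries.X) ^ D₄ = (1 - PowerSeries.X) * (h₃ : PowerSeries ℤ) := by
    rw [← e₃, k₃, pow_succ]
    ring
  rw [k, pow_add, pow_one, ← mul_assoc, h.hilbertSeries_mul_one_sub_X, add_mul, mul_assoc, add_mul,
    add_mul, e₁, e₂, e₃', e₄]
  push_cast
  rfl
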